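/- **Conventions.** A $\mathcal{TC}^0$ circuit is a layered circuit of unbounded fan-in majority gates: every wire comes from a node of the preceding layer (the inputs, for the first layer) or from the constant $1$, and may be negated; a gate outputs $1$ iff more than half of its incoming wires carry $1$. The depth is the number of layers, the size is measured by the number of wires, and the outputs are the gates of the last layer. The relative weight of $y\in\mathbb{F}_2^m$ is the fraction of its non-zero entries. An algorithm is a random access machine (finitely many registers and arrays of natural numbers; assignment, addition, truncated subtraction, tests, at unit cost) that writes an explicit description of a circuit; a number $n$ is given in a register, and a rational number by its numerator and denominator. **Proposition.** The following hold. 1. (Constant relative distance.) There are a universal constant $c>0$ and an algorithm such that for every integer $d\ge1$ there are constants $A,k$ (depending only on $d$) such that for every $n\ge1$, on input $(n,d)$ the algorithm outputs, within $A\,n^{k}$ steps, a $\mathcal{TC}^0$ circuit of depth $2d$ with at most $A\,n^{1+c/d}$ wires that computes an $\mathbb{F}_2$-linear map $f:\mathbb{F}_2^n\to\mathbb{F}_2^{\hat n}$ with $\hat n\le A\,n$, such that $f(x)$ has relative weight at least $3^{-d}$ for every $x\ne0$. 2. (Amplification of the distance.) There are a universal constant $c>0$ and an algorithm such that for every rational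 $\rho\in(0,1]$ there are constants $A,k$ (depending only on $\rho$) such that for every $\hat n\ge1$ and every rational $\varepsilon\in(0,1/2)$, on input $(\hat n,\rho,\varepsilon)$ the algorithm outputs, within $A(\hat n+1/\varepsilon)^{k}$ steps, a $\mathcal{TC}^0$ circuit of depth $2$ with at most $\hat n\cdot(1/\varepsilon)^{c/\rho}$ wires that computes an $\mathbb{F}_2$-linear map $f:\mathbb{F}_2^{\hat n}\to\mathbb{F}_2^{\bar n}$ with $\bar n\le\hat n\cdot(1/\varepsilon)^{c/\rho}$, such that for every $x\in\mathbb{F}_2^{\hat n}$ of relative weight at least $\rho$, the relative weight of $f(x)$ is between $1/2-\varepsilon$ and $1/2$. 3. ($\varepsilon$-balanced code in sparse $\mathcal{TC}^0$.) There are a universal constant $c>0$ and an algorithm such that for every integer $d\ge1$ there are constants $A,k$ (depending only on $d$) such that for every $n\ge1$ and every rational $\varepsilon\in(0,1/2)$, on input $(n,d,\varepsilon)$ the algorithm outputs, within $A(n+1/\varepsilon)^{k}$ steps, a $\mathcal{TC}^0$ circuit of depth $2d$ with at most $n^{1+c/d}+n\cdot(1/\varepsilon)^{c\cdot3^d}$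 wires that computes a linear code $f:\mathbb{F}_2^n\to\mathbb{F}_2^{\bar n}$ with $\bar n\le n\cdot(1/\varepsilon)^{c\cdot3^d}$, such that for every $x\ne0$ the relative weight of $f(x)$ lies in $[1/2-\varepsilon,\,1/2+\varepsilon]$. -/

import Mathlib

namespace SparseTC

/-! ### Layered circuits of majority gates -/

/-- An incoming wire of a gate. Its source is a node of the previous layer (the inputs of the
circuit, for the first layer), given by its index, or the constant `1` (`none`). The value that it
carries may be negated. -/
structure Wire where
  source : Option ℕ
  negated : Bool

/-- The value carried by a wire, when the nodes of the previous layer have the values `v`. -/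
def Wire.eval (v : List Bool) (w : Wire) : Bool :=
  xor w.negated (match w.source with
    | none => true
    | some i => v.getD i false)

/-- A majority gate of unbounded fan-in, given by its incoming wires (parallel wires are allowed,
and are counted separately). -/
abbrev Gate := List Wire

/-- A gate outputs `1` iff more than half of its incoming wires carry the value `1`. -/
def Gate.eval (v : List Bool) (g : Gate) : Bool :=
  decide (g.length < 2 * g.countP (fun w => w.eval v))

/-- A layered circuit of majority gates: the list of its layers, each of them a list of gates, the
layer next to the inputs first. The gates of the last layer are the output gates. -/
abbrev Circuit := List (List Gate)

namespace Circuit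

/-- The number of layers of gates. -/
def depth (C : Circuit) : ℕ := C.length

/-- The number of wires, that is, the sum of the fan-ins of all the gates. -/
def wires (C : Circuit) : ℕ := (C.map fun L => (L.map List.length).sum).sum

/-- Every wire of a circuit over `n` inputs comes from an existing node. -/
def WellFormed : ℕ → Circuit → Prop
  | _, [] => True
  | n, L :: C =>
      (∀ g ∈ L, ∀ w ∈ g, ∀ i : ℕ, w.source = some i → i < n) ∧ WellFormed L.length C

/-- The list of values of the output gates, on the list of input bits `v`. -/
def eval : Circuit → List Bool → List Bool
  | [], v => v
  | L :: C, v => eval C (L.map (Gate.eval v))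

/-- The bit corresponding to an element of the field with two elements. -/
def toBit (a : ZMod 2) : Bool := decide (a = 1)

/-- The circuit `C` has `n` inputs and `m` outputs, and it computes the function `f`. -/
def Computes (C : Circuit) {n m : ℕ} (f : (Fin n → ZMod 2) → (Fin m → ZMod 2)) : Prop :=
  C.WellFormed n ∧
    ∀ x : Fin n → ZMod 2,
      C.eval (List.ofFn fun i => toBit (x i)) = List.ofFn fun j => toBit (f x j)

/-- The description of a wire by a natural number that is at least `2`. -/
def wireCode (w : Wire) : ℕ :=
  2 + 2 * (match w.source with
    | none => 0
    | some i => i + 1) + (if w.negated then 1 else 0)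

/-- The explicit description of a circuit as a list of natural numbers: all the wires, gate by gate
and layer by layer, where `0` marks the end of a gate and `1` marks the end of a layer. -/
def encode (C : Circuit) : List ℕ :=
  C.flatMap fun L => (L.flatMap fun g => g.map wireCode ++ [0]) ++ [1]

end Circuit

/-- The relative Hamming weight of a vector of bits. -/
noncomputable def relWeight {m : ℕ} (y : Fin m → ZMod 2) : ℝ := (hammingNorm y : ℝ) / (m : ℝ)

/-! ### Algorithms: random access machines with a step count

A machine has finitely many registers and finitely many arrays of natural numbers (those that its
program mentions), and a write-only output tape. Every elementary instruction and every test takes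
one step. The arithmetic instructions are addition and truncated subtraction only, so that in `t`
steps the bit lengths of the numbers involved grow by at most `t` over those of the inputs and of
the constants of the program: such a machine is polynomially equivalent to a Turing machine. -/

/-- Programs. Registers and arrays are named by natural numbers. -/
inductive Prog where
  | skip : Prog
  /-- `x := v`, for a fixed number `v` -/
  | const (x v : ℕ) : Prog
  /-- `x := y` -/
  | copy (x y : ℕ) : Prog
  /-- `x := y + z` -/
  | add (x y z : ℕ) : Prog
  /-- `x := max (y - z) 0` -/
  | sub (x y z : ℕ) : Prog
  /-- `x := a[y]` -/
  | load (x a y : ℕ) : Prog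
  /-- `a[x] := y` -/
  | store (a x y : ℕ) : Prog
  /-- append the value of `x` to the output tape -/
  | emit (x : ℕ) : Prog
  | seq (p q : Prog) : Prog
  /-- if `x ≠ 0` then `p` else `q` -/
  | ite (x : ℕ) (p q : Prog) : Prog
  /-- while `x ≠ 0` do `p` -/
  | loop (x : ℕ) (p : Prog) : Prog

/-- The contents of the registers, of the arrays, and of the output tape. -/
structure State where
  reg : ℕ → ℕ
  arr : ℕ → ℕ → ℕ
  out : List ℕ

/-- Assignment to a register. -/
def State.setReg (s : State) (x v : ℕ) : State :=
  { s with reg := Function.update s.reg x v }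

/-- Assignment to a cell of an array. -/
def State.setArr (s : State) (a i v : ℕ) : State :=
  { s with arr := Function.update s.arr a (Function.update (s.arr a) i v) }

/-- Appending a number to the output tape. -/
def State.push (s : State) (v : ℕ) : State :=
  { s with out := s.out ++ [v] }

/-- `Exec p s t s'`: started in the state `s`, the program `p` halts after exactly `t` steps, in the
state `s'`. -/
inductive Exec : Prog → State → ℕ → State → Prop where
  | skip (s : State) : Exec .skip s 1 s
  | const (s : State) (x v : ℕ) : Exec (.const x v) s 1 (s.setReg x v)
  | copy (s : State) (x y : ℕ) : Exec (.copy x y) s 1 (s.setReg x (s.reg y))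
  | add (s : State) (x y z : ℕ) : Exec (.add x y z) s 1 (s.setReg x (s.reg y + s.reg z))
  | sub (s : State) (x y z : ℕ) : Exec (.sub x y z) s 1 (s.setReg x (s.reg y - s.reg z))
  | load (s : State) (x a y : ℕ) : Exec (.load x a y) s 1 (s.setReg x (s.arr a (s.reg y)))
  | store (s : State) (a x y : ℕ) : Exec (.store a x y) s 1 (s.setArr a (s.reg x) (s.reg y))
  | emit (s : State) (x : ℕ) : Exec (.emit x) s 1 (s.push (s.reg x))
  | seq {p q : Prog} {s s₁ s₂ : State} {t₁ t₂ : ℕ} (hp : Exec p s t₁ s₁) (hq : Exec q s₁ t₂ s₂) :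
      Exec (.seq p q) s (t₁ + t₂) s₂
  | iteTrue {x : ℕ} {p q : Prog} {s s₁ : State} {t : ℕ} (hx : s.reg x ≠ 0) (hp : Exec p s t s₁) :
      Exec (.ite x p q) s (t + 1) s₁
  | iteFalse {x : ℕ} {p q : Prog} {s s₁ : State} {t : ℕ} (hx : s.reg x = 0) (hq : Exec q s t s₁) :
      Exec (.ite x p q) s (t + 1) s₁
  | loopStop {x : ℕ} {p : Prog} {s : State} (hx : s.reg x = 0) : Exec (.loop x p) s 1 s
  | loopStep {x : ℕ} {p : Prog} {s s₁ s₂ : State} {t₁ t₂ : ℕ} (hx : s.reg x ≠ 0)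
      (hp : Exec p s t₁ s₁) (hl : Exec (.loop x p) s₁ t₂ s₂) :
      Exec (.loop x p) s (t₁ + t₂ + 1) s₂

/-- The initial state: the numbers of the input stand in the registers `0, 1, 2, …`, everything else
is zero, and the output tape is empty. -/
def initState (input : List ℕ) : State where
  reg := fun i => input.getD i 0
  arr := fun _ _ => 0
  out := []

/-- On the given input, the program halts after exactly `t` steps, and its output is the explicit
description of the circuit `C`. -/
def Prog.OutputsCircuit (P : Prog) (input : List ℕ) (t : ℕ) (C : Circuit) : Prop :=
  ∃ s : State, Exec P (initState input) t s ∧ s.out = C.encode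

end SparseTC

/-! A linear map whose output bits are sums of at most `W` input bits is computed by two layers of
majority gates: thresholds of each sum, then a majority of the thresholds with alternating negations
(`eval_thresholdGate`, `eval_parityGate`). This costs at most `4 * W ^ 2` wires per output bit, so
it remains to find explicit codes that factor into `d` sparse linear maps. Three constructions
supply them.

Amplification. Place the entries of a vector on the vertices of a Margulis-type expander on the
torus, and output the sum over every subset of the vertices of every walk of length `t`. If the walk
meets the support, a random subset is balanced; otherwise all the sums vanish. So the bias of the
output is the probability that a random walk avoids the support. It is nonnegative, hence the weight
is at most 1/2, and by the spectral gap `sum_sq_le_energy` it decays exponentially in `t`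
(`weight_walk_bounds`). This is item 2.

Base code. A message is read as a polynomial `p` over a field of characteristic two, and the
codeword lists the pairs `(p α, α * p α)`, as in Justesen codes. Where `p α` is not zero the pair
determines `α`, so few pairs can have small weight, and the relative distance is a positive constant
(`weight_codeTable`). The fields are explicit, since the trinomials with exponents `2 * 3 ^ l`, `3 ^
l`, `0` are irreducible (`irreducible_trinomial`). A walk of constant length raises the distance to
1/3 (`weight_baseTable`).

Tensor power. With messages of length `N`, about the `d`th root of `n`, the `d`th tensor power of
the base code has relative distance `3 ^ (-d)` and is a product of `d` maps with rows of length
`O(N)` (`weight_chainMap_tensor`). Merging a final random walk into the last factor balances the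
code at depth `2 * d`. The number of wires is about `n * N ^ 2 * Y` with `Y` a power of `1 / ε`, and
`n * z ^ 2 * Y ≤ n * z ^ 4 + n * Y ^ 2` splits it into the two required terms. This is item 3, and
item 1 is its case `ε = 1 / 6`.

Running time. `PolyTime` measures time against the values of the numbers, not their bit lengths, so
naive loops suffice for arithmetic. Two things do not fit this calculus. Powers such as `3 ^ d` are
not polynomial in `d`; they are capped at a number `M`, and `Emits.exists_search` looks for an `M`
that is large enough. The denominator of `ε` may be far larger than `1 / ε`; so only a logarithm of
`1 / ε` is extracted, by repeated doubling (`exec_logProg`). -/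

namespace SparseTC
open Finset

/-! ### Polynomial time computations on tuples of numbers -/

/-- Types whose elements are tuples of natural numbers. -/
class Ctx (Γ : Type) where
  /-- the length of the tuples -/
  arity : ℕ
  /-- the entries of a tuple -/
  get : Γ → ℕ → ℕ

namespace Ctx

instance instNat : Ctx ℕ := ⟨1, fun x _ => x⟩

instance instProd {Γ Δ : Type} [Ctx Γ] [Ctx Δ] : Ctx (Γ × Δ) :=
  ⟨arity Γ + arity Δ, fun p i => if i < arity Γ then get p.1 i else get p.2 (i - arity Γ)⟩

/-- The sum of the entries of a tuple. -/
def size {Γ : Type} [Ctx Γ] (γ : Γ) : ℕ := ∑ i ∈ range (arity Γ), get γ i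

/-- The registers from `o` on contain the tuple `γ`. -/
def At {Γ : Type} [Ctx Γ] (s : State) (o : ℕ) (γ : Γ) : Prop :=
  ∀ i < arity Γ, s.reg (o + i) = get γ i

@[simp] theorem arity_nat : arity ℕ = 1 := rfl

@[simp] theorem arity_prod {Γ Δ : Type} [Ctx Γ] [Ctx Δ] : arity (Γ × Δ) = arity Γ + arity Δ := rfl

@[simp] theorem size_nat (n : ℕ) : size n = n := by
  change ∑ i ∈ range 1, n = n
  simp

@[simp] theorem size_prod {Γ Δ : Type} [Ctx Γ] [Ctx Δ] (p : Γ × Δ) :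
    size p = size p.1 + size p.2 := by
  change ∑ i ∈ range (arity Γ + arity Δ),
    (if i < arity Γ then get p.1 i else get p.2 (i - arity Γ)) = _
  rw [sum_range_add]
  congr 1
  · exact sum_congr rfl fun i hi => by simp [mem_range.1 hi]
  · exact sum_congr rfl fun i _ => by simp

theorem at_nat {s : State} {o n : ℕ} : At s o n ↔ s.reg o = n :=
  ⟨fun h => h 0 Nat.one_pos, fun h i hi => by
    have : i = 0 := Nat.lt_one_iff.1 hi
    subst this; exact h⟩

theorem at_prod {Γ Δ : Type} [Ctx Γ] [Ctx Δ] {s : State} {o : ℕ} {p : Γ × Δ} :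
    At s o p ↔ At s o p.1 ∧ At s (o + arity Γ) p.2 := by
  constructor
  · intro h
    refine ⟨fun i hi => ?_, fun i hi => ?_⟩
    · have := h i (by simp; omega)
      rw [this]; change (if i < arity Γ then _ else _) = _; simp [hi]
    · have := h (arity Γ + i) (by simp; omega)
      rw [add_assoc, this]; change (if _ < arity Γ then _ else _) = _; simp
  · rintro ⟨h₁, h₂⟩ i hi
    change _ = (if i < arity Γ then _ else _)
    rw [arity_prod] at hi
    split_ifs with h
    · exact h₁ i h
    · have := h₂ (i - arity Γ) (by omega)
      rw [← this]; congr 1; omega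

theorem At.congr {Γ : Type} [Ctx Γ] {s s' : State} {o b : ℕ} {γ : Γ} (h : At s o γ)
    (hb : o + arity Γ ≤ b) (hs : ∀ i < b, s'.reg i = s.reg i) : At s' o γ :=
  fun i hi => by rw [hs _ (by omega), h i hi]

end Ctx

open Ctx

variable {Γ Δ Θ : Type} [Ctx Γ] [Ctx Δ] [Ctx Θ]

/-- Functions that are bounded by a polynomial in the size of the tuple. -/
def PolyBound (T : Γ → ℕ) : Prop := ∃ C, ∀ γ, T γ ≤ (size γ + 2) ^ C

namespace PolyBound

theorem mono {S T : Γ → ℕ} (hT : PolyBound T) (h : ∀ γ, S γ ≤ T γ) : PolyBound S :=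
  let ⟨C, hC⟩ := hT; ⟨C, fun γ => (h γ).trans (hC γ)⟩

theorem const (c : ℕ) : PolyBound (fun _ : Γ => c) :=
  ⟨c, fun γ => (Nat.lt_two_pow_self).le.trans (Nat.pow_le_pow_left (by omega) c)⟩

theorem size : PolyBound (fun γ : Γ => size γ) := ⟨1, fun γ => by simp⟩

theorem mul {S T : Γ → ℕ} (hS : PolyBound S) (hT : PolyBound T) :
    PolyBound (fun γ => S γ * T γ) := by
  obtain ⟨C, hC⟩ := hS
  obtain ⟨D, hD⟩ := hT
  exact ⟨C + D, fun γ => by rw [pow_add]; exact Nat.mul_le_mul (hC γ) (hD γ)⟩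

theorem add {S T : Γ → ℕ} (hS : PolyBound S) (hT : PolyBound T) :
    PolyBound (fun γ => S γ + T γ) := by
  obtain ⟨C, hC⟩ := hS
  obtain ⟨D, hD⟩ := hT
  refine ⟨C + D + 1, fun γ => ?_⟩
  have h1 : 1 ≤ (Ctx.size γ + 2) ^ C := Nat.one_le_pow _ _ (by omega)
  have h2 : 1 ≤ (Ctx.size γ + 2) ^ D := Nat.one_le_pow _ _ (by omega)
  have hx := hC γ
  have hy := hD γ
  -- The sum is at most twice the product of the bounds, and one more factor, which is at least 2,
  -- absorbs the 2.
  rw [pow_succ, pow_add]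
  calc S γ + T γ ≤ (Ctx.size γ + 2) ^ C * (Ctx.size γ + 2) ^ D
        + (Ctx.size γ + 2) ^ C * (Ctx.size γ + 2) ^ D := by
        have := Nat.le_mul_of_pos_right ((Ctx.size γ + 2) ^ C) h2
        have := Nat.le_mul_of_pos_left ((Ctx.size γ + 2) ^ D) h1
        omega
    _ = (Ctx.size γ + 2) ^ C * (Ctx.size γ + 2) ^ D * 2 := by ring
    _ ≤ _ := Nat.mul_le_mul_left _ (by omega)

theorem pow {S : Γ → ℕ} (hS : PolyBound S) (c : ℕ) : PolyBound (fun γ => S γ ^ c) := by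
  obtain ⟨C, hC⟩ := hS
  exact ⟨C * c, fun γ => by rw [pow_mul]; exact Nat.pow_le_pow_left (hC γ) c⟩

theorem comp {T : Δ → ℕ} {f : Γ → Δ} (hT : PolyBound T)
    (hf : PolyBound (fun γ => Ctx.size (f γ))) : PolyBound (fun γ => T (f γ)) := by
  obtain ⟨C, hC⟩ := hT
  exact ((hf.add (const 2)).pow C).mono fun γ => hC _

end PolyBound

/-- Copy a block of registers. -/
def copyBlock (src dst : ℕ) : ℕ → Prog
  | 0 => .skip
  | l + 1 => .seq (copyBlock src dst l) (.copy (dst + l) (src + l))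

/-- The registers are copied in ascending order, so none is overwritten before it is read if the
destination starts no later than the source or lies behind it. -/
theorem exec_copyBlock {src dst l : ℕ} (h : dst ≤ src ∨ src + l ≤ dst) (s : State) :
    ∃ s', Exec (copyBlock src dst l) s (l + 1) s' ∧ (∀ i < l, s'.reg (dst + i) = s.reg (src + i)) ∧
      (∀ i, i < dst ∨ dst + l ≤ i → s'.reg i = s.reg i) ∧ s'.out = s.out := by
  induction l with
  | zero => exact ⟨s, .skip s, by simp, by simp, rfl⟩
  | succ l ih =>
    obtain ⟨s', he, h1, h2, h3⟩ := ih (by omega)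
    refine ⟨_, .seq he (.copy s' _ _), fun i hi => ?_, fun i hi => ?_, h3⟩
    · simp only [State.setReg, Function.update_apply]
      split_ifs with hc
      · have : i = l := by omega
        subst this
        exact h2 _ (by omega)
      · exact h1 i (by omega)
    · simp only [State.setReg, Function.update_apply]
      rw [if_neg (by omega)]
      exact h2 i (by omega)

/-- The function `f` is computed by a program, for any location of the argument and of the value,
within polynomial time; the program does not change the registers in front of the value. -/
@[fun_prop]
def PolyTime (f : Γ → Δ) : Prop :=
  PolyBound (fun γ => size (f γ)) ∧ ∀ o b, o + arity Γ ≤ b → ∃ (p : Prog) (T : Γ → ℕ),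
    PolyBound T ∧ ∀ γ s, At s o γ → ∃ t s', t ≤ T γ ∧ Exec p s t s' ∧ At s' b (f γ) ∧
      (∀ i < b, s'.reg i = s.reg i) ∧ s'.out = s.out

/-- The list `G` is written on the output tape by a program within polynomial time. -/
def Emits (G : Γ → List ℕ) : Prop :=
  ∀ o b, o + arity Γ ≤ b → ∃ (p : Prog) (T : Γ → ℕ),
    PolyBound T ∧ ∀ γ s, At s o γ → ∃ t s', t ≤ T γ ∧ Exec p s t s' ∧
      (∀ i < b, s'.reg i = s.reg i) ∧ s'.out = s.out ++ G γ

namespace PolyTime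

theorem of_block {f : Γ → Δ} (k : ℕ) (hk : k + arity Δ ≤ arity Γ)
    (hf : ∀ s o γ, At s o γ → At s (o + k) (f γ)) (hs : ∀ γ, size (f γ) ≤ size γ) : PolyTime f := by
  refine ⟨PolyBound.size.mono hs, fun o b hb => ⟨copyBlock (o + k) b (arity Δ), fun _ => arity Δ + 1,
    .const _, fun γ s h => ?_⟩⟩
  obtain ⟨s', he, h1, h2, h3⟩ := exec_copyBlock (src := o + k) (dst := b) (l := arity Δ) (by omega) s
  exact ⟨_, s', le_rfl, he, fun i hi => by rw [h1 i hi, hf s o γ h i hi],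
    fun i hi => h2 i (.inl hi), h3⟩

@[fun_prop]
theorem id : PolyTime (fun γ : Γ => γ) := of_block 0 (by simp) (fun _ _ _ h => h) (fun _ => le_rfl)

@[fun_prop]
theorem fst : PolyTime (fun p : Γ × Δ => p.1) :=
  of_block 0 (by simp) (fun _ _ _ h => (at_prod.1 h).1) (fun _ => by simp)

@[fun_prop]
theorem snd : PolyTime (fun p : Γ × Δ => p.2) :=
  of_block (arity Γ) (by simp) (fun _ _ _ h => (at_prod.1 h).2) (fun _ => by simp)

@[fun_prop]
theorem const (c : ℕ) : PolyTime (fun _ : Γ => c) :=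
  ⟨by simpa using PolyBound.const c, fun o b _ => ⟨.const b c, fun _ => 1, .const _, fun γ s _ =>
    ⟨1, _, le_rfl, .const s b c, at_nat.2 (by simp [State.setReg]),
      fun i hi => by simp [State.setReg, hi.ne], rfl⟩⟩⟩

@[fun_prop]
theorem comp {g : Δ → Θ} {f : Γ → Δ} (hg : PolyTime g) (hf : PolyTime f) :
    PolyTime (fun γ => g (f γ)) := by
  refine ⟨hg.1.comp hf.1, fun o b hb => ?_⟩
  obtain ⟨p, T, hT, hp⟩ := hf.2 o b hb
  obtain ⟨q, S, hS, hq⟩ := hg.2 b (b + arity Δ) le_rfl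
  -- The value of `g` is computed behind that of `f` and then moved down over it.
  refine ⟨.seq (.seq p q) (copyBlock (b + arity Δ) b (arity Θ)),
    fun γ => T γ + S (f γ) + (arity Θ + 1), (hT.add (hS.comp hf.1)).add (.const _), fun γ s h => ?_⟩
  obtain ⟨t₁, s₁, ht₁, he₁, ha₁, hr₁, ho₁⟩ := hp γ s h
  obtain ⟨t₂, s₂, ht₂, he₂, ha₂, hr₂, ho₂⟩ := hq (f γ) s₁ ha₁
  obtain ⟨s₃, he₃, h1, h2, h3⟩ :=
    exec_copyBlock (src := b + arity Δ) (dst := b) (l := arity Θ) (by omega) s₂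
  refine ⟨_, s₃, ?_, .seq (.seq he₁ he₂) he₃, fun i hi => ?_, fun i hi => ?_, ?_⟩
  · dsimp only; omega
  · rw [h1 i hi, ha₂ i hi]
  · rw [h2 i (.inl hi), hr₂ i (by omega), hr₁ i hi]
  · rw [h3, ho₂, ho₁]

@[fun_prop]
theorem prodMk {f : Γ → Δ} {g : Γ → Θ} (hf : PolyTime f) (hg : PolyTime g) :
    PolyTime (fun γ => (f γ, g γ)) := by
  refine ⟨by simpa using hf.1.add hg.1, fun o b hb => ?_⟩
  obtain ⟨p, T, hT, hp⟩ := hf.2 o b hb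
  obtain ⟨q, S, hS, hq⟩ := hg.2 o (b + arity Δ) (by omega)
  refine ⟨.seq p q, fun γ => T γ + S γ, hT.add hS, fun γ s h => ?_⟩
  obtain ⟨t₁, s₁, ht₁, he₁, ha₁, hr₁, ho₁⟩ := hp γ s h
  obtain ⟨t₂, s₂, ht₂, he₂, ha₂, hr₂, ho₂⟩ := hq γ s₁ (h.congr hb hr₁)
  refine ⟨_, s₂, by dsimp only; omega, .seq he₁ he₂, at_prod.2 ⟨ha₁.congr le_rfl hr₂, ha₂⟩, fun i hi => ?_, ?_⟩
  · rw [hr₂ i (by omega), hr₁ i hi]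
  · rw [ho₂, ho₁]

theorem add' : PolyTime (fun p : ℕ × ℕ => p.1 + p.2) :=
  ⟨PolyBound.size.mono (by simp), fun o b hb => ⟨.add b o (o + 1), fun _ => 1, .const _, fun γ s h => by
    obtain ⟨h1, h2⟩ := at_prod.1 h
    rw [at_nat] at h1 h2
    exact ⟨1, _, le_rfl, .add s b o (o + 1), at_nat.2 (by simp_all [State.setReg]),
      fun i hi => by simp [State.setReg, hi.ne], rfl⟩⟩⟩

theorem sub' : PolyTime (fun p : ℕ × ℕ => p.1 - p.2) :=
  ⟨PolyBound.size.mono (by simp; omega), fun o b hb => ⟨.sub b o (o + 1), fun _ => 1, .const _,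
    fun γ s h => by
    obtain ⟨h1, h2⟩ := at_prod.1 h
    rw [at_nat] at h1 h2
    exact ⟨1, _, le_rfl, .sub s b o (o + 1), at_nat.2 (by simp_all [State.setReg]),
      fun i hi => by simp [State.setReg, hi.ne], rfl⟩⟩⟩

@[fun_prop]
theorem add {f g : Γ → ℕ} (hf : PolyTime f) (hg : PolyTime g) : PolyTime (fun γ => f γ + g γ) :=
  add'.comp (hf.prodMk hg)

@[fun_prop]
theorem sub {f g : Γ → ℕ} (hf : PolyTime f) (hg : PolyTime g) : PolyTime (fun γ => f γ - g γ) :=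
  sub'.comp (hf.prodMk hg)

theorem ite_zero {c : Γ → ℕ} {f g : Γ → Δ} (hc : PolyTime c) (hf : PolyTime f) (hg : PolyTime g) :
    PolyTime (fun γ => if c γ = 0 then f γ else g γ) := by
  refine ⟨(hf.1.add hg.1).mono fun γ => by dsimp only; split_ifs <;> omega, fun o b hb => ?_⟩
  obtain ⟨p, T, hT, hp⟩ := hc.2 o b hb
  obtain ⟨q, S, hS, hq⟩ := hf.2 o b hb
  obtain ⟨r, U, hU, hr⟩ := hg.2 o b hb
  refine ⟨.seq p (.ite b r q), fun γ => T γ + (S γ + U γ + 1),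
    hT.add ((hS.add hU).add (.const 1)), fun γ s h => ?_⟩
  obtain ⟨t₁, s₁, ht₁, he₁, ha₁, hr₁, ho₁⟩ := hp γ s h
  rw [at_nat] at ha₁
  by_cases h0 : c γ = 0
  · obtain ⟨t₂, s₂, ht₂, he₂, ha₂, hr₂, ho₂⟩ := hq γ s₁ (h.congr hb hr₁)
    refine ⟨_, s₂, ?_, .seq he₁ (.iteFalse (ha₁.trans h0) he₂), by simpa [h0] using ha₂,
      fun i hi => by rw [hr₂ i hi, hr₁ i hi], by rw [ho₂, ho₁]⟩
    dsimp only; omega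
  · obtain ⟨t₂, s₂, ht₂, he₂, ha₂, hr₂, ho₂⟩ := hr γ s₁ (h.congr hb hr₁)
    refine ⟨_, s₂, ?_, .seq he₁ (.iteTrue (by rwa [ha₁]) he₂), by simpa [h0] using ha₂,
      fun i hi => by rw [hr₂ i hi, hr₁ i hi], by rw [ho₂, ho₁]⟩
    dsimp only; omega

@[fun_prop]
theorem ite_le {a c : Γ → ℕ} {f g : Γ → Δ} (ha : PolyTime a) (hc : PolyTime c) (hf : PolyTime f)
    (hg : PolyTime g) : PolyTime (fun γ => if a γ ≤ c γ then f γ else g γ) := by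
  simpa only [Nat.sub_eq_zero_iff_le] using ite_zero (ha.sub hc) hf hg

@[fun_prop]
theorem ite_lt {a c : Γ → ℕ} {f g : Γ → Δ} (ha : PolyTime a) (hc : PolyTime c) (hf : PolyTime f)
    (hg : PolyTime g) : PolyTime (fun γ => if a γ < c γ then f γ else g γ) :=
  ite_le (ha.add (const 1)) hc hf hg

@[fun_prop]
theorem ite_eq {a c : Γ → ℕ} {f g : Γ → Δ} (ha : PolyTime a) (hc : PolyTime c) (hf : PolyTime f)
    (hg : PolyTime g) : PolyTime (fun γ => if a γ = c γ then f γ else g γ) := by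
  have h : ∀ γ, (a γ - c γ) + (c γ - a γ) = 0 ↔ a γ = c γ := fun γ => by omega
  simpa only [h] using ite_zero ((ha.sub hc).add (hc.sub ha)) hf hg

/-- A counting loop: the body `q` maps the states that satisfy `I i` to states that satisfy
`I (i + 1)`, and it does not change the registers `z` and `z + 1`. -/
theorem exec_loop {q : Prog} {z N B : ℕ} {I : ℕ → State → Prop}
    (hq : ∀ i < N, ∀ s, I i s → ∃ t s', t ≤ B ∧ Exec q s t s' ∧ I (i + 1) s' ∧
      s'.reg z = s.reg z ∧ s'.reg (z + 1) = s.reg (z + 1))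
    (hI : ∀ i s v, I i s → I i (s.setReg z v)) {s : State} (hs : I 0 s) (hz : s.reg z = N)
    (hz1 : s.reg (z + 1) = 1) :
    ∃ t s', t ≤ N * (B + 2) + 1 ∧ Exec (.loop z (.seq q (.sub z z (z + 1)))) s t s' ∧ I N s' := by
  suffices H : ∀ j i s, i + j = N → I i s → s.reg z = j → s.reg (z + 1) = 1 →
      ∃ t s', t ≤ j * (B + 2) + 1 ∧ Exec (.loop z (.seq q (.sub z z (z + 1)))) s t s' ∧ I N s' from
    H N 0 s (by simp) hs hz hz1
  intro j
  induction j with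
  | zero =>
    intro i s hij h hz0 _
    obtain rfl : i = N := by omega
    exact ⟨1, s, by simp, .loopStop hz0, h⟩
  | succ j ih =>
    intro i s hij h hz hz1
    obtain ⟨t, s', ht, he, h', h1, h2⟩ := hq i (by omega) s h
    obtain ⟨t₂, s₂, ht₂, he₂, h₂⟩ := ih (i + 1) (s'.setReg z (s'.reg z - s'.reg (z + 1))) (by omega)
      (hI _ _ _ h') (by simp [State.setReg, h1, h2, hz, hz1])
      (by simp [State.setReg, h2, hz1])
    refine ⟨_, s₂, ?_, .loopStep (by omega) (.seq he (.sub s' _ _ _)) he₂, h₂⟩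
    have : (j + 1) * (B + 2) = j * (B + 2) + (B + 2) := by ring
    omega

/-- Bounded iteration. -/
theorem iterate {count : Γ → ℕ} {init : Γ → Δ} {step : Γ × Δ → Δ} (hc : PolyTime count)
    (hi : PolyTime init) (hs : PolyTime step) {B : Γ → ℕ} (hB : PolyBound B)
    (hsize : ∀ γ, ∀ i ≤ count γ, size ((fun δ => step (γ, δ))^[i] (init γ)) ≤ B γ) :
    PolyTime (fun γ => (fun δ => step (γ, δ))^[count γ] (init γ)) := by
  refine ⟨hB.mono fun γ => hsize γ _ le_rfl, fun o b hb => ?_⟩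
  set a := arity Γ
  set e := arity Δ
  -- Layout: a copy of `γ` at `b`, the current iterate at `b + a`, the counter at `z`, the constant
  -- 1 at `z + 1`, and working space from `z + 2` on. The first two blocks together are the argument
  -- of `step`.
  set z := b + a + e with hz
  obtain ⟨p₁, T₁, hT₁, hp₁⟩ := hi.2 o (b + a) (by omega)
  obtain ⟨p₂, T₂, hT₂, hp₂⟩ := hc.2 o z (by omega)
  obtain ⟨q, S, ⟨C, hC⟩, hq⟩ := hs.2 b (z + 2) (by rw [arity_prod]; omega)
  refine ⟨.seq (.seq (.seq (copyBlock o b a) (.seq p₁ p₂)) (.const (z + 1) 1))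
    (.seq (.loop z (.seq (.seq q (copyBlock (z + 2) (b + a) e)) (.sub z z (z + 1))))
      (copyBlock (b + a) b e)),
    fun γ => (a + 1) + (T₁ γ + T₂ γ) + 1 +
      ((count γ * ((size γ + B γ + 2) ^ C + (e + 1) + 2) + 1) + (e + 1)), ?_, fun γ s h => ?_⟩
  · have hc' : PolyBound count := by simpa using hc.1
    have h1 : PolyBound (fun γ : Γ => (size γ + B γ + 2) ^ C + (e + 1) + 2) :=
      (((((PolyBound.size).add hB).add (.const 2)).pow C).add (.const _)).add (.const 2)
    exact ((PolyBound.const _).add (hT₁.add hT₂) |>.add (.const 1)).add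
      (((hc'.mul h1).add (.const 1)).add (.const _))
  obtain ⟨s₁, he₁, h11, h12, h13⟩ := exec_copyBlock (src := o) (dst := b) (l := a) (by omega) s
  have hs₁ : ∀ i < b, s₁.reg i = s.reg i := fun i hi => h12 i (.inl hi)
  have hA₁ : At s₁ b γ := fun i hi => by rw [h11 i hi, h i hi]
  obtain ⟨t₂, s₂, ht₂, he₂, ha₂, hr₂, ho₂⟩ := hp₁ γ s₁ (h.congr hb hs₁)
  have hs₂ : ∀ i < b, s₂.reg i = s.reg i := fun i hi => by rw [hr₂ i (by omega), hs₁ i hi]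
  obtain ⟨t₃, s₃, ht₃, he₃, ha₃, hr₃, ho₃⟩ := hp₂ γ s₂ (h.congr hb hs₂)
  set s₄ := s₃.setReg (z + 1) 1 with hs₄
  have hr₄ : ∀ i < z, s₄.reg i = s₂.reg i := fun i hi => by
    simp only [hs₄, State.setReg, Function.update_apply]
    rw [if_neg (by omega), hr₃ i hi]
  let I : ℕ → State → Prop := fun i u => At u b (γ, (fun δ => step (γ, δ))^[i] (init γ)) ∧
    (∀ i < b, u.reg i = s.reg i) ∧ u.out = s.out
  obtain ⟨t₅, s₅, ht₅, he₅, ha₅, hr₅, ho₅⟩ := exec_loop (q := .seq q (copyBlock (z + 2) (b + a) e))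
    (z := z) (N := count γ) (B := (size γ + B γ + 2) ^ C + (e + 1)) (I := I)
    (fun i hi u hu => by
      obtain ⟨hu1, hu2, hu3⟩ := hu
      obtain ⟨t₆, s₆, ht₆, he₆, ha₆, hr₆, ho₆⟩ := hq _ u hu1
      obtain ⟨s₇, he₇, h71, h72, h73⟩ :=
        exec_copyBlock (src := z + 2) (dst := b + a) (l := e) (by omega) s₆
      refine ⟨_, s₇, ?_, .seq he₆ he₇, ⟨at_prod.2 ⟨?_, ?_⟩, ?_, ?_⟩, ?_, ?_⟩
      · have := (ht₆.trans (hC _)).trans (Nat.pow_le_pow_left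
          (show _ ≤ size γ + B γ + 2 by simpa using hsize γ i hi.le) C)
        omega
      · refine (at_prod.1 hu1).1.congr (b := b + a) le_rfl fun j hj => ?_
        rw [h72 j (.inl hj), hr₆ j (by omega)]
      · intro j hj
        rw [Function.iterate_succ_apply', h71 j hj, ha₆ j hj]
      · intro j hj
        rw [h72 j (.inl (by omega)), hr₆ j (by omega), hu2 j hj]
      · rw [h73, ho₆, hu3]
      · rw [h72 z (.inr (by omega)), hr₆ z (by omega)]
      · rw [h72 (z + 1) (.inr (by omega)), hr₆ (z + 1) (by omega)])
    (fun i u v hu => ⟨fun j hj => by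
        rw [arity_prod] at hj
        simp only [State.setReg, Function.update_apply]
        rw [if_neg (by omega)]
        exact hu.1 j (by rw [arity_prod]; omega),
      fun j hj => by
        simp only [State.setReg, Function.update_apply]
        rw [if_neg (by omega)]
        exact hu.2.1 j hj, hu.2.2⟩)
    (s := s₄) ⟨at_prod.2 ⟨hA₁.congr (b := b + a) le_rfl fun j hj => by
        rw [hr₄ j (by omega), hr₂ j hj], ha₂.congr (b := z) (by omega) hr₄⟩,
      fun j hj => by rw [hr₄ j (by omega), hs₂ j hj],
      by change s₃.out = s.out; rw [ho₃, ho₂, h13]⟩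
    (by simpa [hs₄, State.setReg] using at_nat.1 ha₃) (by simp [hs₄, State.setReg])
  obtain ⟨s₈, he₈, h81, h82, h83⟩ :=
    exec_copyBlock (src := b + a) (dst := b) (l := e) (by omega) s₅
  refine ⟨_, s₈, ?_, .seq (.seq (.seq he₁ (.seq he₂ he₃)) (.const s₃ _ _)) (.seq he₅ he₈),
    fun i hi => ?_, fun i hi => ?_, ?_⟩
  · dsimp only; omega
  · rw [h81 i hi]; exact (at_prod.1 ha₅).2 i hi
  · rw [h82 i (.inl hi), hr₅ i hi]
  · rw [h83, ho₅]

end PolyTime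

namespace Emits

theorem singleton {f : Γ → ℕ} (hf : PolyTime f) : Emits (fun γ => [f γ]) := by
  intro o b hb
  obtain ⟨p, T, hT, hp⟩ := hf.2 o b hb
  refine ⟨.seq p (.emit b), fun γ => T γ + 1, hT.add (.const 1), fun γ s h => ?_⟩
  obtain ⟨t₁, s₁, ht₁, he₁, ha₁, hr₁, ho₁⟩ := hp γ s h
  refine ⟨_, _, by dsimp only; omega, .seq he₁ (.emit s₁ b), hr₁, ?_⟩
  simp only [State.push]
  rw [ho₁, at_nat.1 ha₁]

theorem append {F G : Γ → List ℕ} (hF : Emits F) (hG : Emits G) : Emits (fun γ => F γ ++ G γ) := by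
  intro o b hb
  obtain ⟨p, T, hT, hp⟩ := hF o b hb
  obtain ⟨q, S, hS, hq⟩ := hG o b hb
  refine ⟨.seq p q, fun γ => T γ + S γ, hT.add hS, fun γ s h => ?_⟩
  obtain ⟨t₁, s₁, ht₁, he₁, hr₁, ho₁⟩ := hp γ s h
  obtain ⟨t₂, s₂, ht₂, he₂, hr₂, ho₂⟩ := hq γ s₁ (h.congr hb hr₁)
  exact ⟨_, s₂, by dsimp only; omega, .seq he₁ he₂, fun i hi => by rw [hr₂ i hi, hr₁ i hi], by
    rw [ho₂, ho₁, List.append_assoc]⟩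

theorem flatMap {count : Γ → ℕ} {G : Γ × ℕ → List ℕ} (hc : PolyTime count) (hG : Emits G) :
    Emits (fun γ => (List.range (count γ)).flatMap fun i => G (γ, i)) := by
  intro o b hb
  set a := arity Γ
  -- The running index is at `b + a`, right behind the copy of `γ`, so that both form the argument
  -- of `G`; the counter at `z` runs downwards, and `z + 1` contains 1.
  set z := b + a + 1 with hz
  obtain ⟨p₂, T₂, hT₂, hp₂⟩ := hc.2 o z (by omega)
  obtain ⟨q, S, ⟨C, hC⟩, hq⟩ := hG b (z + 2) (by rw [arity_prod, arity_nat]; omega)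
  refine ⟨.seq (.seq (.seq (copyBlock o b a) (.seq (.const (b + a) 0) p₂)) (.const (z + 1) 1))
    (.loop z (.seq (.seq q (.add (b + a) (b + a) (z + 1))) (.sub z z (z + 1)))),
    fun γ => (a + 1) + (1 + T₂ γ) + 1 +
      (count γ * ((size γ + count γ + 2) ^ C + 1 + 2) + 1), ?_, fun γ s h => ?_⟩
  · have hc' : PolyBound count := by simpa using hc.1
    have h1 : PolyBound (fun γ : Γ => (size γ + count γ + 2) ^ C + 1 + 2) :=
      (((((PolyBound.size).add hc').add (.const 2)).pow C).add (.const _)).add (.const 2)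
    exact ((PolyBound.const _).add ((PolyBound.const 1).add hT₂) |>.add (.const 1)).add
      ((hc'.mul h1).add (.const 1))
  obtain ⟨s₁, he₁, h11, h12, h13⟩ := exec_copyBlock (src := o) (dst := b) (l := a) (by omega) s
  have hs₁ : ∀ i < b, s₁.reg i = s.reg i := fun i hi => h12 i (.inl hi)
  have hA₁ : At s₁ b γ := fun i hi => by rw [h11 i hi, h i hi]
  set s₂ := s₁.setReg (b + a) 0 with hs₂'
  have hr₂ : ∀ i < b + a, s₂.reg i = s₁.reg i := fun i hi => by
    simp only [hs₂', State.setReg, Function.update_apply]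
    rw [if_neg (by omega)]
  have hs₂ : ∀ i < b, s₂.reg i = s.reg i := fun i hi => by rw [hr₂ i (by omega), hs₁ i hi]
  obtain ⟨t₃, s₃, ht₃, he₃, ha₃, hr₃, ho₃⟩ := hp₂ γ s₂ (h.congr hb hs₂)
  set s₄ := s₃.setReg (z + 1) 1 with hs₄
  have hr₄ : ∀ i < z, s₄.reg i = s₂.reg i := fun i hi => by
    simp only [hs₄, State.setReg, Function.update_apply]
    rw [if_neg (by omega), hr₃ i hi]
  let I : ℕ → State → Prop := fun i u => At u b (γ, i) ∧ u.reg (z + 1) = 1 ∧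
    (∀ i < b, u.reg i = s.reg i) ∧ u.out = s.out ++ (List.range i).flatMap fun i => G (γ, i)
  obtain ⟨t₅, s₅, ht₅, he₅, -, -, hr₅, ho₅⟩ := PolyTime.exec_loop
    (q := .seq q (.add (b + a) (b + a) (z + 1)))
    (z := z) (N := count γ) (B := (size γ + count γ + 2) ^ C + 1) (I := I)
    (fun i hi u hu => by
      obtain ⟨hu1, hu1', hu2, hu3⟩ := hu
      obtain ⟨t₆, s₆, ht₆, he₆, hr₆, ho₆⟩ := hq _ u hu1
      have hba : s₆.reg (b + a) = i := by
        rw [hr₆ _ (by omega)]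
        exact at_nat.1 (at_prod.1 hu1).2
      refine ⟨_, _, ?_, .seq he₆ (.add s₆ _ _ _), ⟨at_prod.2 ⟨?_, at_nat.2 ?_⟩, ?_, ?_, ?_⟩, ?_, ?_⟩
      · have := (ht₆.trans (hC _)).trans (Nat.pow_le_pow_left
          (show _ ≤ size γ + count γ + 2 by simpa using hi.le) C)
        omega
      · refine (at_prod.1 hu1).1.congr (b := b + a) le_rfl fun j hj => ?_
        simp only [State.setReg, Function.update_apply]
        rw [if_neg (by omega), hr₆ j (by omega)]
      · change (Function.update _ (b + a) _) (b + a) = _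
        rw [Function.update_self, hba, hr₆ _ (by omega), hu1']
      · simp only [State.setReg, Function.update_apply]
        rw [if_neg (by omega), hr₆ _ (by omega), hu1']
      · intro j hj
        simp only [State.setReg, Function.update_apply]
        rw [if_neg (by omega), hr₆ j (by omega), hu2 j hj]
      · change s₆.out = _
        rw [ho₆, hu3, List.range_succ, List.flatMap_append]
        simp
      · simp only [State.setReg, Function.update_apply]
        rw [if_neg (by omega), hr₆ z (by omega)]
      · simp only [State.setReg, Function.update_apply]
        rw [if_neg (by omega), hr₆ (z + 1) (by omega)])
    (fun i u v hu => ⟨fun j hj => by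
        rw [arity_prod, arity_nat] at hj
        simp only [State.setReg, Function.update_apply]
        rw [if_neg (by omega)]
        exact hu.1 j (by rw [arity_prod, arity_nat]; omega),
      by simp only [State.setReg, Function.update_apply]
         rw [if_neg (by omega)]
         exact hu.2.1,
      fun j hj => by
        simp only [State.setReg, Function.update_apply]
        rw [if_neg (by omega)]
        exact hu.2.2.1 j hj, hu.2.2.2⟩)
    (s := s₄) ⟨at_prod.2 ⟨hA₁.congr (b := b + a) le_rfl fun j hj => by
        rw [hr₄ j (by omega), hr₂ j hj], at_nat.2 (by
          change s₄.reg (b + a) = 0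
          rw [hr₄ _ (by omega)]; simp [hs₂', State.setReg])⟩,
      by simp [hs₄, State.setReg],
      fun j hj => by rw [hr₄ j (by omega), hs₂ j hj],
      by change s₃.out = _; rw [ho₃]; change s₁.out = _; rw [h13]; simp⟩
    (by simpa [hs₄, State.setReg] using at_nat.1 ha₃) (by simp [hs₄, State.setReg])
  exact ⟨_, s₅, by dsimp only; omega,
    .seq (.seq (.seq he₁ (.seq (.const s₁ _ _) he₃)) (.const s₃ _ _)) he₅, hr₅, ho₅⟩

end Emits

end SparseTC

/-! ### Arithmetic in time polynomial in the values of the arguments. -/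

namespace SparseTC
open Finset Ctx

variable {Γ Δ Θ : Type} [Ctx Γ] [Ctx Δ] [Ctx Θ]

namespace PolyTime

/-- Repeated addition is fast enough, because time is measured against the value of the factors. -/
theorem mul' : PolyTime (fun p : ℕ × ℕ => p.1 * p.2) := by
  have key : ∀ x n : ℕ, (fun a => a + x)^[n] 0 = x * n := fun x n => by
    induction n with
    | zero => simp
    | succ n ih => rw [Function.iterate_succ_apply', ih]; ring
  have := iterate (Γ := ℕ × ℕ) (Δ := ℕ) (count := fun p => p.2) (init := fun _ => 0)
    (step := fun q => q.2 + q.1.1) (by fun_prop) (by fun_prop) (by fun_prop)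
    (B := fun p => size p * size p) (PolyBound.size.mul .size) (fun p i hi => by
      simp only [key, size_nat, size_prod]
      nlinarith [Nat.zero_le p.1, Nat.zero_le p.2])
  simpa only [key] using this

@[fun_prop]
theorem mul {f g : Γ → ℕ} (hf : PolyTime f) (hg : PolyTime g) : PolyTime (fun γ => f γ * g γ) :=
  mul'.comp (hf.prodMk hg)

theorem div' : PolyTime (fun p : ℕ × ℕ => p.1 / p.2) := by
  have key : ∀ x y n : ℕ, 0 < y → (fun q => if (q + 1) * y ≤ x then q + 1 else q)^[n] 0
      = min n (x / y) := fun x y n hy => by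
    induction n with
    | zero => simp
    | succ n ih =>
      rw [Function.iterate_succ_apply', ih]
      simp only [← Nat.le_div_iff_mul_le hy]
      split_ifs <;> omega
  have hle : ∀ x y n : ℕ, (fun q => if (q + 1) * y ≤ x then q + 1 else q)^[n] 0 ≤ n := fun x y n => by
    induction n with
    | zero => simp
    | succ n ih =>
      rw [Function.iterate_succ_apply']
      split_ifs <;> omega
  have := iterate (Γ := ℕ × ℕ) (Δ := ℕ) (count := fun p => p.1) (init := fun _ => 0)
    (step := fun q => if (q.2 + 1) * q.1.2 ≤ q.1.1 then q.2 + 1 else q.2)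
    (by fun_prop) (by fun_prop) (by fun_prop)
    (B := fun p => size p) .size (fun p i hi => by
      simp only [size_nat, size_prod] at hi ⊢
      exact (hle _ _ _).trans (by omega))
  -- For the divisor 0 the loop returns the dividend, whereas Lean's quotient is 0.
  have h2 := ite_eq snd (const 0) (const 0) this
  convert h2 using 2 with p
  split_ifs with h
  · simp [h]
  · dsimp only
    rw [key _ _ _ (Nat.pos_of_ne_zero h), min_eq_right (Nat.div_le_self _ _)]

@[fun_prop]
theorem div {f g : Γ → ℕ} (hf : PolyTime f) (hg : PolyTime g) : PolyTime (fun γ => f γ / g γ) :=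
  div'.comp (hf.prodMk hg)

@[fun_prop]
theorem mod {f g : Γ → ℕ} (hf : PolyTime f) (hg : PolyTime g) : PolyTime (fun γ => f γ % g γ) := by
  simp only [Nat.mod_eq_sub]
  fun_prop

/-- The cap keeps all intermediate products below the size of the argument, as `iterate` demands; an
uncapped power is not of polynomial size. -/
theorem minPow' : PolyTime (fun p : (ℕ × ℕ) × ℕ => min p.1.1 (p.1.2 ^ p.2)) := by
  have key : ∀ M a n : ℕ, (fun q => if q * a ≤ M then q * a else M)^[n] (min M 1) = min M (a ^ n) :=
    fun M a n => by
    induction n with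
    | zero => simp
    | succ n ih =>
      rw [Function.iterate_succ_apply', ih]
      rcases Nat.eq_zero_or_pos a with rfl | ha
      · simp
      · rcases le_total M (a ^ n) with h | h
        · have h1 : M ≤ M * a := Nat.le_mul_of_pos_right _ ha
          have h2 : M ≤ a ^ (n + 1) := h.trans (Nat.pow_le_pow_right ha (by omega))
          rw [min_eq_left h, min_eq_left h2]
          split_ifs <;> omega
        · rw [min_eq_right h, pow_succ]
          split_ifs <;> omega
  have := iterate (Γ := (ℕ × ℕ) × ℕ) (Δ := ℕ) (count := fun p => p.2)
    (init := fun p => if p.1.1 ≤ 1 then p.1.1 else 1)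
    (step := fun q => if q.2 * q.1.1.2 ≤ q.1.1.1 then q.2 * q.1.1.2 else q.1.1.1)
    (by fun_prop) (by fun_prop) (by fun_prop)
    (B := fun p => size p) .size (fun p i hi => by
      have h1 : ∀ M : ℕ, (if M ≤ 1 then M else 1) = min M 1 := fun M => by split_ifs <;> omega
      simp only [size_nat, size_prod, h1, key]
      omega)
  have h1 : ∀ M : ℕ, (if M ≤ 1 then M else 1) = min M 1 := fun M => by split_ifs <;> omega
  simpa only [h1, key] using this

/-- Powers can be computed if they are truncated. -/
@[fun_prop]
theorem minPow {f g h : Γ → ℕ} (hf : PolyTime f) (hg : PolyTime g) (hh : PolyTime h) :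
    PolyTime (fun γ => min (f γ) (g γ ^ h γ)) :=
  minPow'.comp ((hf.prodMk hg).prodMk hh)

theorem shiftRight' : PolyTime (fun p : ℕ × ℕ => p.1 >>> p.2) := by
  have key : ∀ x n : ℕ, (fun q => q / 2)^[n] x = x >>> n := fun x n => by
    induction n with
    | zero => simp
    | succ n ih => rw [Function.iterate_succ_apply', ih, Nat.shiftRight_succ]
  have := iterate (Γ := ℕ × ℕ) (Δ := ℕ) (count := fun p => p.2) (init := fun p => p.1)
    (step := fun q => q.2 / 2) (by fun_prop) (by fun_prop) (by fun_prop)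
    (B := fun p => size p) .size (fun p i hi => by
      simp only [key, size_nat, size_prod]
      have := Nat.shiftRight_le p.1 i
      omega)
  simpa only [key] using this

@[fun_prop]
theorem shiftRight {f g : Γ → ℕ} (hf : PolyTime f) (hg : PolyTime g) :
    PolyTime (fun γ => f γ >>> g γ) :=
  shiftRight'.comp (hf.prodMk hg)

theorem ite_testBit {a c : Γ → ℕ} {f g : Γ → Δ} (ha : PolyTime a) (hc : PolyTime c)
    (hf : PolyTime f) (hg : PolyTime g) :
    PolyTime (fun γ => if (a γ).testBit (c γ) then f γ else g γ) := by
  have : ∀ x y : ℕ, x.testBit y = true ↔ (x >>> y) % 2 = 1 := fun x y => by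
    rw [Nat.testBit_eq_decide_div_mod_eq, Nat.shiftRight_eq_div_pow]; simp
  simp only [this]
  fun_prop

theorem xor_le_add (a b : ℕ) : a ^^^ b ≤ a + b := by
  refine Nat.binaryRec' (motive := fun a => ∀ b, a ^^^ b ≤ a + b) (by simp) ?_ a b
  intro x a _ ih b
  obtain ⟨y, b, rfl⟩ : ∃ y c, b = Nat.bit y c := ⟨b.bodd, b.div2, (Nat.bit_bodd_div2 b).symm⟩
  have := ih b
  rw [Nat.xor_bit]
  simp only [Nat.bit_val]
  cases x <;> cases y <;> simp <;> omega

/-- The bits are produced from the top. The first component of the state is the current position,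
which starts at `a + b`, beyond all the bits; the second one is the part of the result above that
position. -/
theorem xor' : PolyTime (fun p : ℕ × ℕ => p.1 ^^^ p.2) := by
  have hmod : ∀ a b i : ℕ, (a >>> i + b >>> i) % 2 = ((a ^^^ b) >>> i) % 2 := fun a b i => by
    have h : ∀ x : ℕ, (x >>> i) % 2 = (x.testBit i).toNat := fun x => by
      rw [Nat.shiftRight_eq_div_pow, Nat.toNat_testBit]
    rw [Nat.add_mod, h, h, h, Nat.testBit_xor]
    cases a.testBit i <;> cases b.testBit i <;> rfl
  have key : ∀ a b n : ℕ, n ≤ a + b →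
      (fun q : ℕ × ℕ => (q.1 - 1, 2 * q.2 + (a >>> (q.1 - 1) + b >>> (q.1 - 1)) % 2))^[n] (a + b, 0)
        = (a + b - n, (a ^^^ b) >>> (a + b - n)) := fun a b n hn => by
    induction n with
    | zero =>
      have : (a ^^^ b) >>> (a + b) = 0 := by
        rw [Nat.shiftRight_eq_div_pow]
        exact Nat.div_eq_of_lt ((xor_le_add a b).trans_lt Nat.lt_two_pow_self)
      simp [this]
    | succ n ih =>
      rw [Function.iterate_succ_apply', ih (by omega)]
      obtain ⟨m, hm⟩ : ∃ m, a + b - n = m + 1 := ⟨a + b - n - 1, by omega⟩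
      have h2 : a + b - (n + 1) = m := by omega
      simp only [hm, h2, hmod, Nat.add_sub_cancel, Prod.mk.injEq, true_and, Nat.shiftRight_succ]
      omega
  have := iterate (Γ := ℕ × ℕ) (Δ := ℕ × ℕ) (count := fun p => p.1 + p.2)
    (init := fun p => (p.1 + p.2, 0))
    (step := fun q => (q.2.1 - 1,
      2 * q.2.2 + (q.1.1 >>> (q.2.1 - 1) + q.1.2 >>> (q.2.1 - 1)) % 2))
    (by fun_prop) (by fun_prop) (by fun_prop)
    (B := fun p => size p + size p) (PolyBound.size.add .size) (fun p i hi => by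
      simp only [key p.1 p.2 i hi, size_nat, size_prod]
      have := Nat.shiftRight_le (p.1 ^^^ p.2) (p.1 + p.2 - i)
      have := xor_le_add p.1 p.2
      omega)
  have h2 := snd.comp this
  convert h2 using 2 with p
  simp [key]

@[fun_prop]
theorem xor {f g : Γ → ℕ} (hf : PolyTime f) (hg : PolyTime g) : PolyTime (fun γ => f γ ^^^ g γ) :=
  xor'.comp (hf.prodMk hg)

end PolyTime

/-! ### Unbounded search, and logarithms by doubling. -/

/-- A search for the least number `M` with `ok (γ, M) ≠ 0`, after which the list `G (γ, M)` is
written on the output tape. -/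
theorem Emits.exists_search {G : Γ × ℕ → List ℕ} (hG : Emits G) {ok : Γ × ℕ → ℕ}
    (hok : PolyTime ok) (o : ℕ) : ∃ (P : Prog) (C : ℕ), ∀ (γ : Γ) (s : State) (M : ℕ), At s o γ →
      (∀ i < M, ok (γ, i) = 0) → ok (γ, M) ≠ 0 →
      ∃ t s', t ≤ (size γ + M + 2) ^ C ∧ Exec P s t s' ∧ s'.out = s.out ++ G (γ, M) := by
  set a := arity Γ
  set b := o + a with hb
  set z := b + a + 2 with hz
  -- Loops run while a register is non-zero, so the negated test is what the program evaluates.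
  have hnok : PolyTime (fun p : Γ × ℕ => if ok p = 0 then 1 else 0) := by fun_prop
  obtain ⟨q, S, ⟨C, hC⟩, hq⟩ := hnok.2 b z (by rw [arity_prod, arity_nat]; omega)
  obtain ⟨p, T, ⟨D, hD⟩, hp⟩ := hG b z (by rw [arity_prod, arity_nat]; omega)
  have hB : PolyBound (fun p : ℕ => (a + 1 + 1 + 1 + (p + 2) ^ C) +
      (p * ((p + 2) ^ C + 2) + 1) + (p + 2) ^ D) := by
    have h1 : PolyBound (fun p : ℕ => p) := by simpa using PolyBound.size (Γ := ℕ)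
    have h2 : ∀ E, PolyBound (fun p : ℕ => (p + 2) ^ E) := fun E => (h1.add (.const 2)).pow E
    exact (((PolyBound.const _).add (h2 C)).add ((h1.mul ((h2 C).add (.const 2))).add
      (.const 1))).add (h2 D)
  obtain ⟨E, hE⟩ := hB
  refine ⟨.seq (.seq (.seq (.seq (.seq (copyBlock o b a) (.const (b + a) 0)) (.const (b + a + 1) 1))
    q) (.loop z (.seq (.add (b + a) (b + a) (b + a + 1)) q))) p, E, fun γ s M h hlt hM => ?_⟩
  obtain ⟨s₁, he₁, h11, h12, h13⟩ := exec_copyBlock (src := o) (dst := b) (l := a) (by omega) s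
  set s₂ := s₁.setReg (b + a) 0 with hs₂
  set s₃ := s₂.setReg (b + a + 1) 1 with hs₃
  have hA₃ : At s₃ b (γ, 0) := by
    refine at_prod.2 ⟨fun i hi => ?_, at_nat.2 ?_⟩
    · simp only [hs₃, hs₂, State.setReg, Function.update_apply]
      rw [if_neg (by omega), if_neg (by omega), h11 i hi, h i hi]
    · simp [hs₃, hs₂, State.setReg, a]
  obtain ⟨t₄, s₄, ht₄, he₄, ha₄, hr₄, ho₄⟩ := hq (γ, 0) s₃ hA₃
  have hcost : ∀ i ≤ M, ∀ (U : Γ × ℕ → ℕ) c, (∀ γ, U γ ≤ (size γ + 2) ^ c) →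
      U (γ, i) ≤ (size γ + M + 2) ^ c := fun i hi U c hU =>
    (hU _).trans (Nat.pow_le_pow_left (by simpa using hi) c)
  have hloop : ∀ j i u, i + j = M → At u b (γ, i) → u.reg (b + a + 1) = 1 →
      u.reg z = (if ok (γ, i) = 0 then 1 else 0) → ∃ t u', t ≤ j * ((size γ + M + 2) ^ C + 2) + 1 ∧
        Exec (.loop z (.seq (.add (b + a) (b + a) (b + a + 1)) q)) u t u' ∧ At u' b (γ, M) ∧
        u'.out = u.out := by
    intro j
    induction j with
    | zero =>
      intro i u hij hu _ hz0
      obtain rfl : i = M := by omega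
      exact ⟨1, u, by simp, .loopStop (by simp [hz0, hM]), hu, rfl⟩
    | succ j ih =>
      intro i u hij hu hu1 hz0
      set v := u.setReg (b + a) (u.reg (b + a) + u.reg (b + a + 1)) with hv
      have hAv : At v b (γ, i + 1) := by
        refine at_prod.2 ⟨fun k hk => ?_, at_nat.2 ?_⟩
        · simp only [hv, State.setReg, Function.update_apply]
          rw [if_neg (by omega)]
          exact (at_prod.1 hu).1 k hk
        · have := at_nat.1 (at_prod.1 hu).2
          simp only at this
          simp [hv, State.setReg, a, hu1, this]
      obtain ⟨t₅, s₅, ht₅, he₅, ha₅, hr₅, ho₅⟩ := hq _ v hAv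
      obtain ⟨t₆, s₆, ht₆, he₆, ha₆, ho₆⟩ := ih (i + 1) s₅ (by omega)
        (hAv.congr (b := z) (by rw [arity_prod, arity_nat]; omega) hr₅)
        (by rw [hr₅ _ (by omega)]; simp [hv, State.setReg, hu1]) (at_nat.1 ha₅)
      refine ⟨_, s₆, ?_, .loopStep (by simp [hz0, hlt i (by omega)]) (.seq (.add u _ _ _) he₅) he₆,
        ha₆, by rw [ho₆, ho₅]; rfl⟩
      have h1 := ht₅.trans (hcost (i + 1) (by omega) S C hC)
      have : (j + 1) * ((size γ + M + 2) ^ C + 2)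
        = j * ((size γ + M + 2) ^ C + 2) + ((size γ + M + 2) ^ C + 2) := by ring
      omega
  obtain ⟨t₅, s₅, ht₅, he₅, ha₅, ho₅⟩ := hloop M 0 s₄ (by simp)
    (hA₃.congr (b := z) (by rw [arity_prod, arity_nat]; omega) hr₄)
    (by rw [hr₄ _ (by omega)]; simp [hs₃, State.setReg]) (at_nat.1 ha₄)
  obtain ⟨t₆, s₆, ht₆, he₆, hr₆, ho₆⟩ := hp _ s₅ ha₅
  refine ⟨_, s₆, ?_, .seq (.seq (.seq (.seq (.seq he₁ (.const s₁ _ _)) (.const s₂ _ _)) he₄) he₅)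
    he₆, ?_⟩
  · refine le_trans ?_ (hE (size γ + M))
    have h1 := ht₄.trans (hcost 0 (by omega) S C hC)
    have h2 := ht₆.trans (hcost M le_rfl T D hD)
    have h3 : M * ((size γ + M + 2) ^ C + 2) ≤ (size γ + M) * ((size γ + M + 2) ^ C + 2) :=
      Nat.mul_le_mul_right _ (by omega)
    dsimp only
    omega
  · rw [ho₆, ho₅, ho₄]
    change s₁.out ++ _ = _
    rw [h13]

/-- Replaces the number `x` in the register `a` by the least `l` with `y ≤ x * 2 ^ l`, where `y` is
the number in the register `b`. -/
def logProg (a b z : ℕ) : Prog :=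
  .seq (.seq (.seq (.seq (.seq (.const z 0) (.const (z + 1) 1)) (.copy (z + 2) a))
    (.sub (z + 3) b (z + 2))) (.loop (z + 3) (.seq (.seq (.add (z + 2) (z + 2) (z + 2))
      (.add z z (z + 1))) (.sub (z + 3) b (z + 2))))) (.copy a z)

/-- Doubling is a single addition, so the time is linear in `l` whatever the size of the two
numbers. This is why the numerator and the denominator of `ε` do not enter the running time. -/
theorem exec_logProg {a b z : ℕ} (ha : a < z) (hb : b < z) (s : State) {l : ℕ}
    (h1 : s.reg b ≤ s.reg a * 2 ^ l) (h2 : ∀ i < l, s.reg a * 2 ^ i < s.reg b) :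
    ∃ t s', t ≤ 4 * l + 6 ∧ Exec (logProg a b z) s t s' ∧ s'.reg a = l ∧
      (∀ i < z, i ≠ a → s'.reg i = s.reg i) ∧ s'.out = s.out := by
  have hloop : ∀ j i (u : State), i + j = l → (∀ k < z, u.reg k = s.reg k) → u.out = s.out →
      u.reg z = i → u.reg (z + 1) = 1 → u.reg (z + 2) = s.reg a * 2 ^ i →
      u.reg (z + 3) = s.reg b - s.reg a * 2 ^ i →
      ∃ t u', t ≤ 4 * j + 1 ∧ Exec (.loop (z + 3) (.seq (.seq (.add (z + 2) (z + 2) (z + 2))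
        (.add z z (z + 1))) (.sub (z + 3) b (z + 2)))) u t u' ∧
        (∀ k < z, u'.reg k = s.reg k) ∧ u'.out = s.out ∧ u'.reg z = l := by
    intro j
    induction j with
    | zero =>
      intro i u hij hu hu' hz0 _ _ hz3
      obtain rfl : i = l := by omega
      exact ⟨1, u, by simp, .loopStop (by omega), hu, hu', hz0⟩
    | succ j ih =>
      intro i u hij hu hu' hz0 hz1 hz2 hz3
      have := h2 i (by omega)
      let u₁ := u.setReg (z + 2) (u.reg (z + 2) + u.reg (z + 2))
      let u₂ := u₁.setReg z (u₁.reg z + u₁.reg (z + 1))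
      let u₃ := u₂.setReg (z + 3) (u₂.reg b - u₂.reg (z + 2))
      have hbz : b ≠ z + 2 := by omega
      have hbz' : b ≠ z := by omega
      obtain ⟨t, u', ht, he, hr⟩ := ih (i + 1) u₃ (by omega)
        (fun k hk => by
          have h1 : k ≠ z := by omega
          have h2 : k ≠ z + 2 := by omega
          have h3 : k ≠ z + 3 := by omega
          simp [u₃, u₂, u₁, State.setReg, Function.update_apply, h1, h2, h3, hu k hk])
        hu'
        (by simp [u₃, u₂, u₁, State.setReg, Function.update_apply, hz0, hz1])
        (by simp [u₃, u₂, u₁, State.setReg, Function.update_apply, hz1])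
        (by simp [u₃, u₂, u₁, State.setReg, Function.update_apply, hz2]; ring)
        (by simp [u₃, u₂, u₁, State.setReg, hz2, hbz, hbz', hu b hb, pow_succ]
            ring_nf)
      exact ⟨_, u', by omega, .loopStep (by omega)
        (.seq (.seq (.add u _ _ _) (.add u₁ _ _ _)) (.sub u₂ _ _ _)) he, hr⟩
  let s₁ := s.setReg z 0
  let s₂ := s₁.setReg (z + 1) 1
  let s₃ := s₂.setReg (z + 2) (s₂.reg a)
  let s₄ := s₃.setReg (z + 3) (s₃.reg b - s₃.reg (z + 2))
  have ha1 : a ≠ z := by omega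
  have ha2 : a ≠ z + 1 := by omega
  have hb1 : b ≠ z := by omega
  have hb2 : b ≠ z + 1 := by omega
  have hb3 : b ≠ z + 2 := by omega
  obtain ⟨t, u, ht, he, hr, ho, hl⟩ := hloop l 0 s₄ (by simp)
    (fun k hk => by
      have h1 : k ≠ z := by omega
      have h2 : k ≠ z + 1 := by omega
      have h3 : k ≠ z + 2 := by omega
      have h4 : k ≠ z + 3 := by omega
      simp [s₄, s₃, s₂, s₁, State.setReg, Function.update_apply, h1, h2, h3, h4])
    rfl
    (by simp [s₄, s₃, s₂, s₁, State.setReg, Function.update_apply])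
    (by simp [s₄, s₃, s₂, s₁, State.setReg, Function.update_apply])
    (by simp [s₄, s₃, s₂, s₁, State.setReg, Function.update_apply, ha1, ha2])
    (by simp [s₄, s₃, s₂, s₁, State.setReg, ha1, ha2, hb1, hb2, hb3])
  refine ⟨_, _, ?_, .seq (.seq (.seq (.seq (.seq (.const s _ _) (.const s₁ _ _)) (.copy s₂ _ _))
    (.sub s₃ _ _ _)) he) (.copy u _ _), by simp [State.setReg, hl], fun i hi hia => ?_, ho⟩
  · omega
  · simp [State.setReg, hia, hr i hi]

end SparseTC

namespace SparseTC
open Finset Ctx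

/-! ### Linear maps given by tables, and their circuits -/

/-- The linear map given by a table whose rows have `W` entries: the entry `0` stands for nothing,
and the entry `i + 1` stands for the summand `x i`. -/
def tableMap (W : ℕ) (T : ℕ → ℕ → ℕ) : (ℕ → ZMod 2) →ₗ[ZMod 2] (ℕ → ZMod 2) where
  toFun x r := ∑ j ∈ range W, if T r j = 0 then 0 else x (T r j - 1)
  map_add' x y := by
    funext r
    simp only [Pi.add_apply, ← sum_add_distrib]
    exact sum_congr rfl fun j _ => by split_ifs <;> simp
  map_smul' c x := by
    funext r
    simp only [Pi.smul_apply, RingHom.id_apply, smul_eq_mul, mul_sum]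
    exact sum_congr rfl fun j _ => by split_ifs <;> simp

theorem tableMap_apply (W : ℕ) (T : ℕ → ℕ → ℕ) (x : ℕ → ZMod 2) (r : ℕ) :
    tableMap W T x r = ∑ j ∈ range W, if T r j = 0 then 0 else x (T r j - 1) := rfl

/-- The entries that are greater than `N` are removed from the table. -/
def trunc (N : ℕ) (T : ℕ → ℕ → ℕ) (r j : ℕ) : ℕ := if T r j ≤ N then T r j else 0

theorem trunc_le (N : ℕ) (T : ℕ → ℕ → ℕ) (r j : ℕ) : trunc N T r j ≤ N := by
  unfold trunc; split_ifs <;> omega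

theorem trunc_of_le {N : ℕ} {T : ℕ → ℕ → ℕ} {r j : ℕ} (h : T r j ≤ N) : trunc N T r j = T r j :=
  if_pos h

theorem sum_range_mul {M : Type*} [AddCommMonoid M] (a b : ℕ) (F : ℕ → M) :
    ∑ i ∈ range (a * b), F i = ∑ i ∈ range a, ∑ j ∈ range b, F (i * b + j) := by
  induction a with
  | zero => simp
  | succ a ih => rw [Nat.succ_mul, sum_range_add, ih, sum_range_succ]

/-- The table of the composition of two linear maps that are given by tables. -/
def compTable (W₁ : ℕ) (T₂ T₁ : ℕ → ℕ → ℕ) (r i : ℕ) : ℕ :=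
  if T₂ r (i / W₁) = 0 then 0 else T₁ (T₂ r (i / W₁) - 1) (i % W₁)

theorem tableMap_compTable (W₁ W₂ : ℕ) (T₁ T₂ : ℕ → ℕ → ℕ) (x : ℕ → ZMod 2) :
    tableMap (W₂ * W₁) (compTable W₁ T₂ T₁) x = tableMap W₂ T₂ (tableMap W₁ T₁ x) := by
  funext r
  simp only [tableMap_apply, sum_range_mul]
  refine sum_congr rfl fun i _ => ?_
  split_ifs with h
  · refine sum_eq_zero fun j hj => ?_
    have hj := mem_range.1 hj
    have h1 : (i * W₁ + j) / W₁ = i := by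
      rw [mul_comm, Nat.mul_add_div (by omega), Nat.div_eq_of_lt hj, add_zero]
    simp [compTable, h1, h]
  · refine sum_congr rfl fun j hj => ?_
    have hj := mem_range.1 hj
    have h1 : (i * W₁ + j) / W₁ = i := by
      rw [mul_comm, Nat.mul_add_div (by omega), Nat.div_eq_of_lt hj, add_zero]
    have h2 : (i * W₁ + j) % W₁ = j := by
      rw [mul_comm, Nat.mul_add_mod, Nat.mod_eq_of_lt hj]
    simp [compTable, h1, h2, h]

/-- The wire for an entry of a table. -/
def entryWire (e : ℕ) : Wire := if e = 0 then ⟨none, true⟩ else ⟨some (e - 1), false⟩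

/-- The gate that tests whether more than `j` of the summands in a row of a table are `1`. -/
def thresholdGate (W : ℕ) (T : ℕ → ℕ → ℕ) (r j : ℕ) : Gate :=
  ((List.range W).map fun i => entryWire (T r i)) ++
    ((List.range W).map fun _ => ⟨none, false⟩) ++ (List.range (2 * j + 1)).map fun _ => ⟨none, true⟩

/-- The gate that computes a parity from the outputs of the threshold gates. -/
def parityGate (W r : ℕ) : Gate :=
  (List.range W).map fun j => ⟨some (r * W + j), decide (j % 2 = 1)⟩

/-- The circuit that computes the linear map given by a table. -/
def parityCircuit (R W : ℕ) (T : ℕ → ℕ → ℕ) : Circuit :=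
  [(List.range R).flatMap fun r => (List.range W).map fun j => thresholdGate W T r j,
    (List.range R).map fun r => parityGate W r]

/-- The numbers 2 and 3 are the codes of the constant wire and of its negation, and a table entry `e
> 0`, which refers to the node `e - 1`, has the code `2 + 2 * e`. -/
theorem emits_encode_parityCircuit {Γ : Type} [Ctx Γ] {R W : Γ → ℕ} {T : Γ → ℕ → ℕ → ℕ}
    (hR : PolyTime R) (hW : PolyTime W)
    (hT : PolyTime (fun q : (Γ × ℕ) × ℕ => T q.1.1 q.1.2 q.2)) :
    Emits (fun γ => (parityCircuit (R γ) (W γ) (T γ)).encode) := by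
  have hT' : PolyTime (fun q : ((Γ × ℕ) × ℕ) × ℕ => T q.1.1.1 q.1.1.2 q.2) :=
    hT.comp (f := fun q : ((Γ × ℕ) × ℕ) × ℕ => (q.1.1, q.2)) (by fun_prop)
  have h1 : Emits (fun q : (Γ × ℕ) × ℕ =>
      ((List.range (W q.1.1)).flatMap fun i => [if T q.1.1 q.1.2 i = 0 then 3 else 2 + 2 * T q.1.1 q.1.2 i])
      ++ ((List.range (W q.1.1)).flatMap fun _ => [2]) ++
      ((List.range (2 * q.2 + 1)).flatMap fun _ => [3]) ++ [0]) := by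
    refine (((Emits.flatMap (G := fun q : ((Γ × ℕ) × ℕ) × ℕ =>
      [if T q.1.1.1 q.1.1.2 q.2 = 0 then 3 else 2 + 2 * T q.1.1.1 q.1.1.2 q.2]) ?_ ?_).append
      (.flatMap (G := fun _ => [2]) ?_ ?_)).append (.flatMap (G := fun _ => [3]) ?_ ?_)).append
      (.singleton ?_)
    · fun_prop
    · exact .singleton (.ite_eq hT' (.const 0) (.const 3) (.add (.const 2) (.mul (.const 2) hT')))
    · fun_prop
    · exact .singleton (by fun_prop)
    · fun_prop
    · exact .singleton (by fun_prop)
    · fun_prop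
  have h2 : Emits (fun γ =>
      ((List.range (R γ)).flatMap fun r => (List.range (W γ)).flatMap fun j =>
      (((List.range (W γ)).flatMap fun i => [if T γ r i = 0 then 3 else 2 + 2 * T γ r i])
      ++ ((List.range (W γ)).flatMap fun _ => [2]) ++
      ((List.range (2 * j + 1)).flatMap fun _ => [3]) ++ [0])) ++ [1] ++
      ((List.range (R γ)).flatMap fun r =>
        ((List.range (W γ)).flatMap fun j => [2 + 2 * (r * W γ + j + 1) + j % 2]) ++ [0]) ++ [1]) := by
    refine (((Emits.flatMap hR (.flatMap (Γ := Γ × ℕ) (hW.comp PolyTime.fst) h1)).append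
      (.singleton (by fun_prop))).append (.flatMap hR (G := fun q : Γ × ℕ =>
        ((List.range (W q.1)).flatMap fun j => [2 + 2 * (q.2 * W q.1 + j + 1) + j % 2]) ++ [0])
        (.append (.flatMap (G := fun q : (Γ × ℕ) × ℕ =>
          [2 + 2 * (q.1.2 * W q.1.1 + q.2 + 1) + q.2 % 2]) ?_ (.singleton ?_))
          (.singleton ?_)))).append (.singleton ?_)
    · fun_prop
    · fun_prop
    · fun_prop
    · fun_prop
  convert h2 using 2 with γ
  have hw : ∀ e, Circuit.wireCode (entryWire e) = if e = 0 then 3 else 2 + 2 * e := fun e => by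
    unfold entryWire
    split_ifs with h
    · rfl
    · simp [Circuit.wireCode]; omega
  have hp : ∀ r j, Circuit.wireCode ⟨some (r * W γ + j), decide (j % 2 = 1)⟩
      = 2 + 2 * (r * W γ + j + 1) + j % 2 := fun r j => by
    simp only [Circuit.wireCode, decide_eq_true_eq]
    split_ifs <;> omega
  have hm : ∀ (l : List ℕ) (f : ℕ → ℕ), (l.flatMap fun i => [f i]) = l.map f := fun l f => by
    induction l <;> simp_all
  have hc1 : Circuit.wireCode ⟨none, false⟩ = 2 := rfl
  have hc2 : Circuit.wireCode ⟨none, true⟩ = 3 := rfl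
  simp [parityCircuit, Circuit.encode, thresholdGate, parityGate, List.flatMap_assoc,
    List.flatMap_map, List.map_map, Function.comp_def, hw, hp, hm, hc1, hc2, List.append_assoc]

namespace Circuit

/-- The number of values that a circuit with `n` inputs outputs. -/
def outSize : ℕ → Circuit → ℕ
  | n, [] => n
  | _, L :: C => outSize L.length C

theorem outSize_append (n : ℕ) (C D : Circuit) : outSize n (C ++ D) = outSize (outSize n C) D := by
  induction C generalizing n with
  | nil => rfl
  | cons L C ih => exact ih _

theorem wellFormed_append {n : ℕ} {C D : Circuit} (hC : C.WellFormed n)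
    (hD : D.WellFormed (outSize n C)) : WellFormed n (C ++ D) := by
  induction C generalizing n with
  | nil => exact hD
  | cons L C ih => exact ⟨hC.1, ih hC.2 hD⟩

theorem eval_append (C D : Circuit) (v : List Bool) : eval (C ++ D) v = eval D (eval C v) := by
  induction C generalizing v with
  | nil => rfl
  | cons L C ih => exact ih _

theorem wires_append (C D : Circuit) : wires (C ++ D) = wires C + wires D := by
  simp [wires]

theorem encode_flatMap {α : Type*} (l : List α) (C : α → Circuit) :
    encode (l.flatMap C) = l.flatMap fun a => encode (C a) := by
  simp [encode, List.flatMap_assoc]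

end Circuit

open Circuit

theorem length_thresholds (R W : ℕ) (T : ℕ → ℕ → ℕ) :
    ((List.range R).flatMap fun r => (List.range W).map fun j => thresholdGate W T r j).length
      = R * W := by
  simp

theorem wellFormed_parityCircuit {N R W : ℕ} {T : ℕ → ℕ → ℕ} (hT : ∀ r j, T r j ≤ N) :
    (parityCircuit R W T).WellFormed N := by
  refine ⟨fun g hg w hw i hi => ?_, fun g hg w hw i hi => ?_, trivial⟩
  · simp only [List.mem_flatMap, List.mem_map, List.mem_range] at hg
    obtain ⟨r, -, j, -, rfl⟩ := hg
    simp only [thresholdGate, List.mem_append, List.mem_map, List.mem_range] at hw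
    rcases hw with (⟨k, -, rfl⟩ | ⟨k, -, rfl⟩) | ⟨k, -, rfl⟩
    · unfold entryWire at hi
      split_ifs at hi with h
      · have := hT r k
        simp only [Option.some.injEq] at hi
        omega
    · simp at hi
    · simp at hi
  · simp only [List.mem_map, List.mem_range] at hg
    obtain ⟨r, hr, rfl⟩ := hg
    simp only [parityGate, List.mem_map, List.mem_range] at hw
    obtain ⟨j, hj, rfl⟩ := hw
    simp only [Option.some.injEq] at hi
    rw [length_thresholds, ← hi]
    calc r * W + j < (r + 1) * W := by rw [Nat.succ_mul]; omega
      _ ≤ R * W := Nat.mul_le_mul_right _ hr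

theorem outSize_parityCircuit (N R W : ℕ) (T : ℕ → ℕ → ℕ) :
    outSize N (parityCircuit R W T) = R := by
  simp [parityCircuit, outSize]

/-- The threshold gates of a row have the fan-ins `2 * W + 2 * j + 1` for `j < W`, in total `3 * W ^
2`; the parity gate adds `W`. -/
theorem wires_parityCircuit_le (R W : ℕ) (T : ℕ → ℕ → ℕ) :
    (parityCircuit R W T).wires ≤ 4 * R * W ^ 2 := by
  have h1 : ∀ n, ((List.range n).map fun j => W + (W + (2 * j + 1))).sum = 2 * W * n + n ^ 2 := by
    intro n
    induction n with
    | zero => simp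
    | succ n ih => rw [List.range_succ, List.map_append, List.sum_append, ih]; simp; ring
  have h2 : ∀ n c : ℕ, ((List.range n).map fun _ => c).sum = n * c := by simp
  have h3 : ∀ n, (((List.range n).flatMap fun r => (List.range W).map fun j =>
      thresholdGate W T r j).map List.length).sum = n * (3 * W ^ 2) := by
    intro n
    induction n with
    | zero => simp
    | succ n ih =>
      rw [List.range_succ, List.flatMap_append, List.map_append, List.sum_append, ih]
      simp only [List.flatMap_cons, List.flatMap_nil, List.append_nil, List.map_map,
        Function.comp_def, thresholdGate, List.length_append, List.length_map, List.length_range,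
        add_assoc, h1]
      ring
  have h4 : (parityCircuit R W T).wires = R * (3 * W ^ 2) + R * W := by
    simp only [wires, parityCircuit, List.map_cons, List.map_nil, List.sum_cons, List.sum_nil, h3]
    simp [parityGate, Function.comp_def]
  rw [h4]
  have : W ≤ W ^ 2 := Nat.le_self_pow (by omega) W
  nlinarith [Nat.mul_le_mul_left R this]

theorem getD_map_range {α : Type*} (n i : ℕ) (f : ℕ → α) (a : α) (h : i < n) :
    ((List.range n).map f).getD i a = f i := by
  simp [h]

theorem countP_map_range (n : ℕ) (p : ℕ → Bool) :
    (List.range n).countP p = ∑ i ∈ range n, if p i then 1 else 0 := by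
  induction n with
  | zero => simp
  | succ n ih => rw [List.range_succ, List.countP_append, ih, sum_range_succ]; simp [List.countP_cons]

/-- If `c` summands are 1, then `W + c` of the `2 * W + 2 * j + 1` wires carry 1, because of the `W`
constant ones; this is a majority exactly when `j < c`. -/
theorem eval_thresholdGate {N W : ℕ} {T : ℕ → ℕ → ℕ} (hT : ∀ r j, T r j ≤ N) (x : ℕ → ZMod 2)
    (r j : ℕ) : Gate.eval ((List.range N).map fun i => toBit (x i)) (thresholdGate W T r j)
      = decide (j < ∑ i ∈ range W, if T r i ≠ 0 ∧ x (T r i - 1) = 1 then 1 else 0) := by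
  set v := (List.range N).map fun i => toBit (x i) with hv
  have h1 : ∀ i, (entryWire (T r i)).eval v = decide (T r i ≠ 0 ∧ x (T r i - 1) = 1) := by
    intro i
    have := hT r i
    unfold entryWire
    split_ifs with h
    · simp [Wire.eval, h]
    · simp only [Wire.eval, hv, getD_map_range N (T r i - 1) _ _ (by omega)]
      simp [toBit, h]
  simp only [Gate.eval, thresholdGate, List.length_append, List.length_map, List.length_range,
    List.countP_append, List.countP_map, Function.comp_def, h1, countP_map_range]
  simp [Wire.eval]
  omega

/-- The thresholds form a block of `c` ones followed by zeros. With every second wire negated the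
wires inside the block pair off, and so do those behind it, up to boundary terms. The count is `W /
2 + c % 2`, which exceeds `W / 2` as a majority exactly for odd `c`. -/
theorem eval_parityGate {R W : ℕ} (c : ℕ → ℕ) (hc : ∀ r, c r ≤ W) {r : ℕ} (hr : r < R) :
    Gate.eval ((List.range R).flatMap fun r => (List.range W).map fun j => decide (j < c r))
      (parityGate W r) = decide (c r % 2 = 1) := by
  have hget : ∀ n, r < n → ∀ j < W, ((List.range n).flatMap fun r => (List.range W).map fun j =>
      decide (j < c r)).getD (r * W + j) false = decide (j < c r) := by
    intro n
    induction n with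
    | zero => simp
    | succ n ih =>
      intro hrn j hj
      rw [List.range_succ, List.flatMap_append]
      have hl : ((List.range n).flatMap fun r => (List.range W).map fun j =>
        decide (j < c r)).length = n * W := by simp
      rcases Nat.lt_succ_iff_lt_or_eq.1 hrn with h | h
      · rw [List.getD_append, ih h j hj]
        rw [hl]
        calc r * W + j < (r + 1) * W := by rw [Nat.succ_mul]; omega
          _ ≤ n * W := Nat.mul_le_mul_right _ h
      · subst h
        rw [List.getD_append_right _ _ _ _ (by rw [hl]; omega), hl]
        simp [hj]
  -- The case `n < k` occurs only during the induction on `n`.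
  have hcount : ∀ k n, (∑ j ∈ range n, if (xor (decide (j % 2 = 1)) (decide (j < k))) then 1 else 0)
      = n / 2 + (if k ≤ n then k % 2 else n % 2) := by
    intro k n
    induction n with
    | zero => simp; omega
    | succ n ih =>
      rw [sum_range_succ, ih]
      rcases Nat.mod_two_eq_zero_or_one n with h | h <;> by_cases h' : n < k <;>
        simp only [h, h', decide_true, decide_false, Bool.xor_false, Bool.xor_true,
          Bool.not_true, Bool.not_false, if_true, if_false, zero_ne_one, Bool.false_eq_true] <;>
        split_ifs <;> omega
  have hw : ∀ j ∈ List.range W, Wire.eval ((List.range R).flatMap fun r => (List.range W).map fun j =>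
      decide (j < c r)) ⟨some (r * W + j), decide (j % 2 = 1)⟩
        = xor (decide (j % 2 = 1)) (decide (j < c r)) := by
    intro j hj
    simp only [Wire.eval]
    rw [hget R hr j (List.mem_range.1 hj)]
  have := hc r
  simp only [Gate.eval, parityGate, List.length_map, List.length_range, List.countP_map,
    Function.comp_def]
  rw [List.countP_congr (q := fun j => xor (decide (j % 2 = 1)) (decide (j < c r)))
    (fun j hj => by rw [hw j hj]), countP_map_range, hcount, if_pos this]
  congr 1
  apply propext
  omega

theorem eval_parityCircuit {N R W : ℕ} {T : ℕ → ℕ → ℕ} (hT : ∀ r j, T r j ≤ N) (x : ℕ → ZMod 2) :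
    (parityCircuit R W T).eval ((List.range N).map fun i => toBit (x i))
      = (List.range R).map fun r => toBit (tableMap W T x r) := by
  simp only [parityCircuit, Circuit.eval, List.map_flatMap, List.map_map, Function.comp_def,
    eval_thresholdGate hT]
  refine List.map_congr_left fun r hr => ?_
  rw [eval_parityGate (fun r => ∑ i ∈ range W, if T r i ≠ 0 ∧ x (T r i - 1) = 1 then 1 else 0)
    (fun r => (sum_le_sum (g := fun _ => 1) fun i _ => by split_ifs <;> simp).trans (by simp))
    (List.mem_range.1 hr)]
  have h2 : ∀ a : ZMod 2, a = 0 ∨ a = 1 := by decide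
  have : tableMap W T x r
      = ((∑ i ∈ range W, if T r i ≠ 0 ∧ x (T r i - 1) = 1 then 1 else 0 : ℕ) : ZMod 2) := by
    rw [tableMap_apply, Nat.cast_sum]
    refine sum_congr rfl fun i _ => ?_
    by_cases h : T r i = 0
    · simp [h]
    · rcases h2 (x (T r i - 1)) with h' | h' <;> simp [h, h']
  simp only [toBit, this]
  congr 1
  apply propext
  rw [ZMod.natCast_eq_one_iff_odd, Nat.odd_iff]

/-- The circuit for a chain of `k` linear maps that are given by tables; the `j`th of them maps
vectors of length `D j` to vectors of length `D (j + 1)`. -/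
def chainCircuit (D W : ℕ → ℕ) (T : ℕ → ℕ → ℕ → ℕ) (k : ℕ) : Circuit :=
  (List.range k).flatMap fun j => parityCircuit (D (j + 1)) (W j) (trunc (D j) (T j))

/-- The composition of a chain of linear maps that are given by tables. -/
def chainMap (D W : ℕ → ℕ) (T : ℕ → ℕ → ℕ → ℕ) : ℕ → (ℕ → ZMod 2) →ₗ[ZMod 2] (ℕ → ZMod 2)
  | 0 => LinearMap.id
  | k + 1 => tableMap (W k) (trunc (D k) (T k)) ∘ₗ chainMap D W T k

theorem chainCircuit_succ (D W : ℕ → ℕ) (T : ℕ → ℕ → ℕ → ℕ) (k : ℕ) :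
    chainCircuit D W T (k + 1)
      = chainCircuit D W T k ++ parityCircuit (D (k + 1)) (W k) (trunc (D k) (T k)) := by
  simp [chainCircuit, List.range_succ]

theorem depth_chainCircuit (D W : ℕ → ℕ) (T : ℕ → ℕ → ℕ → ℕ) (k : ℕ) :
    (chainCircuit D W T k).depth = 2 * k := by
  simp [chainCircuit, depth, parityCircuit]; ring

theorem outSize_chainCircuit (D W : ℕ → ℕ) (T : ℕ → ℕ → ℕ → ℕ) (k : ℕ) :
    outSize (D 0) (chainCircuit D W T k) = D k := by
  cases k with
  | zero => rfl
  | succ k => rw [chainCircuit_succ, outSize_append, outSize_parityCircuit]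

theorem wellFormed_chainCircuit (D W : ℕ → ℕ) (T : ℕ → ℕ → ℕ → ℕ) (k : ℕ) :
    (chainCircuit D W T k).WellFormed (D 0) := by
  induction k with
  | zero => trivial
  | succ k ih =>
    rw [chainCircuit_succ]
    refine wellFormed_append ih ?_
    rw [outSize_chainCircuit]
    exact wellFormed_parityCircuit (trunc_le _ _)

theorem eval_chainCircuit (D W : ℕ → ℕ) (T : ℕ → ℕ → ℕ → ℕ) (k : ℕ) (x : ℕ → ZMod 2) :
    (chainCircuit D W T k).eval ((List.range (D 0)).map fun i => toBit (x i))
      = (List.range (D k)).map fun r => toBit (chainMap D W T k x r) := by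
  induction k with
  | zero => rfl
  | succ k ih =>
    rw [chainCircuit_succ, eval_append, ih, eval_parityCircuit (trunc_le _ _)]
    rfl

theorem wires_chainCircuit_le (D W : ℕ → ℕ) (T : ℕ → ℕ → ℕ → ℕ) (k : ℕ) :
    (chainCircuit D W T k).wires ≤ ∑ j ∈ range k, 4 * D (j + 1) * W j ^ 2 := by
  induction k with
  | zero => simp [chainCircuit, wires]
  | succ k ih =>
    rw [chainCircuit_succ, wires_append, sum_range_succ]
    exact Nat.add_le_add ih (wires_parityCircuit_le _ _ _)

/-- Extension by zero. -/
def extend (n : ℕ) : (Fin n → ZMod 2) →ₗ[ZMod 2] (ℕ → ZMod 2) where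
  toFun x i := if h : i < n then x ⟨i, h⟩ else 0
  map_add' x y := by
    funext i
    by_cases h : i < n <;> simp [h]
  map_smul' c x := by
    funext i
    by_cases h : i < n <;> simp [h]

theorem extend_apply {n : ℕ} (x : Fin n → ZMod 2) (i : Fin n) : extend n x i = x i := by
  simp [extend]

/-- The linear map between finite vectors given by a chain of tables. -/
def finMap (D W : ℕ → ℕ) (T : ℕ → ℕ → ℕ → ℕ) (k n m : ℕ) :
    (Fin n → ZMod 2) →ₗ[ZMod 2] (Fin m → ZMod 2) :=
  LinearMap.funLeft (ZMod 2) (ZMod 2) (fun i : Fin m => (i : ℕ)) ∘ₗ chainMap D W T k ∘ₗ extend n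

theorem finMap_apply (D W : ℕ → ℕ) (T : ℕ → ℕ → ℕ → ℕ) (k n m : ℕ) (x : Fin n → ZMod 2)
    (i : Fin m) : finMap D W T k n m x i = chainMap D W T k (extend n x) i := rfl

theorem computes_chainCircuit (D W : ℕ → ℕ) (T : ℕ → ℕ → ℕ → ℕ) (k : ℕ) :
    (chainCircuit D W T k).Computes (finMap D W T k (D 0) (D k)) := by
  refine ⟨wellFormed_chainCircuit D W T k, fun x => ?_⟩
  have h1 : (List.ofFn fun i => toBit (x i))
      = (List.range (D 0)).map fun i => toBit (extend (D 0) x i) := by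
    rw [← List.ofFn_getElem (xs := (List.range (D 0)).map _)]
    apply List.ext_getElem <;> simp [extend]
  have h2 : (List.ofFn fun j => toBit (finMap D W T k (D 0) (D k) x j))
      = (List.range (D k)).map fun j => toBit (chainMap D W T k (extend (D 0) x) j) := by
    apply List.ext_getElem <;> simp [finMap_apply]
  rw [h1, h2, eval_chainCircuit]

/-- The number of non-zero entries among the first `n` ones. -/
def weight (n : ℕ) (y : ℕ → ZMod 2) : ℕ := #{i ∈ range n | y i ≠ 0}

theorem hammingNorm_eq_weight {m : ℕ} (z : Fin m → ZMod 2) (y : ℕ → ZMod 2) (h : ∀ i, z i = y i) :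
    hammingNorm z = weight m y := by
  rw [hammingNorm, weight, card_filter, card_filter,
    ← Fin.sum_univ_eq_sum_range fun i => if y i ≠ 0 then 1 else 0]
  simp only [h]

end SparseTC

namespace SparseTC
open Finset

/-! ### An expander on the discrete torus -/

section Torus

variable {m : ℕ} [NeZero m]

/-- The Fourier transform on the discrete torus. -/
noncomputable def fourier (f : ZMod m × ZMod m → ℂ) (ξ : ZMod m × ZMod m) : ℂ :=
  ∑ v, f v * ZMod.stdAddChar (-(ξ.1 * v.1 + ξ.2 * v.2))

theorem sum_stdAddChar (a : ZMod m × ZMod m) :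
    ∑ ξ : ZMod m × ZMod m, ZMod.stdAddChar (ξ.1 * a.1 + ξ.2 * a.2)
      = if a = 0 then ((m : ℂ) ^ 2) else 0 := by
  simp only [AddChar.map_add_eq_mul, Fintype.sum_prod_type]
  simp only [← mul_sum, ← sum_mul]
  rw [AddChar.sum_mulShift _ (ZMod.isPrimitive_stdAddChar m),
    AddChar.sum_mulShift _ (ZMod.isPrimitive_stdAddChar m)]
  rcases a with ⟨a, b⟩
  simp only [ZMod.card, Prod.mk_eq_zero]
  by_cases ha : a = 0 <;> by_cases hb : b = 0 <;> simp [ha, hb, sq]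

/-- Parseval's identity, from the orthogonality of the characters. -/
theorem sum_norm_fourier_sq (f : ZMod m × ZMod m → ℂ) :
    ∑ ξ, ‖fourier f ξ‖ ^ 2 = (m : ℝ) ^ 2 * ∑ v, ‖f v‖ ^ 2 := by
  have hn : ∀ z : ℂ, ((‖z‖ ^ 2 : ℝ) : ℂ) = z * (starRingEnd ℂ) z := fun z => by
    rw [Complex.mul_conj, Complex.normSq_eq_norm_sq]
  have hconj : ∀ a : ZMod m, (starRingEnd ℂ) (ZMod.stdAddChar a) = ZMod.stdAddChar (-a) := fun a => by
    rw [AddChar.map_neg_eq_conj]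
  apply Complex.ofReal_injective
  rw [Complex.ofReal_sum]
  simp only [hn]
  calc ∑ ξ, fourier f ξ * (starRingEnd ℂ) (fourier f ξ)
      = ∑ ξ : ZMod m × ZMod m, ∑ v, ∑ w, f v * (starRingEnd ℂ) (f w) *
          ZMod.stdAddChar (ξ.1 * (w - v).1 + ξ.2 * (w - v).2) := by
        refine sum_congr rfl fun ξ _ => ?_
        rw [fourier, map_sum, sum_mul_sum]
        refine sum_congr rfl fun v _ => sum_congr rfl fun w _ => ?_
        rw [map_mul, hconj]
        have : ξ.1 * (w - v).1 + ξ.2 * (w - v).2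
          = -(ξ.1 * v.1 + ξ.2 * v.2) + -(-(ξ.1 * w.1 + ξ.2 * w.2)) := by
          simp only [Prod.fst_sub, Prod.snd_sub]; ring
        rw [this, AddChar.map_add_eq_mul]
        ring
    _ = ∑ v, ∑ w, f v * (starRingEnd ℂ) (f w) * (if w - v = 0 then ((m : ℂ) ^ 2) else 0) := by
        rw [sum_comm]
        refine sum_congr rfl fun v _ => ?_
        rw [sum_comm]
        refine sum_congr rfl fun w _ => ?_
        rw [← mul_sum, sum_stdAddChar]
    _ = _ := by
        simp only [sub_eq_zero]
        push_cast
        simp only [← Complex.ofReal_pow, hn, mul_sum]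
        refine sum_congr rfl fun v _ => ?_
        rw [sum_eq_single v (fun w _ hw => by simp [hw]) (by simp)]
        simp; ring

theorem fourier_sub (f g : ZMod m × ZMod m → ℂ) (ξ : ZMod m × ZMod m) :
    fourier (fun v => f v - g v) ξ = fourier f ξ - fourier g ξ := by
  simp [fourier, sub_mul]

/-- The distance of two points on the unit circle is `2 * |sin|` of half the angle, and Jordan's
inequality bounds it below by `4 * |k| / m`, which is at least 1/2. -/
theorem quarter_le_norm_sub {a : ZMod m} (h : (m : ℤ) ≤ 8 * |a.valMinAbs|) :
    1 / 4 ≤ ‖1 - ZMod.stdAddChar a‖ ^ 2 := by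
  set k := a.valMinAbs with hk
  have hm : (0 : ℝ) < m := by exact_mod_cast NeZero.pos m
  have h1 : ZMod.stdAddChar a = Complex.exp (Complex.I * ((2 * Real.pi * k / m : ℝ) : ℂ)) := by
    conv_lhs => rw [← ZMod.coe_valMinAbs a, ZMod.stdAddChar_coe]
    congr 1; push_cast; ring
  have h2 := ZMod.valMinAbs_mem_Ioc a
  rw [← hk] at h2
  have h3 : |(k : ℝ)| * 2 ≤ m := by
    have : |k| * 2 ≤ m := by rcases abs_cases k with ⟨h, -⟩ | ⟨h, -⟩ <;> rw [h] <;>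
      have := h2.1 <;> have := h2.2 <;> omega
    exact_mod_cast this
  have h4 : (m : ℝ) ≤ 8 * |(k : ℝ)| := by exact_mod_cast h
  rw [h1, norm_sub_rev, Complex.norm_exp_I_mul_ofReal_sub_one]
  have h5 : |2 * Real.pi * k / m / 2| ≤ Real.pi / 2 := by
    rw [show 2 * Real.pi * k / m / 2 = Real.pi * (k / m) by ring, abs_mul, abs_div,
      abs_of_pos Real.pi_pos, abs_of_pos hm]
    have : |(k : ℝ)| / m ≤ 1 / 2 := by rw [div_le_div_iff₀ hm two_pos]; linarith
    nlinarith [Real.pi_pos]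
  have h6 := Real.mul_abs_le_abs_sin h5
  have h7 : 2 / Real.pi * |2 * Real.pi * k / m / 2| = 2 * (|(k : ℝ)| / m) := by
    rw [show 2 * Real.pi * k / m / 2 = Real.pi * (k / m) by ring, abs_mul, abs_div,
      abs_of_pos Real.pi_pos, abs_of_pos hm]
    field_simp
  have h8 : 1 / 8 ≤ |(k : ℝ)| / m := by rw [div_le_div_iff₀ (by norm_num) hm]; linarith
  rw [h7] at h6
  rw [norm_mul, Real.norm_eq_abs, Real.norm_eq_abs, abs_two]
  nlinarith

/-- Half of the ping-pong argument. -/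
theorem ping_pong (g : ZMod m × ZMod m → ℂ) :
    ∑ v : ZMod m × ZMod m, ‖g v‖ ^ 2 *
      (if 8 * |v.1.valMinAbs| < m ∧ 8 * |v.2.valMinAbs| < m then
        (if |v.1.valMinAbs| < |v.2.valMinAbs| then 2 else
          if |v.1.valMinAbs| = |v.2.valMinAbs| ∧ v ≠ 0 then 1 else 0) else 0)
    ≤ ∑ v : ZMod m × ZMod m, ‖g v‖ ^ 2 * (if |v.2.valMinAbs| < |v.1.valMinAbs| then 1 else 0)
      + 2 * (8 * ∑ v, ‖g v - g (v.1 - 2 * v.2, v.2)‖ ^ 2 + (∑ v, ‖g v‖ ^ 2) / 8) := by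
  let S : (ZMod m × ZMod m) ≃ (ZMod m × ZMod m) :=
    { toFun := fun v => (v.1 - 2 * v.2, v.2)
      invFun := fun v => (v.1 + 2 * v.2, v.2)
      left_inv := fun v => by simp
      right_inv := fun v => by simp }
  change _ ≤ _ + 2 * (8 * ∑ v, ‖g v - g (S v)‖ ^ 2 + (∑ v, ‖g v‖ ^ 2) / 8)
  -- The points near the origin, other than the origin itself, in the cone where the second
  -- coordinate dominates. Both `S` and its inverse move them into the opposite cone, apart from one
  -- diagonal each; `p` and `q` leave out these diagonals.
  let Q : ZMod m × ZMod m → Prop := fun v => 8 * |v.1.valMinAbs| < m ∧ 8 * |v.2.valMinAbs| < m ∧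
    |v.1.valMinAbs| ≤ |v.2.valMinAbs| ∧ v.2.valMinAbs ≠ 0
  classical
  let p : ZMod m × ZMod m → ℝ := fun v => if Q v ∧ v.1.valMinAbs ≠ - v.2.valMinAbs then 1 else 0
  let q : ZMod m × ZMod m → ℝ := fun v => if Q v ∧ v.1.valMinAbs ≠ v.2.valMinAbs then 1 else 0
  -- Moving mass along `S` changes a weighted sum by little: with `s = ‖g v‖ + ‖g (S v)‖` and `δ =
  -- ‖g v - g (S v)‖` one has `s * δ ≤ 8 * δ ^ 2 + s ^ 2 / 32`.
  have hdiff : ∀ r : ZMod m × ZMod m → ℝ, (∀ v, 0 ≤ r v ∧ r v ≤ 1) →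
      |∑ v, ‖g v‖ ^ 2 * r v - ∑ v, ‖g (S v)‖ ^ 2 * r v|
        ≤ 8 * ∑ v, ‖g v - g (S v)‖ ^ 2 + (∑ v, ‖g v‖ ^ 2) / 8 := by
    intro r hr
    have h1 : ∑ v, ‖g (S v)‖ ^ 2 = ∑ v, ‖g v‖ ^ 2 := Equiv.sum_comp S fun v => ‖g v‖ ^ 2
    calc |∑ v, ‖g v‖ ^ 2 * r v - ∑ v, ‖g (S v)‖ ^ 2 * r v|
        ≤ ∑ v, |‖g v‖ ^ 2 * r v - ‖g (S v)‖ ^ 2 * r v| := by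
          rw [← sum_sub_distrib]; exact abs_sum_le_sum_abs _ _
      _ ≤ ∑ v, (8 * ‖g v - g (S v)‖ ^ 2 + (‖g v‖ ^ 2 + ‖g (S v)‖ ^ 2) / 16) := by
          refine sum_le_sum fun v _ => ?_
          obtain ⟨hr0, hr1⟩ := hr v
          rw [← sub_mul, abs_mul, abs_of_nonneg hr0]
          refine (mul_le_of_le_one_right (abs_nonneg _) hr1).trans ?_
          have h2 := abs_norm_sub_norm_le (g v) (g (S v))
          have h3 := norm_nonneg (g v)
          have h4 := norm_nonneg (g (S v))
          have h5 := norm_nonneg (g v - g (S v))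
          rw [sq_sub_sq, abs_mul, abs_of_nonneg (add_nonneg h3 h4)]
          have h6 : (‖g v‖ + ‖g (S v)‖) * |‖g v‖ - ‖g (S v)‖|
            ≤ (‖g v‖ + ‖g (S v)‖) * ‖g v - g (S v)‖ :=
            mul_le_mul_of_nonneg_left h2 (add_nonneg h3 h4)
          nlinarith [sq_nonneg (16 * ‖g v - g (S v)‖ - (‖g v‖ + ‖g (S v)‖)),
            sq_nonneg (‖g v‖ - ‖g (S v)‖)]
      _ = _ := by
          rw [sum_add_distrib, ← mul_sum, ← sum_div, sum_add_distrib, h1]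
          ring
  -- The coordinates are below `m / 8`, so the sheared coordinate is below `3 * m / 8` and does not
  -- wrap around.
  have hval : ∀ a b : ZMod m, 8 * |a.valMinAbs| < m → 8 * |b.valMinAbs| < m →
      (a + 2 * b).valMinAbs = a.valMinAbs + 2 * b.valMinAbs ∧
      (a - 2 * b).valMinAbs = a.valMinAbs - 2 * b.valMinAbs := by
    intro a b ha hb
    have ha := abs_lt.1 (show |8 * a.valMinAbs| < m by rw [abs_mul]; simpa using ha)
    have hb := abs_lt.1 (show |8 * b.valMinAbs| < m by rw [abs_mul]; simpa using hb)
    constructor <;> rw [ZMod.valMinAbs_spec] <;> refine ⟨by push_cast; simp, ?_, ?_⟩ <;> omega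
  have hp : ∀ v, Q v → v.1.valMinAbs ≠ - v.2.valMinAbs →
      |(S.symm v).2.valMinAbs| < |(S.symm v).1.valMinAbs| ∧
        0 < (S.symm v).1.valMinAbs * (S.symm v).2.valMinAbs := by
    rintro ⟨a, b⟩ ⟨h1, h2, h3, h4⟩ h5
    change |b.valMinAbs| < |(a + 2 * b).valMinAbs| ∧ 0 < (a + 2 * b).valMinAbs * b.valMinAbs
    rw [(hval a b h1 h2).1]
    simp only at h3 h4 h5
    rw [mul_pos_iff]
    rcases abs_cases a.valMinAbs with ⟨e1, _⟩ | ⟨e1, _⟩ <;>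
    rcases abs_cases b.valMinAbs with ⟨e2, _⟩ | ⟨e2, _⟩ <;>
    rcases abs_cases (a.valMinAbs + 2 * b.valMinAbs) with ⟨e3, _⟩ | ⟨e3, _⟩ <;>
    rw [e1, e2] at h3 <;> rw [e2, e3] <;> omega
  have hq : ∀ v, Q v → v.1.valMinAbs ≠ v.2.valMinAbs →
      |(S v).2.valMinAbs| < |(S v).1.valMinAbs| ∧ (S v).1.valMinAbs * (S v).2.valMinAbs < 0 := by
    rintro ⟨a, b⟩ ⟨h1, h2, h3, h4⟩ h5
    change |b.valMinAbs| < |(a - 2 * b).valMinAbs| ∧ (a - 2 * b).valMinAbs * b.valMinAbs < 0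
    rw [(hval a b h1 h2).2]
    simp only at h3 h4 h5
    rw [mul_neg_iff]
    rcases abs_cases a.valMinAbs with ⟨e1, _⟩ | ⟨e1, _⟩ <;>
    rcases abs_cases b.valMinAbs with ⟨e2, _⟩ | ⟨e2, _⟩ <;>
    rcases abs_cases (a.valMinAbs - 2 * b.valMinAbs) with ⟨e3, _⟩ | ⟨e3, _⟩ <;>
    rw [e1, e2] at h3 <;> rw [e2, e3] <;> omega
  -- The two images are disjoint, since the product of the coordinates is positive on one of them
  -- and negative on the other. So both copies of the mass fit into the opposite cone at once.
  have hpq : ∀ w, p (S w) + q (S.symm w)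
      ≤ if |w.2.valMinAbs| < |w.1.valMinAbs| then 1 else 0 := by
    intro w
    have h1 := hp (S w)
    have h2 := hq (S.symm w)
    rw [Equiv.symm_apply_apply] at h1
    rw [Equiv.apply_symm_apply] at h2
    simp only [p, q]
    by_cases c1 : Q (S w) ∧ (S w).1.valMinAbs ≠ - (S w).2.valMinAbs
    · obtain ⟨h11, h12⟩ := h1 c1.1 c1.2
      rw [if_pos c1, if_neg fun c2 => (h2 c2.1 c2.2).2.not_gt h12, if_pos h11, add_zero]
    · rw [if_neg c1]
      by_cases c2 : Q (S.symm w) ∧ (S.symm w).1.valMinAbs ≠ (S.symm w).2.valMinAbs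
      · rw [if_pos c2, if_pos (h2 c2.1 c2.2).1, zero_add]
      · rw [if_neg c2]
        split_ifs <;> norm_num
  -- Points strictly inside the cone are counted by both `p` and `q`, points on a diagonal by at
  -- least one of them.
  have hsum : ∀ v : ZMod m × ZMod m,
      (if 8 * |v.1.valMinAbs| < m ∧ 8 * |v.2.valMinAbs| < m then
        (if |v.1.valMinAbs| < |v.2.valMinAbs| then 2 else
          if |v.1.valMinAbs| = |v.2.valMinAbs| ∧ v ≠ 0 then 1 else 0) else 0) ≤ p v + q v := by
    rintro ⟨a, b⟩
    have h01 : ∀ (c : Prop) [Decidable c], (0 : ℝ) ≤ if c then 1 else 0 := fun c _ => by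
      split_ifs <;> norm_num
    split_ifs with h1 h2 h3
    · have h4 : Q (a, b) := ⟨h1.1, h1.2, h2.le, fun h => by
        simp only at h h2
        rw [h] at h2
        exact absurd h2 (by simp)⟩
      simp only [p, q]
      rw [if_pos ⟨h4, fun h => by simp only at h h2; rw [h, abs_neg] at h2; exact lt_irrefl _ h2⟩,
        if_pos ⟨h4, fun h => by simp only at h h2; rw [h] at h2; exact lt_irrefl _ h2⟩]
      norm_num
    · simp only at h3
      have hb : b.valMinAbs ≠ 0 := fun h => h3.2 (by
        have ha : a.valMinAbs = 0 := by rw [← abs_eq_zero, h3.1, h, abs_zero]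
        rw [ZMod.valMinAbs_eq_zero] at h ha
        rw [h, ha]; rfl)
      have h4 : Q (a, b) := ⟨h1.1, h1.2, h3.1.le, hb⟩
      simp only [p, q]
      by_cases hab : a.valMinAbs = b.valMinAbs
      · rw [if_pos ⟨h4, fun h => by
          have h' : a.valMinAbs = -b.valMinAbs := h
          omega⟩]
        linarith [h01 (Q (a, b) ∧ a.valMinAbs ≠ b.valMinAbs)]
      · rw [if_pos (c := Q (a, b) ∧ a.valMinAbs ≠ b.valMinAbs) ⟨h4, hab⟩]
        linarith [h01 (Q (a, b) ∧ a.valMinAbs ≠ -b.valMinAbs)]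
    · exact add_nonneg (h01 _) (h01 _)
    · exact add_nonneg (h01 _) (h01 _)
  have hp01 : ∀ v, 0 ≤ p v ∧ p v ≤ 1 := fun v => by simp only [p]; split_ifs <;> norm_num
  have hq01 : ∀ v, 0 ≤ q v ∧ q v ≤ 1 := fun v => by simp only [q]; split_ifs <;> norm_num
  have e1 := (abs_le.1 (hdiff (fun v => p (S v)) fun v => hp01 _)).1
  have e2 := (abs_le.1 (hdiff q hq01)).2
  have e3 : ∑ v, ‖g (S v)‖ ^ 2 * p (S v) = ∑ v, ‖g v‖ ^ 2 * p v :=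
    Equiv.sum_comp S fun v => ‖g v‖ ^ 2 * p v
  have e4 : ∑ v, ‖g (S v)‖ ^ 2 * q v = ∑ v, ‖g v‖ ^ 2 * q (S.symm v) := by
    rw [← Equiv.sum_comp S fun v => ‖g v‖ ^ 2 * q (S.symm v)]
    simp
  have e5 : ∑ v, ‖g v‖ ^ 2 * p (S v) + ∑ v, ‖g v‖ ^ 2 * q (S.symm v)
      ≤ ∑ v : ZMod m × ZMod m, ‖g v‖ ^ 2 * (if |v.2.valMinAbs| < |v.1.valMinAbs| then 1 else 0) := by
    rw [← sum_add_distrib]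
    refine sum_le_sum fun v _ => ?_
    rw [← mul_add]
    exact mul_le_mul_of_nonneg_left (hpq v) (by positivity)
  have e6 : ∑ v, ‖g v‖ ^ 2 * (p v + q v) = ∑ v, ‖g v‖ ^ 2 * p v + ∑ v, ‖g v‖ ^ 2 * q v := by
    rw [← sum_add_distrib]
    exact sum_congr rfl fun v _ => mul_add _ _ _
  refine (sum_le_sum fun v _ => mul_le_mul_of_nonneg_left (hsum v) (by positivity)).trans ?_
  rw [e6]
  linarith

/-- The maps that define the expander. -/
def move : ℕ → ZMod m × ZMod m ≃ ZMod m × ZMod m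
  | 0 => ⟨fun v => (v.1 + 1, v.2), fun v => (v.1 - 1, v.2), fun v => by simp, fun v => by simp⟩
  | 1 => ⟨fun v => (v.1, v.2 + 1), fun v => (v.1, v.2 - 1), fun v => by simp, fun v => by simp⟩
  | 2 => ⟨fun v => (v.1 + 2 * v.2, v.2), fun v => (v.1 - 2 * v.2, v.2),
      fun v => by simp, fun v => by simp⟩
  | 3 => ⟨fun v => (v.1, v.2 + 2 * v.1), fun v => (v.1, v.2 - 2 * v.1),
      fun v => by simp, fun v => by simp⟩
  | _ => Equiv.refl _

/-- A translation multiplies the transform by a character; hence the energy of translations controls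
the frequencies away from the origin. -/
theorem fourier_move_zero (f : ZMod m × ZMod m → ℂ) (ξ : ZMod m × ZMod m) :
    fourier (fun v => f (move 0 v)) ξ = fourier f ξ * ZMod.stdAddChar ξ.1 := by
  rw [fourier, fourier, ← Equiv.sum_comp (move 0) fun w => f w * ZMod.stdAddChar (-(ξ.1 * w.1 + ξ.2 * w.2)), sum_mul]
  refine sum_congr rfl fun v _ => ?_
  rw [mul_assoc, ← AddChar.map_add_eq_mul]
  congr 2
  simp only [move, Equiv.coe_fn_mk]
  ring

theorem fourier_move_one (f : ZMod m × ZMod m → ℂ) (ξ : ZMod m × ZMod m) :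
    fourier (fun v => f (move 1 v)) ξ = fourier f ξ * ZMod.stdAddChar ξ.2 := by
  rw [fourier, fourier, ← Equiv.sum_comp (move 1) fun w => f w * ZMod.stdAddChar (-(ξ.1 * w.1 + ξ.2 * w.2)), sum_mul]
  refine sum_congr rfl fun v _ => ?_
  rw [mul_assoc, ← AddChar.map_add_eq_mul]
  congr 2
  simp only [move, Equiv.coe_fn_mk]
  ring

/-- A shear acts on the frequencies by the inverse transpose, which is again a shear; hence the
ping-pong argument applies to the transform. -/
theorem fourier_move_two (f : ZMod m × ZMod m → ℂ) (ξ : ZMod m × ZMod m) :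
    fourier (fun v => f (move 2 v)) ξ = fourier f (ξ.1, ξ.2 - 2 * ξ.1) := by
  rw [fourier, fourier, ← Equiv.sum_comp (move 2) fun w => f w * ZMod.stdAddChar (-(ξ.1 * w.1 + (ξ.2 - 2 * ξ.1) * w.2))]
  refine sum_congr rfl fun v _ => ?_
  congr 2
  simp only [move, Equiv.coe_fn_mk]
  ring

theorem fourier_move_three (f : ZMod m × ZMod m → ℂ) (ξ : ZMod m × ZMod m) :
    fourier (fun v => f (move 3 v)) ξ = fourier f (ξ.1 - 2 * ξ.2, ξ.2) := by
  rw [fourier, fourier, ← Equiv.sum_comp (move 3) fun w => f w * ZMod.stdAddChar (-((ξ.1 - 2 * ξ.2) * w.1 + ξ.2 * w.2))]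
  refine sum_congr rfl fun v _ => ?_
  congr 2
  simp only [move, Equiv.coe_fn_mk]
  ring

/-- The spectral gap of the expander. -/
theorem sum_sq_le_energy (f : ZMod m × ZMod m → ℝ) (hf : ∑ v, f v = 0) :
    ∑ v, f v ^ 2 ≤ 32 * ∑ e ∈ range 4, ∑ v, (f v - f (move e v)) ^ 2 := by
  set F : ZMod m × ZMod m → ℂ := fun v => f v with hF
  set g := fourier F with hg
  have hm : (0 : ℝ) < (m : ℝ) ^ 2 := by
    have : (0 : ℝ) < m := by exact_mod_cast NeZero.pos m
    positivity
  have hnorm : ∀ v, ‖F v‖ ^ 2 = f v ^ 2 := fun v => by simp [hF]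
  have hen : ∀ e, ∑ ξ, ‖g ξ - fourier (fun v => F (move e v)) ξ‖ ^ 2
      = (m : ℝ) ^ 2 * ∑ v, (f v - f (move e v)) ^ 2 := fun e => by
    simp only [hg, ← fourier_sub]
    rw [sum_norm_fourier_sq]
    congr 1
    refine sum_congr rfl fun v _ => ?_
    rw [hF, ← Complex.ofReal_sub, Complex.norm_real, Real.norm_eq_abs, sq_abs]
  have hN : ∑ ξ, ‖g ξ‖ ^ 2 = (m : ℝ) ^ 2 * ∑ v, f v ^ 2 := by
    rw [hg, sum_norm_fourier_sq]; simp only [hnorm]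
  -- The mean-zero condition removes the frequency 0, the one point near the origin that the
  -- ping-pong argument cannot move.
  have hg0 : g 0 = 0 := by
    have : ((∑ v, f v : ℝ) : ℂ) = 0 := by rw [hf]; simp
    simpa [hg, fourier, hF] using this
  have h0 := hen 0
  have h1 := hen 1
  have h2 := hen 2
  have h3 := hen 3
  simp only [fourier_move_zero, fourier_move_one, fourier_move_two, fourier_move_three, ← hg]
    at h0 h1 h2 h3
  have p1 := ping_pong g
  have p2 := ping_pong fun v => g v.swap
  have hsw : ∀ (h : ZMod m × ZMod m → ℝ), ∑ v : ZMod m × ZMod m, h v.swap = ∑ v, h v :=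
    fun h => Equiv.sum_comp (Equiv.prodComm _ _) h
  have p2' : ∑ v : ZMod m × ZMod m, ‖g v‖ ^ 2 *
      (if 8 * |v.2.valMinAbs| < m ∧ 8 * |v.1.valMinAbs| < m then
        (if |v.2.valMinAbs| < |v.1.valMinAbs| then 2 else
          if |v.2.valMinAbs| = |v.1.valMinAbs| ∧ v.swap ≠ 0 then 1 else 0) else 0)
      ≤ ∑ v : ZMod m × ZMod m, ‖g v‖ ^ 2 * (if |v.1.valMinAbs| < |v.2.valMinAbs| then 1 else 0)
      + 2 * (8 * ∑ v, ‖g v - g (v.1, v.2 - 2 * v.1)‖ ^ 2 + (∑ v, ‖g v‖ ^ 2) / 8) :=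
    (hsw _).symm.le.trans (p2.trans (le_of_eq (congrArg₂ (· + ·)
      (hsw fun v => ‖g v‖ ^ 2 * (if |v.1.valMinAbs| < |v.2.valMinAbs| then 1 else 0)) (congrArg (2 * ·)
      (congrArg₂ (· + ·) (congrArg (8 * ·) (hsw fun v => ‖g v - g (v.1, v.2 - 2 * v.1)‖ ^ 2))
        (congrArg (· / 8) (hsw fun v => ‖g v‖ ^ 2)))))))
  rw [h3] at p1
  rw [h2] at p2'
  -- Far from the origin one of the two coordinates is at least `m / 8` in absolute value, and
  -- `quarter_le_norm_sub` applies to it.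
  have hfar : ∑ v : ZMod m × ZMod m, ‖g v‖ ^ 2 *
      (if 8 * |v.1.valMinAbs| < m ∧ 8 * |v.2.valMinAbs| < m then 0 else 1) ≤
      4 * ((m : ℝ) ^ 2 * ∑ v, (f v - f (move 0 v)) ^ 2 + (m : ℝ) ^ 2 * ∑ v, (f v - f (move 1 v)) ^ 2) := by
    rw [← h0, ← h1, ← sum_add_distrib, mul_sum]
    refine sum_le_sum fun v _ => ?_
    have e : ∀ z : ℂ, ‖g v - g v * z‖ ^ 2 = ‖g v‖ ^ 2 * ‖1 - z‖ ^ 2 := fun z => by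
      rw [← mul_pow, ← norm_mul]; ring_nf
    rw [e, e]
    have n0 : 0 ≤ ‖g v‖ ^ 2 := by positivity
    have n1 : 0 ≤ ‖1 - ZMod.stdAddChar v.1‖ ^ 2 := by positivity
    have n2 : 0 ≤ ‖1 - ZMod.stdAddChar v.2‖ ^ 2 := by positivity
    split_ifs with h
    · rw [mul_zero]; positivity
    · rw [not_and_or, not_lt, not_lt] at h
      rcases h with h | h
      · have := quarter_le_norm_sub h
        nlinarith [mul_nonneg n0 n2, mul_le_mul_of_nonneg_left this n0]
      · have := quarter_le_norm_sub h
        nlinarith [mul_nonneg n0 n1, mul_le_mul_of_nonneg_left this n0]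
  -- A pointwise comparison: near the origin a point in an open cone is counted twice on both sides,
  -- and a point on a diagonal once on the left and twice on the right. Far points are counted at
  -- most twice on the left and three times on the right.
  have hpt : ∑ v, ‖g v‖ ^ 2 + ∑ v : ZMod m × ZMod m, ‖g v‖ ^ 2 *
        (if |v.2.valMinAbs| < |v.1.valMinAbs| then 1 else 0) + ∑ v : ZMod m × ZMod m, ‖g v‖ ^ 2 *
        (if |v.1.valMinAbs| < |v.2.valMinAbs| then 1 else 0) ≤
      3 * ∑ v : ZMod m × ZMod m, ‖g v‖ ^ 2 *
        (if 8 * |v.1.valMinAbs| < m ∧ 8 * |v.2.valMinAbs| < m then 0 else 1) +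
      (∑ v : ZMod m × ZMod m, ‖g v‖ ^ 2 *
        (if 8 * |v.1.valMinAbs| < m ∧ 8 * |v.2.valMinAbs| < m then
          (if |v.1.valMinAbs| < |v.2.valMinAbs| then 2 else
            if |v.1.valMinAbs| = |v.2.valMinAbs| ∧ v ≠ 0 then 1 else 0) else 0) +
      ∑ v : ZMod m × ZMod m, ‖g v‖ ^ 2 *
        (if 8 * |v.2.valMinAbs| < m ∧ 8 * |v.1.valMinAbs| < m then
          (if |v.2.valMinAbs| < |v.1.valMinAbs| then 2 else
            if |v.2.valMinAbs| = |v.1.valMinAbs| ∧ v.swap ≠ 0 then 1 else 0) else 0)) := by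
    rw [mul_sum, ← sum_add_distrib, ← sum_add_distrib, ← sum_add_distrib, ← sum_add_distrib]
    refine sum_le_sum fun v _ => ?_
    rcases eq_or_ne v 0 with rfl | hv
    · simp [hg0]
    have hv' : v.swap ≠ 0 := fun h => hv (by rw [← Prod.swap_swap v, h]; rfl)
    have n0 : 0 ≤ ‖g v‖ ^ 2 := by positivity
    by_cases c1 : 8 * |v.1.valMinAbs| < m ∧ 8 * |v.2.valMinAbs| < m
    · rw [if_pos c1, if_pos c1, if_pos c1.symm]
      rcases lt_trichotomy |v.1.valMinAbs| |v.2.valMinAbs| with h | h | h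
      · rw [if_neg h.not_gt, if_pos h, if_pos h, if_neg h.not_gt, if_neg fun h' => h.ne' h'.1]
        linarith
      · rw [h]; simp [hv, hv']
      · rw [if_pos h, if_neg h.not_gt, if_neg h.not_gt, if_pos h, if_neg fun h' => h.ne' h'.1]
        linarith
    · rw [if_neg c1, if_neg c1, if_neg (mt And.symm c1)]
      split_ifs with h h' <;> linarith
  -- The masses of the two open cones cancel against the right-hand sides of `p1` and `p2'`. Half of
  -- the total mass remains, bounded by 12 times the energy of the translations and 16 times that of
  -- the shears.
  have h32 : (m : ℝ) ^ 2 * ∑ v, f v ^ 2 ≤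
      (m : ℝ) ^ 2 * (32 * ∑ e ∈ range 4, ∑ v, (f v - f (move e v)) ^ 2) := by
    simp only [sum_range_succ, range_zero, sum_empty, zero_add]
    rw [← hN] at *
    have q0 : 0 ≤ (m : ℝ) ^ 2 * ∑ v, (f v - f (move 0 v)) ^ 2 := by positivity
    have q1 : 0 ≤ (m : ℝ) ^ 2 * ∑ v, (f v - f (move 1 v)) ^ 2 := by positivity
    nlinarith
  exact le_of_mul_le_mul_left h32 hm

/-- The average of a function over the neighbours of a vertex. -/
noncomputable def average (f : ZMod m × ZMod m → ℝ) (v : ZMod m × ZMod m) : ℝ :=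
  (∑ e ∈ range 8, f (move e v)) / 8

theorem sum_average (f : ZMod m × ZMod m → ℝ) : ∑ v, average f v = ∑ v, f v := by
  simp only [average]
  rw [← sum_div, sum_comm]
  simp only [Equiv.sum_comp (move _) f]
  simp

/-- Half of the eight neighbours are the vertex itself, so the average is a mean of four midpoints.
The parallelogram law turns the energy into a loss of 1/16 of it, and `32 * 16 = 512`; no lower
bound on the negative spectrum is needed. -/
theorem sum_average_sq_le_of_sum_eq_zero (f : ZMod m × ZMod m → ℝ) (hf : ∑ v, f v = 0) :
    ∑ v, average f v ^ 2 ≤ (1 - 1 / 512) * ∑ v, f v ^ 2 := by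
  have h := sum_sq_le_energy f hf
  have h1 : ∀ v, average f v ^ 2 ≤
      ∑ e ∈ range 4, (f v ^ 2 / 8 + f (move e v) ^ 2 / 8 - (f v - f (move e v)) ^ 2 / 16) := by
    intro v
    have : average f v = (∑ e ∈ range 4, (f v + f (move e v)) / 2) / 4 := by
      simp only [average, sum_range_succ, range_zero, sum_empty, move, Equiv.refl_apply]
      ring
    rw [this]
    simp only [sum_range_succ, range_zero, sum_empty, zero_add]
    generalize f (move 0 v) = a
    generalize f (move 1 v) = b
    generalize f (move 2 v) = c
    generalize f (move 3 v) = d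
    nlinarith [sq_nonneg (a - b), sq_nonneg (a - c), sq_nonneg (a - d), sq_nonneg (b - c),
      sq_nonneg (b - d), sq_nonneg (c - d)]
  refine (sum_le_sum fun v _ => h1 v).trans ?_
  rw [sum_comm]
  simp only [sum_sub_distrib, sum_add_distrib, ← sum_div]
  have h2 : ∀ e, ∑ v, f (move e v) ^ 2 = ∑ v, f v ^ 2 := fun e =>
    Equiv.sum_comp (move e) fun v => f v ^ 2
  simp only [h2]
  simp only [sum_const, card_range, nsmul_eq_mul]
  push_cast
  linarith

/-- Split `f` into its mean and a part of sum zero. Only the second part contracts, but by the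
Cauchy–Schwarz inequality the mean of a function supported on `B` carries at most the fraction `1 -
ρ` of the square norm. -/
theorem sum_average_sq_le (f : ZMod m × ZMod m → ℝ) (B : Finset (ZMod m × ZMod m))
    (hB : ∀ v ∉ B, f v = 0) {ρ : ℝ} (hρ : (#B : ℝ) ≤ (1 - ρ) * (m : ℝ) ^ 2) :
    ∑ v, average f v ^ 2 ≤ (1 - ρ / 512) * ∑ v, f v ^ 2 := by
  have hm : (0 : ℝ) < (m : ℝ) ^ 2 := by
    have : (0 : ℝ) < m := by exact_mod_cast NeZero.pos m
    positivity
  have hcard : ∀ x : ℝ, ∑ _v : ZMod m × ZMod m, x = (m : ℝ) ^ 2 * x := fun x => by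
    simp [sq]
  set c := (∑ v, f v) / (m : ℝ) ^ 2 with hc
  have hcm : ∑ v, f v = (m : ℝ) ^ 2 * c := by
    rw [hc, mul_comm, div_mul_cancel₀ _ hm.ne']
  have h0 : ∑ v, (f v - c) = 0 := by rw [sum_sub_distrib, hcard, hcm, sub_self]
  have h1 := sum_average_sq_le_of_sum_eq_zero (fun v => f v - c) h0
  have h2 : ∀ v, average (fun v => f v - c) v = average f v - c := fun v => by
    rw [average, average, sum_sub_distrib, sum_const, card_range, nsmul_eq_mul]
    push_cast
    ring
  have h3 : ∀ F : ZMod m × ZMod m → ℝ, ∑ v, F v = (m : ℝ) ^ 2 * c →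
      ∑ v, (F v - c) ^ 2 = ∑ v, F v ^ 2 - (m : ℝ) ^ 2 * c ^ 2 := fun F hF => by
    have : ∀ v, (F v - c) ^ 2 = F v ^ 2 - 2 * c * F v + c ^ 2 := fun v => by ring
    simp only [this]
    rw [sum_add_distrib, sum_sub_distrib, ← mul_sum, hcard, hF]
    ring
  simp only [h2] at h1
  rw [h3 _ hcm, h3 _ ((sum_average f).trans hcm)] at h1
  have h4 : ((m : ℝ) ^ 2 * c) ^ 2 ≤ #B * ∑ v, f v ^ 2 := by
    rw [← hcm, ← sum_subset (subset_univ B) fun v _ hv => hB v hv]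
    refine sq_sum_le_card_mul_sum_sq.trans (mul_le_mul_of_nonneg_left ?_ (Nat.cast_nonneg _))
    exact sum_le_univ_sum_of_nonneg fun v => sq_nonneg _
  have h5 : (m : ℝ) ^ 2 * c ^ 2 ≤ (1 - ρ) * ∑ v, f v ^ 2 := by
    have h6 : (0 : ℝ) ≤ ∑ v, f v ^ 2 := sum_nonneg fun v _ => sq_nonneg _
    have h7 := h4.trans (mul_le_mul_of_nonneg_right hρ h6)
    refine le_of_mul_le_mul_left (a := (m : ℝ) ^ 2) ?_ hm
    nlinarith
  nlinarith

end Torus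
end SparseTC

namespace SparseTC
open Finset

/-! ### Amplification of the distance by random walks -/

/-- The neighbours of a vertex of the expander, where the vertex `(x, y)` has the number
`x * m + y`. -/
def neighbour (m e v : ℕ) : ℕ :=
  if e = 0 then (v / m + 1) % m * m + v % m else
  if e = 1 then v / m * m + (v % m + 1) % m else
  if e = 2 then (v / m + 2 * (v % m)) % m * m + v % m else
  if e = 3 then v / m * m + (v % m + 2 * (v / m)) % m else v

/-- A step of a walk, which is directed by the digits of a number. -/
def walkStep (m : ℕ) (q : ℕ × ℕ) : ℕ × ℕ := (q.1 / 16, neighbour m (q.1 / 2 % 8) q.2)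

/-- The table whose rows are the subsets of the walks on the expander with `m * m` vertices. -/
def walkTable (m r j : ℕ) : ℕ :=
  let q := (walkStep m)^[j] (r / (m * m), r % (m * m))
  if q.1 % 2 = 1 then q.2 + 1 else 0

/-- The number of a vertex of the torus. -/
def vertexCode {m : ℕ} (p : ZMod m × ZMod m) : ℕ := p.1.val * m + p.2.val

theorem sum_vertexCode {M : Type*} [AddCommMonoid M] {m : ℕ} [NeZero m] (F : ℕ → M) :
    ∑ p : ZMod m × ZMod m, F (vertexCode p) = ∑ v ∈ range (m * m), F v := by
  have h : ∀ G : ℕ → M, ∑ x : ZMod m, G x.val = ∑ i ∈ range m, G i := by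
    intro G
    obtain ⟨k, rfl⟩ : ∃ k, m = k + 1 := ⟨m - 1, by have := NeZero.pos m; omega⟩
    exact Fin.sum_univ_eq_sum_range G (k + 1)
  rw [sum_range_mul, Fintype.sum_prod_type, ← h]
  exact sum_congr rfl fun x _ => h fun j => F (x.val * m + j)

theorem vertexCode_move {m : ℕ} [NeZero m] (e : ℕ) (p : ZMod m × ZMod m) :
    vertexCode (move e p) = neighbour m e (vertexCode p) := by
  obtain ⟨x, y⟩ := p
  have hy := ZMod.val_lt y
  have h1 : (x.val * m + y.val) / m = x.val := by
    rw [mul_comm, Nat.mul_add_div (by omega), Nat.div_eq_of_lt hy, add_zero]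
  have h2 : (x.val * m + y.val) % m = y.val := by
    rw [mul_comm, Nat.mul_add_mod, Nat.mod_eq_of_lt hy]
  have h3 : ∀ a : ZMod m, (a + 1).val = (a.val + 1) % m := fun a => by
    rw [← ZMod.val_natCast]; congr 1; simp
  have h4 : ∀ a b : ZMod m, (a + 2 * b).val = (a.val + 2 * b.val) % m := fun a b => by
    rw [← ZMod.val_natCast]; congr 1; simp
  match e with
  | 0 => simp [vertexCode, neighbour, move, h1, h2, h3]
  | 1 => simp [vertexCode, neighbour, move, h1, h2, h3]
  | 2 => simp [vertexCode, neighbour, move, h1, h2, h4]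
  | 3 => simp [vertexCode, neighbour, move, h1, h2, h4]
  | e + 4 => simp [vertexCode, neighbour, move]

/-- The sum of the values of `y` on a subset of the vertices of a walk. -/
def walkSum (m : ℕ) (y : ℕ → ZMod 2) (t g v : ℕ) : ZMod 2 :=
  ∑ j ∈ range t, if ((walkStep m)^[j] (g, v)).1 % 2 = 1 then y ((walkStep m)^[j] (g, v)).2 else 0

theorem walkSum_succ (m : ℕ) (y : ℕ → ZMod 2) (t g v : ℕ) : walkSum m y (t + 1) g v
    = walkSum m y t (g / 16) (neighbour m (g / 2 % 8) v) + if g % 2 = 1 then y v else 0 := by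
  rw [walkSum, sum_range_succ']
  rfl

/-- The number of the subsets of walks that start at `v` on which the sum is `1`. -/
def walkCount (m : ℕ) (y : ℕ → ZMod 2) (t v : ℕ) : ℕ :=
  ∑ g ∈ range (16 ^ t), if walkSum m y t g v ≠ 0 then 1 else 0

/-- The last hexadecimal digit of `g` encodes the first step and whether the starting vertex is in
the subset. If `y v = 0`, membership does not matter; otherwise exactly one of the two choices makes
the sum non-zero, whatever happens later. -/
theorem walkCount_succ (m : ℕ) (y : ℕ → ZMod 2) (t v : ℕ) : walkCount m y (t + 1) v
    = if y v = 0 then 2 * ∑ e ∈ range 8, walkCount m y t (neighbour m e v) else 8 * 16 ^ t := by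
  have h2 : ∀ a : ZMod 2, a = 0 ∨ a = 1 := by decide
  have h : walkCount m y (t + 1) v = ∑ e ∈ range 8, ∑ g ∈ range (16 ^ t),
      ((if walkSum m y t g (neighbour m e v) ≠ 0 then 1 else 0) +
        if walkSum m y t g (neighbour m e v) + y v ≠ 0 then 1 else 0) := by
    rw [walkCount, pow_succ, sum_range_mul, sum_comm, show 16 = 8 * 2 from rfl, sum_range_mul]
    refine sum_congr rfl fun e he => ?_
    have he := mem_range.1 he
    rw [sum_range_succ, sum_range_one, add_zero, ← sum_add_distrib]
    refine sum_congr rfl fun g _ => ?_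
    rw [walkSum_succ, walkSum_succ]
    have e1 : (g * (8 * 2) + e * 2) / 16 = g := by omega
    have e2 : (g * (8 * 2) + e * 2) / 2 % 8 = e := by omega
    have e3 : (g * (8 * 2) + e * 2) % 2 = 0 := by omega
    have e4 : (g * (8 * 2) + (e * 2 + 1)) / 16 = g := by omega
    have e5 : (g * (8 * 2) + (e * 2 + 1)) / 2 % 8 = e := by omega
    have e6 : (g * (8 * 2) + (e * 2 + 1)) % 2 = 1 := by omega
    simp only [e1, e2, e3, e4, e5, e6, zero_ne_one, if_false, if_true, add_zero]
  rw [h]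
  split_ifs with hy
  · simp only [hy, add_zero, ← two_mul, ← mul_sum]
    rfl
  · have hy1 := (h2 (y v)).resolve_left hy
    have h3 : ∀ a : ZMod 2, ((if a ≠ 0 then 1 else 0) + if a + 1 ≠ 0 then 1 else 0) = 1 := by decide
    simp only [hy1, h3]
    simp

section

variable {m : ℕ}

/-- The bias of the sums on the subsets of walks that start at a vertex. -/
noncomputable def walkBias (y : ℕ → ZMod 2) (t : ℕ) (p : ZMod m × ZMod m) : ℝ :=
  1 - 2 * walkCount m y t (vertexCode p) / 16 ^ t

theorem walkBias_zero (y : ℕ → ZMod 2) (p : ZMod m × ZMod m) : walkBias y 0 p = 1 := by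
  simp [walkBias, walkCount, walkSum]

variable [NeZero m]

/-- Thus the bias is the probability that the walk avoids the support of `y`: it evolves by
averaging and then restricting to the zeros of `y`. -/
theorem walkBias_succ (y : ℕ → ZMod 2) (t : ℕ) (p : ZMod m × ZMod m) : walkBias y (t + 1) p
    = if y (vertexCode p) = 0 then average (walkBias y t) p else 0 := by
  simp only [walkBias, walkCount_succ, average, vertexCode_move]
  have h16 : (16 : ℝ) ^ t ≠ 0 := by positivity
  split_ifs
  · rw [sum_sub_distrib, ← sum_div, ← mul_sum]
    push_cast
    simp only [sum_const, card_range, nsmul_eq_mul]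
    field_simp
    push_cast
    ring
  · push_cast
    field_simp
    ring

theorem walkBias_nonneg (y : ℕ → ZMod 2) (t : ℕ) (p : ZMod m × ZMod m) : 0 ≤ walkBias y t p := by
  induction t generalizing p with
  | zero => rw [walkBias_zero]; exact zero_le_one
  | succ t ih =>
    rw [walkBias_succ]
    split_ifs
    · exact div_nonneg (sum_nonneg fun e _ => ih _) (by norm_num)
    · exact le_rfl

/-- A walk with `t + 1` vertices gives only `t` contractions, because the initial function 1 is not
supported on the zeros of `y`. -/
theorem sum_walkBias_sq_le (y : ℕ → ZMod 2) {ρ : ℝ} (hρ1 : ρ ≤ 1)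
    (hρ : ρ * (m : ℝ) ^ 2 ≤ weight (m * m) y) (t : ℕ) :
    ∑ p : ZMod m × ZMod m, walkBias y (t + 1) p ^ 2 ≤ (1 - ρ / 512) ^ t * (m : ℝ) ^ 2 := by
  classical
  set B : Finset (ZMod m × ZMod m) := univ.filter fun p => y (vertexCode p) = 0 with hB
  have hcard : (#B : ℝ) ≤ (1 - ρ) * (m : ℝ) ^ 2 := by
    have h1 : #B + weight (m * m) y = m * m := by
      rw [hB, weight, card_filter, card_filter, ← sum_vertexCode fun v => if y v ≠ 0 then 1 else 0,
        ← sum_add_distrib]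
      have : ∀ a : ZMod 2, ((if a = 0 then 1 else 0) + if a ≠ 0 then 1 else 0) = 1 := by decide
      simp only [this]
      simp
    have h2 : (#B : ℝ) + weight (m * m) y = (m : ℝ) ^ 2 := by rw [sq]; exact_mod_cast h1
    linarith
  have hstep : ∀ t, ∑ p : ZMod m × ZMod m, walkBias y (t + 1) p ^ 2
      ≤ ∑ p : ZMod m × ZMod m, average (walkBias y t) p ^ 2 := fun t => by
    refine sum_le_sum fun p _ => ?_
    rw [walkBias_succ]
    split_ifs
    · exact le_rfl
    · simpa using sq_nonneg _
  induction t with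
  | zero =>
    refine (hstep 0).trans ?_
    simp [average, walkBias_zero, sq]
  | succ t ih =>
    refine (hstep (t + 1)).trans ((sum_average_sq_le _ B (fun p hp => ?_) hcard).trans ?_)
    · rw [walkBias_succ, if_neg]
      simpa [hB] using hp
    · rw [pow_succ', mul_assoc]
      exact mul_le_mul_of_nonneg_left ih (by linarith)

/-- The row `g * m ^ 2 + v` belongs to the walk with start `v` and instructions `g`. Truncating the
table at `n` amounts to extending `x` by zero to the remaining vertices. -/
theorem weight_tableMap_walkTable (n t : ℕ) (x : ℕ → ZMod 2) :
    (weight (16 ^ t * (m * m)) (tableMap t (trunc n (walkTable m)) x) : ℝ)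
      = ∑ p : ZMod m × ZMod m, (1 - walkBias (fun v => if v < n then x v else 0) t p) / 2 * 16 ^ t := by
  set y : ℕ → ZMod 2 := fun v => if v < n then x v else 0 with hy
  have h1 : ∀ r, tableMap t (trunc n (walkTable m)) x r
      = walkSum m y t (r / (m * m)) (r % (m * m)) := by
    intro r
    rw [tableMap_apply, walkSum]
    refine sum_congr rfl fun j _ => ?_
    have key : ∀ q : ℕ × ℕ, (if (if (if q.1 % 2 = 1 then q.2 + 1 else 0) ≤ n then
        (if q.1 % 2 = 1 then q.2 + 1 else 0) else 0) = 0 then 0 else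
        x ((if (if q.1 % 2 = 1 then q.2 + 1 else 0) ≤ n then
        (if q.1 % 2 = 1 then q.2 + 1 else 0) else 0) - 1)) = if q.1 % 2 = 1 then y q.2 else 0 := by
      intro q
      by_cases h : q.1 % 2 = 1 <;> by_cases h' : q.2 < n <;> simp [h, h', hy]
    exact key _
  have hmm : 0 < m * m := Nat.mul_pos (NeZero.pos m) (NeZero.pos m)
  have h2 : weight (16 ^ t * (m * m)) (tableMap t (trunc n (walkTable m)) x)
      = ∑ v ∈ range (m * m), walkCount m y t v := by
    simp only [weight, h1, card_filter, walkCount]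
    rw [sum_range_mul, sum_comm]
    refine sum_congr rfl fun v hv => sum_congr rfl fun g _ => ?_
    have hv := mem_range.1 hv
    have e1 : (g * (m * m) + v) / (m * m) = g := by
      rw [mul_comm, Nat.mul_add_div hmm, Nat.div_eq_of_lt hv, add_zero]
    have e2 : (g * (m * m) + v) % (m * m) = v := by
      rw [mul_comm, Nat.mul_add_mod, Nat.mod_eq_of_lt hv]
    rw [e1, e2]
  rw [h2, ← sum_vertexCode, Nat.cast_sum]
  refine sum_congr rfl fun p _ => ?_
  rw [walkBias]
  field_simp
  ring

/-- The map given by the walks turns vectors of large weight into almost balanced ones. -/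
theorem weight_walkTable (n t : ℕ) (hn : n ≤ m * m) (x : ℕ → ZMod 2) {ρ : ℝ} (hρ1 : ρ ≤ 1)
    (hρ : ρ * (m : ℝ) ^ 2 ≤ weight n x) : ∃ a : ℝ, 0 ≤ a ∧ a ^ 2 ≤ (1 - ρ / 512) ^ t ∧
      (weight (16 ^ (t + 1) * (m * m)) (tableMap (t + 1) (trunc n (walkTable m)) x) : ℝ)
        = (1 - a) / 2 * (16 ^ (t + 1) * (m * m) : ℕ) := by
  set y : ℕ → ZMod 2 := fun v => if v < n then x v else 0 with hy
  have hm : (0 : ℝ) < (m : ℝ) ^ 2 := by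
    have : (0 : ℝ) < m := by exact_mod_cast NeZero.pos m
    positivity
  have hw : weight (m * m) y = weight n x := by
    rw [weight, weight]
    congr 1
    ext i
    simp only [mem_filter, mem_range, hy]
    by_cases h : i < n
    · simp [h, h.trans_le hn]
    · simp [h]
  have h := sum_walkBias_sq_le y hρ1 (by rw [hw]; exact hρ) t
  refine ⟨(∑ p : ZMod m × ZMod m, walkBias y (t + 1) p) / (m : ℝ) ^ 2,
    div_nonneg (sum_nonneg fun p _ => walkBias_nonneg _ _ _) hm.le, ?_, ?_⟩
  -- The witness `a` is the mean bias; Cauchy–Schwarz bounds its square by the mean of the squares.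
  · have h1 := sq_sum_le_card_mul_sum_sq (s := (univ : Finset (ZMod m × ZMod m)))
      (f := walkBias y (t + 1))
    have h2 : ((#(univ : Finset (ZMod m × ZMod m)) : ℕ) : ℝ) = (m : ℝ) ^ 2 := by simp [sq]
    rw [h2] at h1
    rw [div_pow, div_le_iff₀ (by positivity)]
    nlinarith
  · rw [weight_tableMap_walkTable, ← sum_mul, ← sum_div, sum_sub_distrib]
    have h2 : ∑ _p : ZMod m × ZMod m, (1 : ℝ) = (m : ℝ) ^ 2 := by simp [sq]
    have hm' : (m : ℝ) ≠ 0 := by exact_mod_cast NeZero.ne m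
    rw [h2]
    push_cast
    field_simp
    rfl

end

/-- The side of the torus that is used for vectors of length `n`. -/
def side (n : ℕ) : ℕ := Nat.sqrt n + 1

/-- The length of the walks that are used for the bias `2 ^ (-l)` and the density `1 / k`. -/
def walkLength (l k : ℕ) : ℕ := 4096 * l * k + 1

/-- The number of the rows of the table of the walks of length `t`. -/
def walkRows (n t : ℕ) : ℕ := 16 ^ t * (side n * side n)

theorem le_side_sq (n : ℕ) : n ≤ side n * side n := (Nat.lt_succ_sqrt n).le

theorem side_sq_le {n : ℕ} (hn : 1 ≤ n) : side n * side n ≤ 4 * n := by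
  have h1 := Nat.sqrt_le n
  have h2 : 1 ≤ Nat.sqrt n := Nat.le_sqrt.2 (by omega)
  unfold side
  nlinarith

theorem walkRows_le {n : ℕ} (hn : 1 ≤ n) (t : ℕ) : walkRows n t ≤ 4 * n * 16 ^ t := by
  rw [walkRows, mul_comm]
  exact Nat.mul_le_mul_right _ (side_sq_le hn)

theorem walkRows_pos (n t : ℕ) : 0 < walkRows n t := by
  unfold walkRows side
  positivity

/-- The torus has at most `4 * n` vertices, so the density drops to `ρ / 4` and a step contracts by
`1 - ρ / 2048`. As `k * ρ ≥ 1`, after `4096 * l * k` steps the square of the bias is at most `exp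
(-2 * l) ≤ 4 ^ (-l)`. -/
theorem weight_walk_bounds {n : ℕ} (hn : 1 ≤ n) (l k : ℕ) {ρ : ℝ} (hk : 1 ≤ k * ρ)
    (hρ0 : 0 < ρ) (hρ1 : ρ ≤ 1) (x : ℕ → ZMod 2) (hx : ρ * n ≤ weight n x) :
    (1 / 2 - (1 / 2) ^ l / 2) * walkRows n (walkLength l k) ≤ (weight (walkRows n (walkLength l k))
      (tableMap (walkLength l k) (trunc n (walkTable (side n))) x) : ℝ) ∧
    (weight (walkRows n (walkLength l k))
      (tableMap (walkLength l k) (trunc n (walkTable (side n))) x) : ℝ)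
      ≤ 1 / 2 * walkRows n (walkLength l k) := by
  have : NeZero (side n) := ⟨Nat.succ_ne_zero _⟩
  have h4 : ((side n : ℕ) : ℝ) ^ 2 ≤ 4 * n := by rw [sq]; exact_mod_cast side_sq_le hn
  obtain ⟨a, ha0, ha, hw⟩ := weight_walkTable (m := side n) n (4096 * l * k) (le_side_sq n) x
    (ρ := ρ / 4) (by linarith) (by nlinarith)
  have ha' : a ≤ (1 / 2) ^ l := by
    refine (pow_le_pow_iff_left₀ ha0 (by positivity) two_ne_zero).1 (ha.trans ?_)
    have e1 : 1 - ρ / 4 / 512 ≤ Real.exp (-(ρ / 2048)) := by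
      have := Real.add_one_le_exp (-(ρ / 2048)); linarith
    have e2 : Real.exp (-2) ≤ 1 / 4 := by
      rw [Real.exp_neg, show (1 / 4 : ℝ) = 4⁻¹ by norm_num]
      refine inv_anti₀ (by norm_num) ?_
      have := Real.add_one_le_exp 1
      have e3 : Real.exp 2 = Real.exp 1 * Real.exp 1 := by rw [← Real.exp_add]; norm_num
      nlinarith
    calc (1 - ρ / 4 / 512) ^ (4096 * l * k) ≤ Real.exp (-(ρ / 2048)) ^ (4096 * l * k) :=
          pow_le_pow_left₀ (by linarith) e1 _
      _ = Real.exp (-(2 * l * (k * ρ))) := by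
          rw [← Real.exp_nat_mul]; congr 1; push_cast; ring
      _ ≤ Real.exp (-(2 * l)) := by
          apply Real.exp_le_exp.2
          have : (0 : ℝ) ≤ 2 * l := by positivity
          nlinarith
      _ = Real.exp (-2) ^ l := by rw [← Real.exp_nat_mul]; congr 1; ring
      _ ≤ (1 / 4) ^ l := pow_le_pow_left₀ (Real.exp_pos _).le e2 _
      _ = ((1 / 2) ^ l) ^ 2 := by rw [← pow_mul, mul_comm, pow_mul]; norm_num
  have hw' : (weight (walkRows n (walkLength l k))
      (tableMap (walkLength l k) (trunc n (walkTable (side n))) x) : ℝ)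
      = (1 - a) / 2 * (walkRows n (walkLength l k)) := hw
  have hpos : (0 : ℝ) < walkRows n (walkLength l k) := by exact_mod_cast walkRows_pos _ _
  rw [hw']
  constructor
  · exact mul_le_mul_of_nonneg_right (by linarith) hpos.le
  · exact mul_le_mul_of_nonneg_right (by linarith) hpos.le

end SparseTC

namespace SparseTC
open Finset

/-! ### Arithmetic in fields of characteristic two -/

/-- The order of 2 modulo `3 ^ (l + 1)` is at least `2 * 3 ^ l`. Modulo 3 the exponent must be even,
`e = 2 * s`, and by lifting the exponent the 3-adic valuation of `4 ^ s - 1` is one more than that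
of `s`. -/
theorem two_mul_three_pow_le {l e : ℕ} (he : e ≠ 0) (h : 3 ^ (l + 1) ∣ 2 ^ e - 1) :
    2 * 3 ^ l ≤ e := by
  have h3 : 3 ∣ 2 ^ e - 1 := (dvd_pow_self 3 (Nat.succ_ne_zero l)).trans h
  obtain ⟨s, rfl | rfl⟩ := Nat.even_or_odd' e
  · have hs : s ≠ 0 := by rintro rfl; simp at he
    rw [pow_mul] at h
    have h4 := padicValNat.pow_sub_pow (p := 3) (x := 4) (y := 1) (by decide) (by norm_num)
      (by norm_num) (by norm_num) hs
    have h5 : 4 ^ s - 1 ≠ 0 := by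
      have := Nat.one_lt_pow hs (show 1 < 4 by norm_num)
      omega
    have h6 := (padicValNat_dvd_iff_le (p := 3) h5).1 (by simpa using h)
    rw [one_pow] at h4
    rw [h4] at h6
    have h7 : padicValNat 3 (4 - 1) = 1 := padicValNat.self (by norm_num)
    have h8 := (padicValNat_dvd_iff_le (p := 3) hs (n := l)).2 (by omega)
    have := Nat.le_of_dvd (Nat.pos_of_ne_zero hs) h8
    omega
  · exfalso
    rw [pow_succ, pow_mul] at h3
    have h4 : (2 ^ 2) ^ s % 3 = 1 := by rw [Nat.pow_mod]; simp
    omega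

section Field

open Polynomial

theorem natDegree_trinomial (l : ℕ) :
    (X ^ (2 * 3 ^ l) + X ^ (3 ^ l) + 1 : (ZMod 2)[X]).natDegree = 2 * 3 ^ l := by
  have hpos : 0 < 3 ^ l := by positivity
  compute_degree!

/-- With `Y = X ^ h` the trinomial is `Y ^ 2 + Y + 1`, a factor of `Y ^ 3 - 1`. So a root of an
irreducible factor `g` has order exactly `3 ^ (l + 1)`. This divides `2 ^ deg g - 1`, and hence `g`
has the full degree. -/
theorem irreducible_trinomial (l : ℕ) :
    Irreducible (X ^ (2 * 3 ^ l) + X ^ (3 ^ l) + 1 : (ZMod 2)[X]) := by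
  set h := 3 ^ l with hh
  have hpos : 0 < h := by positivity
  set f : (ZMod 2)[X] := X ^ (2 * h) + X ^ h + 1 with hf
  have hdeg : f.natDegree = 2 * h := natDegree_trinomial l
  obtain ⟨g, hg, hgf⟩ := exists_irreducible_of_natDegree_pos (f := f) (by omega)
  suffices 2 * h ≤ g.natDegree from
    (associated_of_dvd_of_natDegree_le hgf (by rintro h0; rw [h0] at hdeg; simp at hdeg; omega)
      (by omega)).irreducible hg
  have : Fact (Irreducible g) := ⟨hg⟩
  set θ := AdjoinRoot.root g with hθ
  have hroot : θ ^ (2 * h) + θ ^ h + 1 = 0 := by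
    have h1 : AdjoinRoot.mk g f = 0 := AdjoinRoot.mk_eq_zero.2 hgf
    simpa only [hf, map_add, map_pow, map_one, AdjoinRoot.mk_X] using h1
  let pb := AdjoinRoot.powerBasis hg.ne_zero
  have : Module.Finite (ZMod 2) (AdjoinRoot g) := pb.finite
  have : Finite (AdjoinRoot g) := Module.finite_of_finite (ZMod 2)
  have := Fintype.ofFinite (AdjoinRoot g)
  have hcard : Fintype.card (AdjoinRoot g) = 2 ^ g.natDegree := by
    rw [Module.card_eq_pow_finrank (K := ZMod 2), pb.finrank, ZMod.card]
    rfl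
  have h2 : (2 : AdjoinRoot g) = 0 := by
    have h3 := congrArg (algebraMap (ZMod 2) (AdjoinRoot g)) (show (2 : ZMod 2) = 0 from rfl)
    rwa [map_ofNat, map_zero] at h3
  have h3 : θ ^ 3 ^ (l + 1) = 1 := by
    rw [pow_succ, ← hh, pow_mul]
    rw [mul_comm, pow_mul] at hroot
    linear_combination (θ ^ h - 1) * hroot
  have h1 : ¬ θ ^ 3 ^ l = 1 := by
    intro h4
    rw [mul_comm, pow_mul, hh, h4] at hroot
    have : (1 : AdjoinRoot g) = 0 := by linear_combination hroot - h2
    exact one_ne_zero this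
  have : Fact (Nat.Prime 3) := ⟨Nat.prime_three⟩
  have h5 := orderOf_eq_prime_pow h1 h3
  have h6 : θ ≠ 0 := by
    intro h0
    rw [h0, zero_pow (by positivity)] at h3
    exact zero_ne_one h3
  have h7 := orderOf_dvd_of_pow_eq_one (FiniteField.pow_card_sub_one_eq_one θ h6)
  rw [h5, hcard] at h7
  exact two_mul_three_pow_le hg.natDegree_pos.ne' h7

/-- All that is used of the field later: the relation for the generator, and coordinates with
respect to its powers, indexed by `ℕ`. -/
theorem exists_binary_field (l : ℕ) : ∃ (K : Type) (_ : Field K) (_ : Algebra (ZMod 2) K) (θ : K)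
    (coord : ℕ → K →ₗ[ZMod 2] ZMod 2), θ ^ (2 * 3 ^ l) + θ ^ 3 ^ l + 1 = 0 ∧
      (∀ u c, u < 2 * 3 ^ l → c < 2 * 3 ^ l → coord c (θ ^ u) = if u = c then 1 else 0) ∧
      ∀ z, (∀ c < 2 * 3 ^ l, coord c z = 0) → z = 0 := by
  set f : (ZMod 2)[X] := X ^ (2 * 3 ^ l) + X ^ (3 ^ l) + 1 with hf
  have hfact : Fact (Irreducible f) := ⟨irreducible_trinomial l⟩
  have hpos : 0 < 3 ^ l := by positivity
  have hdeg : f.natDegree = 2 * 3 ^ l := natDegree_trinomial l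
  let pb := AdjoinRoot.powerBasis hfact.out.ne_zero
  have hdim : pb.dim = 2 * 3 ^ l := hdeg
  refine ⟨AdjoinRoot f, inferInstance, inferInstance, AdjoinRoot.root f, fun c =>
    if hc : c < pb.dim then pb.basis.coord ⟨c, hc⟩ else 0, ?_, fun u c hu hc => ?_, fun z hz => ?_⟩
  · have h1 : AdjoinRoot.mk f f = 0 := AdjoinRoot.mk_self
    simpa only [hf, map_add, map_pow, map_one, AdjoinRoot.mk_X] using h1
  · have h1 : AdjoinRoot.root f ^ u = pb.basis ⟨u, by omega⟩ := by
      rw [pb.basis_eq_pow]; rfl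
    dsimp only
    rw [dif_pos (by omega), h1, Module.Basis.coord_apply, Module.Basis.repr_self,
      Finsupp.single_apply]
    simp
  · apply pb.basis.ext_elem
    intro i
    have := hz i (by have := i.2; omega)
    dsimp only at this
    rw [dif_pos i.2] at this
    simpa using this

end Field

/-- Multiplication by the generator of the field with `q ^ 2` elements; the bits of a number are the
coefficients of an element of the field. -/
def mulGen (q a : ℕ) : ℕ := if 2 * a < q * q then 2 * a else (2 * a) ^^^ (q * q ^^^ (q ^^^ 1))

/-- A step of the multiplication of two elements of the field. -/
def mulStep (q : ℕ) (s : (ℕ × ℕ) × ℕ) : (ℕ × ℕ) × ℕ :=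
  ((mulGen q s.1.1, s.1.2 / 2), if s.1.2 % 2 = 1 then s.2 ^^^ s.1.1 else s.2)

/-- Multiplication in the field with `q ^ 2 = 2 ^ k` elements. -/
def fieldMul (q k a b : ℕ) : ℕ := ((mulStep q)^[k] ((a, b), 0)).2

section

variable {K : Type} [Field K]

/-- The element of the field whose coefficients are the first `N` bits of a number. -/
def bitsSum (θ : K) (N a : ℕ) : K := ∑ u ∈ range N, if a.testBit u then θ ^ u else 0

theorem bitsSum_two_pow (θ : K) {N u : ℕ} (h : u < N) : bitsSum θ N (2 ^ u) = θ ^ u := by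
  rw [bitsSum, sum_eq_single u (fun v _ hv => by rw [Nat.testBit_two_pow_of_ne hv.symm]; simp)
    (fun hu => absurd (mem_range.2 h) hu), Nat.testBit_two_pow_self, if_pos rfl]

theorem bitsSum_two_mul (θ : K) (N a : ℕ) : bitsSum θ (N + 1) (2 * a) = θ * bitsSum θ N a := by
  rw [bitsSum, sum_range_succ', bitsSum, mul_sum]
  simp only [Nat.testBit_zero, Nat.testBit_succ, Nat.mul_div_cancel_left a two_pos]
  simp [pow_succ']

theorem bitsSum_succ_of_lt (θ : K) {N a : ℕ} (h : a < 2 ^ N) :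
    bitsSum θ (N + 1) a = bitsSum θ N a := by
  rw [bitsSum, sum_range_succ, Nat.testBit_lt_two_pow h]
  simp [bitsSum]

variable [Algebra (ZMod 2) K]

theorem two_eq_zero_of_algebra (K : Type) [Field K] [Algebra (ZMod 2) K] : (2 : K) = 0 := by
  have h3 := congrArg (algebraMap (ZMod 2) K) (show (2 : ZMod 2) = 0 from rfl)
  rwa [map_ofNat, map_zero] at h3

theorem bitsSum_xor (θ : K) (N a b : ℕ) :
    bitsSum θ N (a ^^^ b) = bitsSum θ N a + bitsSum θ N b := by
  rw [bitsSum, bitsSum, bitsSum, ← sum_add_distrib]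
  refine sum_congr rfl fun u _ => ?_
  rw [Nat.testBit_xor]
  have h2 := two_eq_zero_of_algebra K
  cases a.testBit u <;> cases b.testBit u <;> simp
  linear_combination (-θ ^ u) * h2

variable {θ : K} {h : ℕ}

/-- If doubling produces the bit `2 * h`, then the added trinomial clears it. -/
theorem mulGen_lt {h : ℕ} (hh : 0 < h) {a : ℕ} (ha : a < 2 ^ (2 * h)) :
    mulGen (2 ^ h) a < 2 ^ (2 * h) := by
  have hq : 2 ^ h * 2 ^ h = 2 ^ (2 * h) := by rw [← pow_add, two_mul]
  rw [mulGen, hq]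
  split_ifs with hlt
  · exact hlt
  · have h1 : 2 * a < 2 ^ (2 * h + 1) := by rw [pow_succ]; omega
    refine Nat.lt_pow_two_of_testBit _ fun i hi => ?_
    have e1 : (2 ^ h).testBit i = false := Nat.testBit_two_pow_of_ne (by omega)
    have e2 : (1 : ℕ).testBit i = false := by
      rw [show (1 : ℕ) = 2 ^ 0 from rfl]; exact Nat.testBit_two_pow_of_ne (by omega)
    rw [Nat.testBit_xor, Nat.testBit_xor, Nat.testBit_xor, e1, e2]
    rcases hi.eq_or_lt with rfl | hi
    · have e3 : (2 * a).testBit (2 * h) = true := by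
        rw [Nat.testBit_eq_decide_div_mod_eq]
        have : 2 * a / 2 ^ (2 * h) = 1 := by
          rw [Nat.div_eq_iff (by positivity)]
          rw [pow_succ] at h1
          omega
        simp [this]
      rw [e3, Nat.testBit_two_pow_self]
      rfl
    · rw [Nat.testBit_two_pow_of_ne hi.ne,
        Nat.testBit_lt_two_pow (h1.trans_le (Nat.pow_le_pow_right two_pos hi))]
      rfl

/-- For `q = 2 ^ h` the number `q * q ^^^ (q ^^^ 1)` has the coefficients of the trinomial as bits,
so adding it is a reduction modulo the relation for `θ`. -/
theorem mulGen_spec (hh : 0 < h) (hθ : θ ^ (2 * h) + θ ^ h + 1 = 0) {a : ℕ} (ha : a < 2 ^ (2 * h)) :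
    bitsSum θ (2 * h) (mulGen (2 ^ h) a) = θ * bitsSum θ (2 * h) a := by
  have hq : 2 ^ h * 2 ^ h = 2 ^ (2 * h) := by rw [← pow_add, two_mul]
  have hb := mulGen_lt hh ha
  rw [mulGen, hq] at hb ⊢
  split_ifs at hb ⊢ with hlt
  · rw [← bitsSum_two_mul, bitsSum_succ_of_lt θ hlt]
  · rw [← bitsSum_succ_of_lt θ hb, bitsSum_xor, bitsSum_two_mul, bitsSum_xor, bitsSum_xor,
      bitsSum_two_pow θ (by omega), bitsSum_two_pow θ (by omega)]
    have e4 : bitsSum θ (2 * h + 1) 1 = 1 := by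
      simpa using bitsSum_two_pow θ (N := 2 * h + 1) (u := 0) (by omega)
    rw [e4]
    linear_combination hθ

/-- Bounds the intermediate values, for the running time of the multiplication. -/
theorem mulStep_iterate_lt (hh : 0 < h) {a b : ℕ} (ha : a < 2 ^ (2 * h)) (i : ℕ) :
    ((mulStep (2 ^ h))^[i] ((a, b), 0)).1.1 < 2 ^ (2 * h) ∧
      ((mulStep (2 ^ h))^[i] ((a, b), 0)).1.2 ≤ b ∧
      ((mulStep (2 ^ h))^[i] ((a, b), 0)).2 < 2 ^ (2 * h) := by
  induction i with
  | zero => exact ⟨ha, le_rfl, by positivity⟩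
  | succ i ih =>
    rw [Function.iterate_succ_apply']
    refine ⟨mulGen_lt hh ih.1, (Nat.div_le_self _ _).trans ih.2.1, ?_⟩
    simp only [mulStep]
    split_ifs
    · exact Nat.xor_lt_two_pow ih.2.2 ih.1
    · exact ih.2.2

/-- Shift and add: after `i` steps the state consists of `θ ^ i` times the first factor, the
remaining bits of `b`, and the product of the first factor with the first `i` bits of `b`. -/
theorem fieldMul_spec (hh : 0 < h) (hθ : θ ^ (2 * h) + θ ^ h + 1 = 0) {a b : ℕ}
    (ha : a < 2 ^ (2 * h)) : fieldMul (2 ^ h) (2 * h) a b < 2 ^ (2 * h) ∧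
      bitsSum θ (2 * h) (fieldMul (2 ^ h) (2 * h) a b)
        = bitsSum θ (2 * h) a * bitsSum θ (2 * h) b := by
  have key : ∀ i, ∃ a' c, (mulStep (2 ^ h))^[i] ((a, b), 0) = ((a', b / 2 ^ i), c) ∧
      a' < 2 ^ (2 * h) ∧ c < 2 ^ (2 * h) ∧ bitsSum θ (2 * h) a' = θ ^ i * bitsSum θ (2 * h) a ∧
      bitsSum θ (2 * h) c = bitsSum θ (2 * h) a * bitsSum θ i b := by
    intro i
    induction i with
    | zero =>
      refine ⟨a, 0, by simp, ha, by positivity, by simp, ?_⟩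
      simp [bitsSum]
    | succ i ih =>
      obtain ⟨a', c, h1, h2, h3, h4, h5⟩ := ih
      have h6 := mulGen_spec hh hθ h2
      rw [Function.iterate_succ_apply', h1]
      refine ⟨mulGen (2 ^ h) a', if b / 2 ^ i % 2 = 1 then c ^^^ a' else c, ?_, mulGen_lt hh h2, ?_, ?_, ?_⟩
      · simp [mulStep, Nat.div_div_eq_div_mul, pow_succ]
      · split_ifs
        · exact Nat.xor_lt_two_pow h3 h2
        · exact h3
      · rw [h6, h4]; ring
      · rw [show bitsSum θ (i + 1) b = bitsSum θ i b + _ from sum_range_succ _ _,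
          Nat.testBit_eq_decide_div_mod_eq]
        simp only [decide_eq_true_eq]
        split_ifs
        · rw [bitsSum_xor, h4, h5]; ring
        · rw [h5, add_zero]
  obtain ⟨a', c, h1, h2, h3, h4, h5⟩ := key (2 * h)
  rw [fieldMul, h1]
  exact ⟨h3, h5⟩

theorem coord_bitsSum {N : ℕ} {coord : ℕ → K →ₗ[ZMod 2] ZMod 2}
    (hc : ∀ u c, u < N → c < N → coord c (θ ^ u) = if u = c then 1 else 0) {c : ℕ} (hcN : c < N)
    (a : ℕ) : coord c (bitsSum θ N a) = if a.testBit c then 1 else 0 := by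
  rw [bitsSum, map_sum, sum_eq_single c]
  · split_ifs <;> simp [hc c c hcN hcN]
  · intro u hu hne
    split_ifs
    · rw [hc u c (mem_range.1 hu) hcN, if_neg hne]
    · simp
  · exact fun h => absurd (mem_range.2 hcN) h

theorem bitsSum_injective {N : ℕ} {coord : ℕ → K →ₗ[ZMod 2] ZMod 2}
    (hc : ∀ u c, u < N → c < N → coord c (θ ^ u) = if u = c then 1 else 0) {a b : ℕ}
    (ha : a < 2 ^ N) (hb : b < 2 ^ N) (hab : bitsSum θ N a = bitsSum θ N b) : a = b := by
  refine Nat.eq_of_testBit_eq fun c => ?_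
  rcases lt_or_ge c N with hcN | hcN
  · have := congrArg (coord c) hab
    rw [coord_bitsSum hc hcN, coord_bitsSum hc hcN] at this
    cases h1 : a.testBit c <;> cases h2 : b.testBit c <;> simp_all
  · rw [Nat.testBit_lt_two_pow (ha.trans_le (Nat.pow_le_pow_right two_pos hcN)),
      Nat.testBit_lt_two_pow (hb.trans_le (Nat.pow_le_pow_right two_pos hcN))]

end

/-! ### Codes of constant relative distance -/

/-- The element `θ ^ b * α ^ j` of the field. -/
def monomialCode (q k α b j : ℕ) : ℕ := (fun z => fieldMul q k z α)^[j] ((mulGen q)^[b] 1)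

/-- The table of the code that consists of the values `p α` and `α * p α` of a polynomial `p`. -/
def evalTable (q k r u : ℕ) : ℕ :=
  if (monomialCode q k (r / (2 * k)) (u % k)
    (u / k + if r % (2 * k) < k then 0 else 1)).testBit (r % (2 * k) % k) then u + 1 else 0

theorem evalTable_le (q k r u : ℕ) : evalTable q k r u ≤ u + 1 := by
  unfold evalTable
  split_ifs <;> omega

theorem monomialCode_spec {K : Type} [Field K] [Algebra (ZMod 2) K] {θ : K} {h : ℕ} (hh : 0 < h)
    (hθ : θ ^ (2 * h) + θ ^ h + 1 = 0) (α b j : ℕ) :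
    monomialCode (2 ^ h) (2 * h) α b j < 2 ^ (2 * h) ∧
      bitsSum θ (2 * h) (monomialCode (2 ^ h) (2 * h) α b j)
        = θ ^ b * bitsSum θ (2 * h) α ^ j := by
  induction j with
  | zero =>
    simp only [monomialCode, Function.iterate_zero, id, pow_zero, mul_one]
    induction b with
    | zero =>
      refine ⟨Nat.one_lt_two_pow (by omega), ?_⟩
      simpa using bitsSum_two_pow θ (N := 2 * h) (u := 0) (by omega)
    | succ b ih =>
      rw [Function.iterate_succ_apply']
      exact ⟨mulGen_lt hh ih.1, by rw [mulGen_spec hh hθ ih.1, ih.2]; ring⟩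
  | succ j ih =>
    rw [monomialCode, Function.iterate_succ_apply', ← monomialCode]
    have := fieldMul_spec hh hθ (b := α) ih.1
    exact ⟨this.1, by rw [this.2, ih.2]; ring⟩

end SparseTC

namespace SparseTC
open Finset

/-- The message bit `u` is the coordinate `u % k` of the coefficient `u / k`, where `k = 2 * h`.
Each point owns `2 * k` rows, the first `k` for `p α` and the others for `α * p α`. -/
theorem tableMap_evalTable {K : Type} [Field K] [Algebra (ZMod 2) K] {θ : K} {h : ℕ} (hh : 0 < h)
    (hθ : θ ^ (2 * h) + θ ^ h + 1 = 0) {coord : ℕ → K →ₗ[ZMod 2] ZMod 2}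
    (hc : ∀ u c, u < 2 * h → c < 2 * h → coord c (θ ^ u) = if u = c then 1 else 0)
    (n : ℕ) (x : ℕ → ZMod 2) (i : ℕ) {c : ℕ} (hc2 : c < 2 * (2 * h)) :
    tableMap n (evalTable (2 ^ h) (2 * h)) x (i * (2 * (2 * h)) + c)
      = coord (c % (2 * h)) ((∑ u ∈ range n, x u • (θ ^ (u % (2 * h)) *
          bitsSum θ (2 * h) i ^ (u / (2 * h)))) *
          bitsSum θ (2 * h) i ^ (if c < 2 * h then 0 else 1)) := by
  have e1 : (i * (2 * (2 * h)) + c) / (2 * (2 * h)) = i := by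
    rw [mul_comm, Nat.mul_add_div (by omega), Nat.div_eq_of_lt hc2, add_zero]
  have e2 : (i * (2 * (2 * h)) + c) % (2 * (2 * h)) = c := by
    rw [mul_comm, Nat.mul_add_mod, Nat.mod_eq_of_lt hc2]
  rw [tableMap_apply, sum_mul, map_sum]
  refine sum_congr rfl fun u _ => ?_
  obtain ⟨h1, h2⟩ := monomialCode_spec hh hθ i (u % (2 * h))
    (u / (2 * h) + if c < 2 * h then 0 else 1)
  rw [smul_mul_assoc, mul_assoc, ← pow_add, ← h2, map_smul,
    coord_bitsSum hc (Nat.mod_lt _ (by omega)), evalTable, e1, e2]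
  split_ifs <;> simp_all

open Polynomial in
/-- The code that consists of the values of polynomials has a constant relative distance. -/
theorem weight_evalTable (l : ℕ) {n k m s : ℕ} (hk : k = 2 * 3 ^ l) (hn : n ≤ m * k)
    (hm : 4 * m ≤ 2 ^ k) (hs : #{S ∈ (range (2 * k)).powerset | #S ≤ s} ≤ m) {x : ℕ → ZMod 2}
    (hx : ∃ u < n, x u ≠ 0) :
    (s + 1) * (2 * m) ≤ weight (4 * m * (2 * k)) (tableMap n (evalTable (2 ^ 3 ^ l) k) x) := by
  classical
  subst hk
  obtain ⟨K, _, _, θ, coord, hθ, hc, hz⟩ := exists_binary_field l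
  set h := 3 ^ l with hh
  have hpos : 0 < h := by positivity
  have hy := fun i c => tableMap_evalTable hpos hθ hc n x i (c := c)
  set y := tableMap n (evalTable (2 ^ h) (2 * h)) x with hydef
  set α : ℕ → K := bitsSum θ (2 * h) with hα
  let x' : ℕ → ZMod 2 := fun u => if u < n then x u else 0
  let a : ℕ → K := fun j => ∑ b ∈ range (2 * h), x' (j * (2 * h) + b) • θ ^ b
  let p : K[X] := ∑ j ∈ range m, monomial j (a j)
  have hcoeff : ∀ j, p.coeff j = if j < m then a j else 0 := fun j => by
    simp [p, coeff_monomial]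
  have hcoord : ∀ j, ∀ c < 2 * h, coord c (a j) = x' (j * (2 * h) + c) := fun j c hcc => by
    simp only [a, map_sum, map_smul]
    rw [sum_eq_single c]
    · rw [hc c c hcc hcc]; simp
    · intro b hb hne
      rw [hc b c (mem_range.1 hb) hcc, if_neg hne, smul_zero]
    · exact fun hcn => absurd (mem_range.2 hcc) hcn
  have hp0 : p ≠ 0 := by
    obtain ⟨u, hu, hxu⟩ := hx
    intro hp
    have h1 : u / (2 * h) < m := (Nat.div_lt_iff_lt_mul (by omega)).2 (by omega)
    have h2 := hcoord (u / (2 * h)) (u % (2 * h)) (Nat.mod_lt _ (by omega))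
    have h3 := hcoeff (u / (2 * h))
    rw [if_pos h1, hp, coeff_zero] at h3
    rw [← h3, map_zero, Nat.div_add_mod'] at h2
    exact hxu (by simpa [x', hu] using h2.symm)
  have hdeg : p.natDegree < m := by
    rw [natDegree_lt_iff_degree_lt hp0, degree_lt_iff_coeff_zero]
    intro j hj
    rw [hcoeff, if_neg (by omega)]
  have hP : ∀ i, ∑ u ∈ range n, x u • (θ ^ (u % (2 * h)) * α i ^ (u / (2 * h))) = p.eval (α i) := by
    intro i
    have h1 : ∑ u ∈ range n, x u • (θ ^ (u % (2 * h)) * α i ^ (u / (2 * h)))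
        = ∑ u ∈ range (m * (2 * h)), x' u • (θ ^ (u % (2 * h)) * α i ^ (u / (2 * h))) := by
      rw [← sum_subset (range_mono hn)]
      · exact sum_congr rfl fun u hu => by simp [x', mem_range.1 hu]
      · intro u _ hu
        have : ¬ u < n := by simpa using hu
        simp [x', this]
    rw [h1, sum_range_mul, eval_finsetSum]
    refine sum_congr rfl fun j _ => ?_
    rw [eval_monomial, sum_mul]
    refine sum_congr rfl fun b hb => ?_
    have hb := mem_range.1 hb
    have e1 : (j * (2 * h) + b) / (2 * h) = j := by
      rw [mul_comm, Nat.mul_add_div (by omega), Nat.div_eq_of_lt hb, add_zero]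
    have e2 : (j * (2 * h) + b) % (2 * h) = b := by
      rw [mul_comm, Nat.mul_add_mod, Nat.mod_eq_of_lt hb]
    rw [e1, e2, smul_mul_assoc]
  simp only [hP] at hy
  have hinj : ∀ i < 4 * m, ∀ j < 4 * m, α i = α j → i = j := fun i hi j hj hij =>
    bitsSum_injective hc (hi.trans_le hm) (hj.trans_le hm) hij
  let supp : ℕ → Finset ℕ := fun i => {c ∈ range (2 * (2 * h)) | y (i * (2 * (2 * h)) + c) ≠ 0}
  have hw : weight (4 * m * (2 * (2 * h))) y = ∑ i ∈ range (4 * m), #(supp i) := by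
    simp only [weight, supp, card_filter]
    rw [sum_range_mul]
  let zeros : Finset ℕ := {i ∈ range (4 * m) | p.eval (α i) = 0}
  let low : Finset ℕ := {i ∈ range (4 * m) | p.eval (α i) ≠ 0 ∧ #(supp i) ≤ s}
  -- The degree of `p` is below `m`, and the points are distinct.
  have hzeros : #zeros ≤ m := by
    have h1 : #zeros ≤ #p.roots.toFinset := by
      refine card_le_card_of_injOn α (fun i hi => ?_) fun i hi j hj hij => ?_
      · have : eval (α i) p = 0 := (mem_filter.1 hi).2
        simp [hp0, this]
      · exact hinj i (mem_range.1 (mem_filter.1 hi).1) j (mem_range.1 (mem_filter.1 hj).1) hij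
    exact ((h1.trans (Multiset.toFinset_card_le _)).trans p.card_roots').trans hdeg.le
  -- Where `p` does not vanish, the support of the pair determines both `p α` and `α * p α`, hence
  -- `α`. So the points with light pairs inject into the sets with at most `s` elements.
  have hlow : #low ≤ m := by
    refine (card_le_card_of_injOn supp (fun i hi => ?_) fun i hi j hj hij => ?_).trans hs
    · have := (mem_filter.1 hi).2.2
      simp only [coe_filter, mem_powerset, Set.mem_ofPred_eq]
      exact ⟨filter_subset _ _, this⟩
    · obtain ⟨hi1, hi2, -⟩ := mem_filter.1 hi
      obtain ⟨hj1, -, -⟩ := mem_filter.1 hj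
      have heq : ∀ c < 2 * (2 * h), y (i * (2 * (2 * h)) + c) = y (j * (2 * (2 * h)) + c) := by
        intro c hcc
        have h1 : c ∈ supp i ↔ c ∈ supp j := by rw [hij]
        simp only [supp, mem_filter, mem_range, hcc, true_and] at h1
        have h2 : ∀ a b : ZMod 2, (a ≠ 0 ↔ b ≠ 0) → a = b := by decide
        exact h2 _ _ h1
      have e1 : p.eval (α i) = p.eval (α j) := by
        refine sub_eq_zero.1 (hz _ fun c hcc => ?_)
        have := heq c (by omega)
        rw [hy i c (by omega), hy j c (by omega), if_pos hcc, Nat.mod_eq_of_lt hcc] at this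
        rw [map_sub, sub_eq_zero]
        simpa using this
      have e2 : p.eval (α i) * α i = p.eval (α j) * α j := by
        refine sub_eq_zero.1 (hz _ fun c hcc => ?_)
        have := heq (2 * h + c) (by omega)
        rw [hy i _ (by omega), hy j _ (by omega), if_neg (by omega), Nat.add_mod_left,
          Nat.mod_eq_of_lt hcc] at this
        rw [map_sub, sub_eq_zero]
        simpa using this
      rw [e1] at e2 hi2
      exact hinj i (mem_range.1 hi1) j (mem_range.1 hj1) (mul_left_cancel₀ hi2 e2)
  rw [hw]
  have hrest : 2 * m ≤ #(range (4 * m) \ (zeros ∪ low)) := by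
    have h1 := le_card_sdiff (zeros ∪ low) (range (4 * m))
    have h2 := card_union_le zeros low
    rw [card_range] at h1
    omega
  calc (s + 1) * (2 * m) ≤ (s + 1) * #(range (4 * m) \ (zeros ∪ low)) :=
        Nat.mul_le_mul_left _ hrest
    _ = ∑ _i ∈ range (4 * m) \ (zeros ∪ low), (s + 1) := by rw [sum_const, smul_eq_mul, mul_comm]
    _ ≤ ∑ i ∈ range (4 * m) \ (zeros ∪ low), #(supp i) := by
        refine sum_le_sum fun i hi => ?_
        rw [mem_sdiff, mem_union, not_or] at hi
        obtain ⟨hi1, hi2, hi3⟩ := hi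
        have h1 : p.eval (α i) ≠ 0 := fun h0 => hi2 (mem_filter.2 ⟨hi1, h0⟩)
        by_contra! h2
        exact hi3 (mem_filter.2 ⟨hi1, h1, by omega⟩)
    _ ≤ _ := sum_le_sum_of_subset sdiff_subset

/-- Give each set `S` the weight `16 ^ (-#S)`: the total is `(17 / 16) ^ N`, and every small set
contributes at least `16 ^ (-s)`. -/
theorem card_small_subsets_le (N s : ℕ) :
    (#{S ∈ (range N).powerset | #S ≤ s} : ℝ) ≤ 16 ^ s * (17 / 16) ^ N := by
  have h1 : ∑ S ∈ (range N).powerset, (1 / 16 : ℝ) ^ #S = (17 / 16) ^ N := by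
    have := Finset.sum_pow_mul_eq_add_pow (1 / 16 : ℝ) 1 (range N)
    simp only [one_pow, mul_one, card_range] at this
    rw [this]; norm_num
  have h2 : ∑ S ∈ (range N).powerset with #S ≤ s, (1 / 16 : ℝ) ^ s ≤ (17 / 16) ^ N := by
    rw [← h1]
    refine (sum_le_sum fun S hS => ?_).trans
      (sum_le_sum_of_subset_of_nonneg (filter_subset _ _) fun _ _ _ => by positivity)
    exact pow_le_pow_of_le_one (by norm_num) (by norm_num) (mem_filter.1 hS).2
  rw [sum_const, nsmul_eq_mul, one_div, inv_pow, ← div_eq_mul_inv, div_le_iff₀ (by positivity)] at h2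
  linarith

/-- Half of the degree of the field that is used for messages of length `n`. -/
def halfDegree (n : ℕ) : ℕ := (fun h => if 2 * n + 4 ≤ 4 ^ h then h else 3 * h)^[n] 1

/-- Either the search has stopped, or it has tripled in every step so far. In the first alternative,
and also in general, the previous power of 3 was too small. -/
theorem halfDegree_iterate (n i : ℕ) : ∃ l,
    (fun h => if 2 * n + 4 ≤ 4 ^ h then h else 3 * h)^[i] 1 = 3 ^ l ∧
      (l = 0 ∨ 4 ^ 3 ^ (l - 1) < 2 * n + 4) ∧ (2 * n + 4 ≤ 4 ^ 3 ^ l ∨ l = i) := by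
  induction i with
  | zero => exact ⟨0, rfl, .inl rfl, .inr rfl⟩
  | succ i ih =>
    obtain ⟨l, h1, h2, h3⟩ := ih
    rw [Function.iterate_succ_apply', h1]
    by_cases h : 2 * n + 4 ≤ 4 ^ 3 ^ l
    · exact ⟨l, by rw [if_pos h], h2, .inl h⟩
    · refine ⟨l + 1, by rw [if_neg h, pow_succ'], .inr (by simpa using h), .inr ?_⟩
      rw [h3.resolve_left h]

/-- The search stops within `n` steps, since `4 ^ 3 ^ n ≥ 2 * n + 4`. -/
theorem halfDegree_spec (n : ℕ) : ∃ l, halfDegree n = 3 ^ l ∧ 2 * n + 4 ≤ 4 ^ 3 ^ l ∧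
    (l = 0 ∨ 4 ^ 3 ^ (l - 1) < 2 * n + 4) := by
  obtain ⟨l, h1, h2, h3⟩ := halfDegree_iterate n n
  refine ⟨l, h1, ?_, h2⟩
  rcases h3 with h3 | rfl
  · exact h3
  · have e1 : l + 1 ≤ 3 ^ l := Nat.lt_pow_self (by norm_num)
    have e2 : l + 1 ≤ 2 ^ l := Nat.lt_two_pow_self
    calc 2 * l + 4 ≤ 4 * 2 ^ l * 2 ^ l := by nlinarith
      _ = 4 ^ (l + 1) := by rw [mul_assoc, ← mul_pow, pow_succ']; norm_num
      _ ≤ 4 ^ 3 ^ l := Nat.pow_le_pow_right (by norm_num) e1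

theorem three_pow_le {n l : ℕ} (h : l = 0 ∨ 4 ^ 3 ^ (l - 1) < 2 * n + 4) : 3 ^ l ≤ 6 * n + 12 := by
  rcases l with _ | l
  · simp
  · have h1 : 3 ^ l < 4 ^ 3 ^ l := Nat.lt_pow_self (by norm_num)
    have h2 := h.resolve_left (Nat.succ_ne_zero l)
    rw [Nat.add_sub_cancel] at h2
    rw [pow_succ]
    omega

theorem halfDegree_le (n : ℕ) : halfDegree n ≤ 6 * n + 12 := by
  obtain ⟨l, h1, -, h2⟩ := halfDegree_spec n
  rw [h1]
  exact three_pow_le h2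

/-- Consecutive admissible degrees differ by the factor 3, so the field is larger than necessary by
at most a cubing and its size stays polynomial. -/
theorem two_pow_halfDegree_le (n : ℕ) :
    2 ^ halfDegree n ≤ (2 * n + 4) * (2 * n + 4) * (2 * n + 4) := by
  obtain ⟨l, h1, -, h2⟩ := halfDegree_spec n
  rw [h1]
  rcases l with _ | l
  · simp only [pow_zero, pow_one]
    nlinarith
  · have h2 := h2.resolve_left (Nat.succ_ne_zero l)
    rw [Nat.add_sub_cancel] at h2
    have h3 : 2 ^ 3 ^ l ≤ 2 * n + 4 := (Nat.pow_le_pow_left (by norm_num) _).trans h2.le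
    calc 2 ^ 3 ^ (l + 1) = 2 ^ 3 ^ l * 2 ^ 3 ^ l * 2 ^ 3 ^ l := by ring
      _ ≤ _ := Nat.mul_le_mul (Nat.mul_le_mul h3 h3) h3

theorem monomialCode_lt (n α b j : ℕ) :
    monomialCode (2 ^ halfDegree n) (2 * halfDegree n) α b j < 2 ^ (2 * halfDegree n) := by
  obtain ⟨l, h1, -⟩ := halfDegree_spec n
  obtain ⟨K, _, _, θ, -, hθ, -⟩ := exists_binary_field l
  rw [← h1] at hθ
  exact (monomialCode_spec (h1 ▸ by positivity) hθ α b j).1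

/-- The number of the coefficients of the polynomial that represents a message of length `n`. -/
def numCoeffs (n : ℕ) : ℕ := (n + 2 * halfDegree n - 1) / (2 * halfDegree n)

/-- The length of the code for messages of length `n`. -/
def codeLength (n : ℕ) : ℕ := 4 * numCoeffs n * (2 * (2 * halfDegree n))

/-- The table of the code for messages of length `n`. -/
def codeTable (n : ℕ) : ℕ → ℕ → ℕ := evalTable (2 ^ halfDegree n) (2 * halfDegree n)

theorem halfDegree_pos (n : ℕ) : 0 < halfDegree n := by
  obtain ⟨l, h1, -⟩ := halfDegree_spec n
  rw [h1]; positivity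

theorem le_numCoeffs_mul (n : ℕ) : n ≤ numCoeffs n * (2 * halfDegree n) := by
  have hp := halfDegree_pos n
  set k := 2 * halfDegree n with hk
  have h1 := Nat.div_add_mod (n + k - 1) k
  have h2 := Nat.mod_lt (n + k - 1) (show 0 < k by omega)
  have h3 : numCoeffs n * k = k * ((n + k - 1) / k) := by rw [mul_comm]; rfl
  omega

theorem numCoeffs_mul_le (n : ℕ) : numCoeffs n * (2 * halfDegree n) ≤ n + 2 * halfDegree n :=
  (Nat.div_mul_le_self _ _).trans (by omega)

theorem codeLength_le {n : ℕ} (hn : 1 ≤ n) : codeLength n ≤ 296 * n := by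
  have h1 := numCoeffs_mul_le n
  have h2 := halfDegree_le n
  -- The constant is `296 = 8 * (1 + 2 * (6 + 12))`; the additive terms are absorbed by `n ≥ 1`.
  have h3 : codeLength n = 8 * (numCoeffs n * (2 * halfDegree n)) := by rw [codeLength]; ring
  omega

theorem numCoeffs_pos {n : ℕ} (hn : 1 ≤ n) : 1 ≤ numCoeffs n := by
  by_contra! h
  have := le_numCoeffs_mul n
  rw [Nat.lt_one_iff.1 h] at this
  omega

theorem pow_growth {g : ℕ} (hg : 27 ≤ g) : 12 * (g : ℝ) * (5 / 2) ^ g + 4 ≤ 4 ^ g := by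
  have key : ∀ g : ℕ, 27 ≤ g → 12 * (g : ℝ) + 4 ≤ (8 / 5) ^ g := by
    intro g hg
    induction g, hg using Nat.le_induction with
    | base => norm_num
    | succ g hg ih =>
      have : (27 : ℝ) ≤ g := by exact_mod_cast hg
      rw [pow_succ]; push_cast; linarith
  have h1 : (1 : ℝ) ≤ (5 / 2) ^ g := one_le_pow₀ (by norm_num)
  calc 12 * (g : ℝ) * (5 / 2) ^ g + 4 ≤ (12 * (g : ℝ) + 4) * (5 / 2) ^ g := by linarith
    _ ≤ (8 / 5) ^ g * (5 / 2) ^ g := mul_le_mul_of_nonneg_right (key g hg) (by positivity)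
    _ = 4 ^ g := by rw [← mul_pow]; norm_num

/-- For degrees below 48 only the empty set is counted. Otherwise put `halfDegree n = 3 * g`: the
number of sets is at most `(119 / 100 * (21 / 10)) ^ g ≤ (5 / 2) ^ g`. The number of coefficients is
at least `n / (6 * g)`, and minimality of the degree makes `n` of order at least `4 ^ g`. -/
theorem card_small_subsets_le_numCoeffs {n : ℕ} (hn : 1 ≤ n) :
    #{S ∈ (range (2 * (2 * halfDegree n))).powerset | #S ≤ halfDegree n / 48} ≤ numCoeffs n := by
  rcases lt_or_ge (halfDegree n) 48 with hlt | hge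
  · rw [Nat.div_eq_of_lt hlt]
    refine le_trans ?_ (numCoeffs_pos hn)
    rw [card_le_one]
    intro S hS T hT
    have h1 := card_eq_zero.1 (Nat.le_zero.1 (mem_filter.1 hS).2)
    have h2 := card_eq_zero.1 (Nat.le_zero.1 (mem_filter.1 hT).2)
    rw [h1, h2]
  · obtain ⟨l, h1, -, h2⟩ := halfDegree_spec n
    have hl : 4 ≤ l := by
      by_contra! hl
      have : 3 ^ l ≤ 3 ^ 3 := Nat.pow_le_pow_right (by norm_num) (by omega)
      omega
    obtain ⟨l, rfl⟩ : ∃ l', l = l' + 1 := ⟨l - 1, by omega⟩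
    have h2 := h2.resolve_left (by omega)
    rw [Nat.add_sub_cancel] at h2
    set g := 3 ^ l with hg
    have hg27 : 27 ≤ g := by
      have : 3 ^ 3 ≤ 3 ^ l := Nat.pow_le_pow_right (by norm_num) (by omega)
      omega
    have hdeg : halfDegree n = 3 * g := by rw [h1, pow_succ, mul_comm]
    have hs : halfDegree n / 48 = g / 16 := by omega
    have h3 := card_small_subsets_le (2 * (2 * halfDegree n)) (halfDegree n / 48)
    have h4 : (16 : ℝ) ^ (halfDegree n / 48) ≤ (119 / 100) ^ g := by
      rw [hs]
      calc (16 : ℝ) ^ (g / 16) ≤ ((119 / 100) ^ 16) ^ (g / 16) :=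
            pow_le_pow_left₀ (by norm_num) (by norm_num) _
        _ = (119 / 100) ^ (16 * (g / 16)) := by rw [pow_mul]
        _ ≤ (119 / 100) ^ g := pow_le_pow_right₀ (by norm_num) (by omega)
    have h5 : (17 / 16 : ℝ) ^ (2 * (2 * halfDegree n)) ≤ (21 / 10) ^ g := by
      rw [show 2 * (2 * halfDegree n) = 12 * g by omega, pow_mul]
      exact pow_le_pow_left₀ (by norm_num) (by norm_num) _
    have h6 : (#{S ∈ (range (2 * (2 * halfDegree n))).powerset | #S ≤ halfDegree n / 48} : ℝ)
        ≤ (5 / 2) ^ g := by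
      refine h3.trans ((mul_le_mul h4 h5 (by positivity) (by positivity)).trans ?_)
      rw [← mul_pow]
      exact pow_le_pow_left₀ (by norm_num) (by norm_num) _
    set V := #{S ∈ (range (2 * (2 * halfDegree n))).powerset | #S ≤ halfDegree n / 48}
    have h7 := pow_growth hg27
    have h8 : ((4 : ℝ) ^ g) < 2 * n + 4 := by exact_mod_cast h2
    have h9 : 6 * (g : ℝ) * V < n := by
      have : 12 * (g : ℝ) * V ≤ 12 * (g : ℝ) * (5 / 2) ^ g :=
        mul_le_mul_of_nonneg_left h6 (by positivity)
      linarith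
    have h10 : 6 * g * V < n := by exact_mod_cast h9
    have h11 := le_numCoeffs_mul n
    rw [hdeg] at h11
    by_contra! h12
    have : numCoeffs n * (2 * (3 * g)) ≤ V * (2 * (3 * g)) := Nat.mul_le_mul_right _ h12.le
    have : V * (2 * (3 * g)) = 6 * g * V := by ring
    omega

/-- The code has relative distance at least `1 / 384`. -/
theorem weight_codeTable {n : ℕ} {x : ℕ → ZMod 2} (hx : ∃ u < n, x u ≠ 0) :
    codeLength n ≤ 384 * weight (codeLength n) (tableMap n (codeTable n) x) := by
  have hn : 1 ≤ n := by obtain ⟨u, hu, -⟩ := hx; omega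
  obtain ⟨l, h1, h2, -⟩ := halfDegree_spec n
  have hp := halfDegree_pos n
  have h3 : 4 * numCoeffs n ≤ 2 ^ (2 * halfDegree n) := by
    rw [pow_mul, h1]
    refine le_trans ?_ h2
    have h4 := numCoeffs_mul_le n
    have h5 : numCoeffs n ≤ 1 + (n - 1) / 2 := by
      rw [numCoeffs, show n + 2 * halfDegree n - 1 = n - 1 + 2 * halfDegree n by omega,
        Nat.add_div_right _ (by omega)]
      have : (n - 1) / (2 * halfDegree n) ≤ (n - 1) / 2 := Nat.div_le_div_left (by omega) two_pos
      omega
    omega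
  have h4 := weight_evalTable l (by rw [h1]) (le_numCoeffs_mul n) h3
    (card_small_subsets_le_numCoeffs hn) hx
  rw [← h1] at h4
  -- Half of the points have pairs of weight at least `halfDegree n / 48 + 1`, out of `4 *
  -- halfDegree n` bits: this gives `2 * 4 * 48 = 384`.
  have h5 : halfDegree n ≤ 48 * (halfDegree n / 48 + 1) := by omega
  calc codeLength n = 16 * numCoeffs n * halfDegree n := by rw [codeLength]; ring
    _ ≤ 16 * numCoeffs n * (48 * (halfDegree n / 48 + 1)) := Nat.mul_le_mul_left _ h5
    _ = 384 * ((halfDegree n / 48 + 1) * (2 * numCoeffs n)) := by ring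
    _ ≤ _ := Nat.mul_le_mul_left _ h4

end SparseTC

namespace SparseTC
open Finset Ctx

/-! ### The tables are computable in polynomial time -/

namespace PolyTime

variable {Γ : Type} [Ctx Γ]

theorem sqrt' : PolyTime Nat.sqrt := by
  have key : ∀ x n : ℕ, (fun s => if (s + 1) * (s + 1) ≤ x then s + 1 else s)^[n] 0
      = min n (Nat.sqrt x) := fun x n => by
    induction n with
    | zero => simp
    | succ n ih =>
      rw [Function.iterate_succ_apply', ih]
      have h : ∀ s, s + 1 ≤ Nat.sqrt x ↔ (s + 1) * (s + 1) ≤ x := fun s => Nat.le_sqrt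
      simp only [← h]
      split_ifs <;> omega
  have := iterate (Γ := ℕ) (Δ := ℕ) (count := fun x => x) (init := fun _ => 0)
    (step := fun q => if (q.2 + 1) * (q.2 + 1) ≤ q.1 then q.2 + 1 else q.2)
    (by fun_prop) (by fun_prop) (by fun_prop) (B := fun x => x) (PolyBound.size.mono (by simp))
    fun x i hi => by
      simp only [size_nat]
      rw [key]
      omega
  refine (funext fun x => ?_ : (fun x : ℕ => _) = Nat.sqrt) ▸ this
  dsimp only
  rw [key, min_eq_right (Nat.sqrt_le_self x)]

@[fun_prop]
theorem side {f : Γ → ℕ} (hf : PolyTime f) : PolyTime (fun γ => side (f γ)) :=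
  (sqrt'.comp hf).add (const 1)

theorem neighbour' : PolyTime (fun p : (ℕ × ℕ) × ℕ => neighbour p.1.1 p.1.2 p.2) := by
  unfold neighbour
  fun_prop

@[fun_prop]
theorem neighbour {m e v : Γ → ℕ} (hm : PolyTime m) (he : PolyTime e) (hv : PolyTime v) :
    PolyTime (fun γ => neighbour (m γ) (e γ) (v γ)) :=
  neighbour'.comp ((hm.prodMk he).prodMk hv)

/-- Needed for the size of the iterates on arbitrary arguments: `v` need not be a vertex, and `m`
may be 0. -/
theorem neighbour_le (m e v : ℕ) : SparseTC.neighbour m e v ≤ v + m * m + 1 := by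
  rcases Nat.eq_zero_or_pos m with rfl | hm
  · unfold SparseTC.neighbour
    simp only [Nat.div_zero, Nat.mod_zero]
    split_ifs <;> omega
  · have h1 : ∀ a, a % m * m ≤ m * m := fun a => Nat.mul_le_mul_right _ (Nat.mod_lt a hm).le
    have h2 : ∀ a, a % m ≤ m * m := fun a => (Nat.mod_lt a hm).le.trans (Nat.le_mul_self m)
    have h3 := Nat.div_mul_le_self v m
    have h4 := Nat.mod_le v m
    unfold SparseTC.neighbour
    split_ifs
    · have := h1 (v / m + 1); omega
    · have := h2 (v % m + 1); omega
    · have := h1 (v / m + 2 * (v % m)); omega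
    · have := h2 (v % m + 2 * (v / m)); omega
    · omega

theorem walkTable' : PolyTime (fun p : (ℕ × ℕ) × ℕ => walkTable p.1.1 p.1.2 p.2) := by
  have key : ∀ m r v i : ℕ, ((walkStep m)^[i] (r, v)).1 ≤ r ∧
      ((walkStep m)^[i] (r, v)).2 ≤ v + i * (m * m + 1) := fun m r v i => by
    induction i with
    | zero => simp
    | succ i ih =>
      rw [Function.iterate_succ_apply']
      refine ⟨(Nat.div_le_self _ _).trans ih.1, (neighbour_le _ _ _).trans ?_⟩
      rw [Nat.succ_mul]
      omega
  have := iterate (Γ := (ℕ × ℕ) × ℕ) (Δ := ℕ × ℕ) (count := fun p => p.2)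
    (init := fun p => (p.1.2 / (p.1.1 * p.1.1), p.1.2 % (p.1.1 * p.1.1)))
    (step := fun q => walkStep q.1.1.1 q.2)
    (by fun_prop) (by fun_prop) (by unfold walkStep; fun_prop)
    (B := fun p => (size p + size p) + size p * (size p * size p + 1))
    ((PolyBound.size.add .size).add (PolyBound.size.mul ((PolyBound.size.mul .size).add (.const 1))))
    fun p i hi => by
      have h1 := key p.1.1 (p.1.2 / (p.1.1 * p.1.1)) (p.1.2 % (p.1.1 * p.1.1)) i
      have h2 := Nat.div_le_self p.1.2 (p.1.1 * p.1.1)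
      have h3 := Nat.mod_le p.1.2 (p.1.1 * p.1.1)
      have h4 : i * (p.1.1 * p.1.1 + 1) ≤ size p * (size p * size p + 1) := by
        simp only [size_prod, size_nat]
        gcongr <;> omega
      change size ((walkStep p.1.1)^[i] _) ≤ _
      simp only [size_prod, size_nat] at h4 ⊢
      omega
  exact (ite_eq (fst.mod (const 2)) (const 1) (snd.add (const 1)) (const 0) :
    PolyTime fun q : ℕ × ℕ => if q.1 % 2 = 1 then q.2 + 1 else 0).comp this

@[fun_prop]
theorem walkTable {m r j : Γ → ℕ} (hm : PolyTime m) (hr : PolyTime r) (hj : PolyTime j) :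
    PolyTime (fun γ => walkTable (m γ) (r γ) (j γ)) :=
  walkTable'.comp (f := fun γ => ((m γ, r γ), j γ)) ((hm.prodMk hr).prodMk hj)

/-- The test `2 * n + 4 ≤ 4 ^ h` is unaffected if the power is capped at `2 * n + 4`. -/
theorem halfDegree' : PolyTime halfDegree := by
  have := iterate (Γ := ℕ) (Δ := ℕ) (count := fun n => n) (init := fun _ => 1)
    (step := fun q => if 2 * q.1 + 4 ≤ min (2 * q.1 + 4) (4 ^ q.2) then q.2 else 3 * q.2)
    (by fun_prop) (by fun_prop) (by fun_prop) (B := fun n => 6 * n + 12)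
    (((PolyBound.const 6).mul (PolyBound.size.mono (by simp))).add (.const 12)) fun n i hi => by
      obtain ⟨l, h1, h2, -⟩ := halfDegree_iterate n i
      simp only [le_min_iff, le_refl, true_and, size_nat]
      rw [h1]
      exact three_pow_le h2
  simp only [le_min_iff, le_refl, true_and] at this
  exact this

@[fun_prop]
theorem halfDegree {f : Γ → ℕ} (hf : PolyTime f) : PolyTime (fun γ => halfDegree (f γ)) :=
  halfDegree'.comp hf

@[fun_prop]
theorem two_pow_halfDegree {f : Γ → ℕ} (hf : PolyTime f) :
    PolyTime (fun γ => 2 ^ SparseTC.halfDegree (f γ)) := by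
  have : PolyTime fun n => 2 ^ SparseTC.halfDegree n := by
    have h : ∀ n, min ((2 * n + 4) * (2 * n + 4) * (2 * n + 4)) (2 ^ SparseTC.halfDegree n)
        = 2 ^ SparseTC.halfDegree n := fun n => min_eq_right (two_pow_halfDegree_le n)
    exact (funext h : (fun n => _) = _) ▸ (by fun_prop)
  exact this.comp hf

@[fun_prop]
theorem mulGen {q a : Γ → ℕ} (hq : PolyTime q) (ha : PolyTime a) :
    PolyTime (fun γ => mulGen (q γ) (a γ)) := by
  unfold SparseTC.mulGen
  fun_prop

/-- `PolyTime` requires a polynomial bound for all arguments, while the bounds for the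
multiplication hold only for codes of field elements. The first factor is therefore reduced, which
changes nothing for such codes. -/
theorem fieldMul_mod : PolyTime (fun p : (ℕ × ℕ) × ℕ => fieldMul (2 ^ SparseTC.halfDegree p.1.1)
    (2 * SparseTC.halfDegree p.1.1) (p.1.2 % (2 ^ SparseTC.halfDegree p.1.1 *
      2 ^ SparseTC.halfDegree p.1.1)) p.2) := by
  have := iterate (Γ := (ℕ × ℕ) × ℕ) (Δ := (ℕ × ℕ) × ℕ)
    (count := fun p => 2 * SparseTC.halfDegree p.1.1)
    (init := fun p => ((p.1.2 % (2 ^ SparseTC.halfDegree p.1.1 *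
      2 ^ SparseTC.halfDegree p.1.1), p.2), 0))
    (step := fun q => mulStep (2 ^ SparseTC.halfDegree q.1.1.1) q.2)
    (by fun_prop) (by fun_prop) (by unfold mulStep; fun_prop)
    (B := fun p => 2 * (2 ^ SparseTC.halfDegree p.1.1 * 2 ^ SparseTC.halfDegree p.1.1) + size p) ?_ ?_
  · exact snd.comp this
  · have h : PolyTime fun p : (ℕ × ℕ) × ℕ =>
        2 * (2 ^ SparseTC.halfDegree p.1.1 * 2 ^ SparseTC.halfDegree p.1.1) := by fun_prop
    exact (h.1.mono fun p => by simp).add .size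
  · intro p i hi
    have hh := halfDegree_pos p.1.1
    have hq : 2 ^ SparseTC.halfDegree p.1.1 * 2 ^ SparseTC.halfDegree p.1.1
      = 2 ^ (2 * SparseTC.halfDegree p.1.1) := by rw [← pow_add, two_mul]
    obtain ⟨h1, h2, h3⟩ := mulStep_iterate_lt hh (a := p.1.2 % (2 ^ SparseTC.halfDegree p.1.1 *
      2 ^ SparseTC.halfDegree p.1.1)) (b := p.2) (by rw [hq]; exact Nat.mod_lt _ (by positivity)) i
    rw [hq] at h1 h2 h3 ⊢
    change size ((mulStep (2 ^ SparseTC.halfDegree p.1.1))^[i] _) ≤ _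
    simp only [size_prod, size_nat]
    omega

theorem iterate_mulGen : PolyTime (fun p : ℕ × ℕ =>
    (SparseTC.mulGen (2 ^ SparseTC.halfDegree p.1))^[p.2] 1) := by
  refine iterate (Γ := ℕ × ℕ) (Δ := ℕ) (count := fun p => p.2) (init := fun _ => 1)
    (step := fun q => SparseTC.mulGen (2 ^ SparseTC.halfDegree q.1.1) q.2)
    (by fun_prop) (by fun_prop) (by fun_prop)
    (B := fun p => 2 ^ SparseTC.halfDegree p.1 * 2 ^ SparseTC.halfDegree p.1) ?_ ?_
  · have h : PolyTime fun p : ℕ × ℕ => 2 ^ SparseTC.halfDegree p.1 * 2 ^ SparseTC.halfDegree p.1 := by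
      fun_prop
    exact h.1.mono fun p => by simp
  · intro p i hi
    have := monomialCode_lt p.1 0 i 0
    rw [← pow_add, ← two_mul]
    exact this.le

/-- All iterates are codes of field elements, so the reduction in `fieldMul_mod` has no effect on
them. -/
theorem monomialCode' : PolyTime (fun p : ((ℕ × ℕ) × ℕ) × ℕ =>
    monomialCode (2 ^ SparseTC.halfDegree p.1.1.1) (2 * SparseTC.halfDegree p.1.1.1)
      p.1.1.2 p.1.2 p.2) := by
  have key : ∀ n α b i, (fun z => fieldMul (2 ^ SparseTC.halfDegree n) (2 * SparseTC.halfDegree n)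
      (z % (2 ^ SparseTC.halfDegree n * 2 ^ SparseTC.halfDegree n)) α)^[i]
        ((SparseTC.mulGen (2 ^ SparseTC.halfDegree n))^[b] 1)
      = monomialCode (2 ^ SparseTC.halfDegree n) (2 * SparseTC.halfDegree n) α b i :=
    fun n α b i => by
    induction i with
    | zero => rfl
    | succ i ih =>
      rw [Function.iterate_succ_apply', ih, Nat.mod_eq_of_lt]
      · rw [monomialCode, monomialCode, Function.iterate_succ_apply']
      · rw [← pow_add, ← two_mul]
        exact monomialCode_lt n α b i
  have := iterate (Γ := ((ℕ × ℕ) × ℕ) × ℕ) (Δ := ℕ) (count := fun p => p.2)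
    (init := fun p => (SparseTC.mulGen (2 ^ SparseTC.halfDegree p.1.1.1))^[p.1.2] 1)
    (step := fun q => fieldMul (2 ^ SparseTC.halfDegree q.1.1.1.1)
      (2 * SparseTC.halfDegree q.1.1.1.1) (q.2 % (2 ^ SparseTC.halfDegree q.1.1.1.1 *
        2 ^ SparseTC.halfDegree q.1.1.1.1)) q.1.1.1.2)
    (by fun_prop)
    (iterate_mulGen.comp (f := fun p : ((ℕ × ℕ) × ℕ) × ℕ => (p.1.1.1, p.1.2)) (by fun_prop))
    (fieldMul_mod.comp (f := fun q : (((ℕ × ℕ) × ℕ) × ℕ) × ℕ => ((q.1.1.1.1, q.2), q.1.1.1.2))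
      (by fun_prop))
    (B := fun p => 2 ^ SparseTC.halfDegree p.1.1.1 * 2 ^ SparseTC.halfDegree p.1.1.1) ?_ ?_
  · simpa only [key] using this
  · have h : PolyTime fun p : ((ℕ × ℕ) × ℕ) × ℕ =>
        2 ^ SparseTC.halfDegree p.1.1.1 * 2 ^ SparseTC.halfDegree p.1.1.1 := by
      fun_prop
    exact h.1.mono fun p => by simp
  · intro p i hi
    dsimp only
    rw [key, size_nat, ← pow_add, ← two_mul]
    exact (monomialCode_lt _ _ _ _).le

theorem codeTable' : PolyTime (fun p : (ℕ × ℕ) × ℕ => codeTable p.1.1 p.1.2 p.2) := by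
  unfold codeTable evalTable
  refine ite_testBit (monomialCode'.comp (f := fun p : (ℕ × ℕ) × ℕ => (((p.1.1,
    p.1.2 / (2 * (2 * SparseTC.halfDegree p.1.1))), p.2 % (2 * SparseTC.halfDegree p.1.1)),
    p.2 / (2 * SparseTC.halfDegree p.1.1) + if p.1.2 % (2 * (2 * SparseTC.halfDegree p.1.1)) <
      2 * SparseTC.halfDegree p.1.1 then 0 else 1)) (by fun_prop))
    (by fun_prop) (by fun_prop) (by fun_prop)

@[fun_prop]
theorem codeTable {n r j : Γ → ℕ} (hn : PolyTime n) (hr : PolyTime r) (hj : PolyTime j) :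
    PolyTime (fun γ => codeTable (n γ) (r γ) (j γ)) :=
  codeTable'.comp (f := fun γ => ((n γ, r γ), j γ)) ((hn.prodMk hr).prodMk hj)

@[fun_prop]
theorem codeLength {n : Γ → ℕ} (hn : PolyTime n) : PolyTime (fun γ => codeLength (n γ)) := by
  unfold SparseTC.codeLength SparseTC.numCoeffs
  fun_prop

end PolyTime

end SparseTC

namespace SparseTC
open Finset Ctx

/-! ### Tensor powers of a code -/

/-- The table that applies the map with the table `B`, from vectors of length `N` to vectors of
length `R`, to the middle coordinate of a tensor whose last coordinate has the range `Q`. -/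
def liftTable (N R Q : ℕ) (B : ℕ → ℕ → ℕ) (r i : ℕ) : ℕ :=
  if B (r / Q % R) i = 0 then 0 else (r / Q / R * N + (B (r / Q % R) i - 1)) * Q + r % Q + 1

/-- The triple `(p, a, q)` has the mixed-radix number `(p * R + a) * Q + q`; the map acts on each
fibre with fixed `p` and `q`. -/
theorem tableMap_liftTable {N R Q V : ℕ} (B : ℕ → ℕ → ℕ) (x : ℕ → ZMod 2) (p : ℕ) {a q : ℕ}
    (ha : a < R) (hq : q < Q) : tableMap V (liftTable N R Q B) x ((p * R + a) * Q + q)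
      = tableMap V B (fun u => x ((p * N + u) * Q + q)) a := by
  have h1 : ((p * R + a) * Q + q) / Q = p * R + a := by
    rw [mul_comm, Nat.mul_add_div (by omega), Nat.div_eq_of_lt hq, add_zero]
  have h2 : ((p * R + a) * Q + q) % Q = q := by
    rw [mul_comm, Nat.mul_add_mod, Nat.mod_eq_of_lt hq]
  have h3 : (p * R + a) / R = p := by
    rw [mul_comm, Nat.mul_add_div (by omega), Nat.div_eq_of_lt ha, add_zero]
  have h4 : (p * R + a) % R = a := by rw [mul_comm, Nat.mul_add_mod, Nat.mod_eq_of_lt ha]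
  simp only [tableMap_apply, liftTable, h1, h2, h3, h4]
  refine sum_congr rfl fun i _ => ?_
  split_ifs <;> simp_all

theorem tableMap_congr {V : ℕ} {T T' : ℕ → ℕ → ℕ} {x x' : ℕ → ZMod 2} {r : ℕ}
    (h : ∀ i < V, (if T r i = 0 then 0 else x (T r i - 1))
      = if T' r i = 0 then 0 else x' (T' r i - 1)) : tableMap V T x r = tableMap V T' x' r :=
  sum_congr rfl fun i hi => h i (mem_range.1 hi)

/-- The removal of the entries that refer to vanishing coordinates. -/
theorem tableMap_trunc_of_eq_zero {N V : ℕ} (T : ℕ → ℕ → ℕ) {x : ℕ → ZMod 2}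
    (hx : ∀ i, N ≤ i → x i = 0) : tableMap V (trunc N T) x = tableMap V T x := by
  funext r
  refine tableMap_congr fun i _ => ?_
  by_cases h : T r i ≤ N
  · rw [trunc_of_le h]
  · rw [trunc, if_neg h, if_pos rfl, if_neg (by omega), hx _ (by omega)]

theorem tableMap_trunc_of_le {N V : ℕ} {T : ℕ → ℕ → ℕ} {x : ℕ → ZMod 2} {r : ℕ}
    (h : ∀ i, T r i ≤ N) : tableMap V (trunc N T) x r = tableMap V T x r :=
  tableMap_congr fun i _ => by rw [trunc_of_le (h i)]

theorem trunc_compTable (N V : ℕ) (T₂ T₁ : ℕ → ℕ → ℕ) :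
    trunc N (compTable V T₂ T₁) = compTable V T₂ (trunc N T₁) := by
  funext r i
  unfold trunc compTable
  split_ifs <;> simp_all

theorem liftTable_le {N R Q P : ℕ} {B : ℕ → ℕ → ℕ} (hB : ∀ r i, B r i ≤ N) {r : ℕ}
    (hr : r < P * R * Q) (i : ℕ) : liftTable N R Q B r i ≤ P * (N * Q) := by
  have hQ : 0 < Q := Nat.pos_of_ne_zero fun h => by simp [h] at hr
  have h1 : r / Q < P * R := (Nat.div_lt_iff_lt_mul hQ).2 hr
  have hR : 0 < R := Nat.pos_of_ne_zero fun h => by simp [h] at h1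
  have h2 : r / Q / R < P := (Nat.div_lt_iff_lt_mul hR).2 h1
  have h3 := Nat.mod_lt r hQ
  have h4 := hB (r / Q % R) i
  unfold liftTable
  split_ifs with h0
  · exact Nat.zero_le _
  · have h5 : B (r / Q % R) i - 1 + 1 ≤ N := by omega
    calc (r / Q / R * N + (B (r / Q % R) i - 1)) * Q + r % Q + 1
        ≤ (r / Q / R * N + (B (r / Q % R) i - 1)) * Q + Q := by omega
      _ = (r / Q / R * N + (B (r / Q % R) i - 1 + 1)) * Q := by ring
      _ ≤ (r / Q / R * N + N) * Q := by gcongr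
      _ = (r / Q / R + 1) * (N * Q) := by ring
      _ ≤ P * (N * Q) := Nat.mul_le_mul_right _ h2

/-- The numbers of coordinates in the construction of the tensor power of a map, for vectors of
length `n`. -/
def tensorDim (n N R d j : ℕ) : ℕ := if j = 0 then n else R ^ j * N ^ (d - j)

/-- The tables in the construction of the tensor power of a map. -/
def tensorTable (N R d : ℕ) (B : ℕ → ℕ → ℕ) (j : ℕ) : ℕ → ℕ → ℕ :=
  liftTable N R (N ^ (d - (j + 1))) B

section

variable {n N R V d : ℕ} {B : ℕ → ℕ → ℕ}

/-- The number of the blocks of length `Q` in which a vector does not vanish. -/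
def blockWeight (P Q : ℕ) (y : ℕ → ZMod 2) : ℕ := #{p ∈ range P | ∃ v < Q, y (p * Q + v) ≠ 0}

/-- The truncation in `chainMap` is harmless: at the first stage `x` vanishes from `n` on, and at
the later stages all entries are in range. -/
theorem chainMap_tensor (hB : ∀ r i, B r i ≤ N) {x : ℕ → ZMod 2} (hx : ∀ i, n ≤ i → x i = 0)
    {j : ℕ} (hj : j < d) {r : ℕ} (hr : r < R ^ (j + 1) * N ^ (d - (j + 1))) :
    chainMap (tensorDim n N R d) (fun _ => V) (tensorTable N R d B) (j + 1) x r
      = tableMap V (tensorTable N R d B j)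
          (chainMap (tensorDim n N R d) (fun _ => V) (tensorTable N R d B) j x) r := by
  rw [chainMap, LinearMap.comp_apply]
  rcases j with _ | j
  · rw [tableMap_trunc_of_eq_zero]
    exact hx
  · refine tableMap_trunc_of_le fun i => ?_
    rw [tensorDim, if_neg (Nat.succ_ne_zero j), show d - (j + 1) = d - (j + 1 + 1) + 1 by omega,
      pow_succ' N]
    exact liftTable_le hB (by rwa [← pow_succ]) i

/-- Each stage loses at most a factor 3 in the fraction of non-zero blocks: a non-zero block
contains a non-zero fibre, and the code maps this fibre to non-zero entries in at least a third of
the `R` new blocks. -/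
theorem blockWeight_chainMap (hB : ∀ r i, B r i ≤ N) {x : ℕ → ZMod 2} (hx : ∀ i, n ≤ i → x i = 0)
    (hdist : ∀ y : ℕ → ZMod 2, (∃ u < N, y u ≠ 0) → R ≤ 3 * weight R (tableMap V B y))
    (h0 : ∃ u < N ^ d, x u ≠ 0) {j : ℕ} (hj : j ≤ d) :
    R ^ j ≤ 3 ^ j * blockWeight (R ^ j) (N ^ (d - j))
      (chainMap (tensorDim n N R d) (fun _ => V) (tensorTable N R d B) j x) := by
  induction j with
  | zero =>
    obtain ⟨u, hu, hxu⟩ := h0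
    simp only [pow_zero, one_mul, blockWeight, Nat.one_le_iff_ne_zero, card_ne_zero]
    exact ⟨0, mem_filter.2 ⟨by simp, u, by simpa using hu, by simpa [chainMap] using hxu⟩⟩
  | succ j ih =>
    have ih := ih (by omega)
    have hstep := fun r => chainMap_tensor (R := R) (V := V) hB hx (show j < d by omega) (r := r)
    set y := chainMap (tensorDim n N R d) (fun _ => V) (tensorTable N R d B) j x
    set z := chainMap (tensorDim n N R d) (fun _ => V) (tensorTable N R d B) (j + 1) x
    set Q := N ^ (d - (j + 1)) with hQ
    have hNQ : N ^ (d - j) = N * Q := by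
      rw [hQ, ← pow_succ']
      congr 1
      omega
    rw [hNQ] at ih
    have key : ∀ p < R ^ j, (if ∃ v < N * Q, y (p * (N * Q) + v) ≠ 0 then 1 else 0) * R
        ≤ 3 * ∑ a ∈ range R, if ∃ v < Q, z ((p * R + a) * Q + v) ≠ 0 then 1 else 0 := by
      intro p hp
      split_ifs with h
      -- The fibre through the non-zero entry `v` consists of the entries congruent to `v` modulo
      -- `Q`.
      · obtain ⟨v, hv, hyv⟩ := h
        have hQ0 : 0 < Q := Nat.pos_of_ne_zero fun h => by simp [h] at hv
        have hq := Nat.mod_lt v hQ0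
        rw [one_mul]
        refine (hdist (fun u => y ((p * N + u) * Q + v % Q))
          ⟨v / Q, (Nat.div_lt_iff_lt_mul hQ0).2 hv, ?_⟩).trans ?_
        · have h1 := Nat.div_add_mod' v Q
          rwa [show (p * N + v / Q) * Q + v % Q = p * (N * Q) + v by
            rw [add_mul, add_assoc, h1]; ring]
        · rw [weight, card_filter]
          refine Nat.mul_le_mul_left _ (sum_le_sum fun a ha => ?_)
          split_ifs with h1 h2
          · exact le_rfl
          · refine absurd ⟨v % Q, hq, ?_⟩ h2
            rw [hstep _ ?_, tensorTable, tableMap_liftTable B y p (mem_range.1 ha) hq]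
            · exact h1
            · have h3 : p * R + a < R ^ (j + 1) := by
                have := mem_range.1 ha
                calc p * R + a < (p + 1) * R := by rw [add_mul]; omega
                  _ ≤ R ^ j * R := Nat.mul_le_mul_right _ hp
                  _ = R ^ (j + 1) := (pow_succ R j).symm
              calc (p * R + a) * Q + v % Q < (p * R + a + 1) * Q := by rw [add_mul _ 1]; omega
                _ ≤ R ^ (j + 1) * Q := Nat.mul_le_mul_right _ h3
          · exact Nat.zero_le _
          · exact le_rfl
      · simp
    calc R ^ (j + 1) = R ^ j * R := pow_succ R j
      _ ≤ 3 ^ j * blockWeight (R ^ j) (N * Q) y * R := Nat.mul_le_mul_right _ ih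
      _ = 3 ^ j * ∑ p ∈ range (R ^ j),
          (if ∃ v < N * Q, y (p * (N * Q) + v) ≠ 0 then 1 else 0) * R := by
        rw [blockWeight, card_filter, mul_assoc, sum_mul]
      _ ≤ 3 ^ j * ∑ p ∈ range (R ^ j),
          3 * ∑ a ∈ range R, if ∃ v < Q, z ((p * R + a) * Q + v) ≠ 0 then 1 else 0 :=
        Nat.mul_le_mul_left _ (sum_le_sum fun p hp => key p (mem_range.1 hp))
      _ = 3 ^ (j + 1) * blockWeight (R ^ (j + 1)) Q z := by
        rw [blockWeight, card_filter, pow_succ R, sum_range_mul, ← mul_sum, pow_succ, mul_assoc]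

/-- The tensor power of a code of relative distance `1 / 3` has relative distance `1 / 3 ^ d`. -/
theorem weight_chainMap_tensor (hB : ∀ r i, B r i ≤ N) {x : ℕ → ZMod 2}
    (hx : ∀ i, n ≤ i → x i = 0)
    (hdist : ∀ y : ℕ → ZMod 2, (∃ u < N, y u ≠ 0) → R ≤ 3 * weight R (tableMap V B y))
    (h0 : ∃ u < N ^ d, x u ≠ 0) :
    R ^ d ≤ 3 ^ d * weight (R ^ d)
      (chainMap (tensorDim n N R d) (fun _ => V) (tensorTable N R d B) d x) := by
  have := blockWeight_chainMap hB hx hdist h0 le_rfl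
  rw [Nat.sub_self, pow_zero] at this
  simpa [blockWeight, weight] using this

end

theorem chainMap_congr {D D' W W' : ℕ → ℕ} {T T' : ℕ → ℕ → ℕ → ℕ} {k : ℕ}
    (h : ∀ j < k, D j = D' j ∧ W j = W' j ∧ T j = T' j) :
    chainMap D W T k = chainMap D' W' T' k := by
  induction k with
  | zero => rfl
  | succ k ih =>
    obtain ⟨h1, h2, h3⟩ := h k (Nat.lt_succ_self k)
    rw [chainMap, chainMap, ih fun j hj => h j (by omega), h1, h2, h3]

/-- The numbers of coordinates in the composition of a tensor power with a random walk. -/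
def balancedDim (n N R d t j : ℕ) : ℕ :=
  if j < d then tensorDim n N R d j else walkRows (R ^ d) t

/-- The widths of the tables in the composition of a tensor power with a random walk. -/
def balancedWidth (V d t j : ℕ) : ℕ := if j + 1 < d then V else t * V

/-- The tables in the composition of a tensor power with a random walk. -/
def balancedTable (N R V d : ℕ) (B : ℕ → ℕ → ℕ) (j : ℕ) : ℕ → ℕ → ℕ :=
  if j + 1 < d then tensorTable N R d B j else
    compTable V (trunc (R ^ d) (walkTable (side (R ^ d)))) (tensorTable N R d B j)

/-- The walk is merged with the last stage of the tensor power instead of being a stage of its own,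
which keeps the depth at `2 * d`. -/
theorem chainMap_balanced {d : ℕ} (hd : 1 ≤ d) (n N R V t : ℕ) (B : ℕ → ℕ → ℕ) (x : ℕ → ZMod 2) :
    chainMap (balancedDim n N R d t) (balancedWidth V d t) (balancedTable N R V d B) d x
      = tableMap t (trunc (R ^ d) (walkTable (side (R ^ d))))
          (chainMap (tensorDim n N R d) (fun _ => V) (tensorTable N R d B) d x) := by
  obtain ⟨d, rfl⟩ : ∃ e, d = e + 1 := ⟨d - 1, by omega⟩
  have h1 : chainMap (balancedDim n N R (d + 1) t) (balancedWidth V (d + 1) t)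
      (balancedTable N R V (d + 1) B) d
      = chainMap (tensorDim n N R (d + 1)) (fun _ => V) (tensorTable N R (d + 1) B) d :=
    chainMap_congr fun j hj => ⟨if_pos (by omega), if_pos (by omega), if_pos (by omega)⟩
  rw [chainMap, LinearMap.comp_apply, h1, balancedDim, if_pos (Nat.lt_succ_self d), balancedWidth,
    if_neg (lt_irrefl _), balancedTable, if_neg (lt_irrefl _), trunc_compTable,
    tableMap_compTable]
  rfl

/-- The composition of a tensor power with a random walk is a balanced code. -/
theorem weight_chainMap_balanced {n N R V d l : ℕ} {B : ℕ → ℕ → ℕ} (hd : 1 ≤ d) (hR : 1 ≤ R)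
    (hB : ∀ r i, B r i ≤ N) {x : ℕ → ZMod 2} (hx : ∀ i, n ≤ i → x i = 0)
    (hdist : ∀ y : ℕ → ZMod 2, (∃ u < N, y u ≠ 0) → R ≤ 3 * weight R (tableMap V B y))
    (h0 : ∃ u < N ^ d, x u ≠ 0) :
    (1 / 2 - (1 / 2) ^ l / 2) * walkRows (R ^ d) (walkLength l (3 ^ d)) ≤
      (weight (walkRows (R ^ d) (walkLength l (3 ^ d)))
        (chainMap (balancedDim n N R d (walkLength l (3 ^ d)))
          (balancedWidth V d (walkLength l (3 ^ d))) (balancedTable N R V d B) d x) : ℝ) ∧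
    (weight (walkRows (R ^ d) (walkLength l (3 ^ d)))
        (chainMap (balancedDim n N R d (walkLength l (3 ^ d)))
          (balancedWidth V d (walkLength l (3 ^ d))) (balancedTable N R V d B) d x) : ℝ) ≤
      1 / 2 * walkRows (R ^ d) (walkLength l (3 ^ d)) := by
  rw [chainMap_balanced hd]
  have h3 : (0 : ℝ) < 3 ^ d := by positivity
  refine weight_walk_bounds (Nat.one_le_pow _ _ hR) l (3 ^ d) (ρ := 1 / 3 ^ d) ?_ (by positivity)
    ?_ _ ?_
  · push_cast; rw [mul_one_div_cancel h3.ne']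
  · rw [div_le_one h3]; exact one_le_pow₀ (by norm_num)
  · have := weight_chainMap_tensor hB hx hdist h0
    rw [one_div_mul_eq_div, div_le_iff₀' h3]
    exact_mod_cast this

/-! ### The base code -/

/-- The length of the walks in the construction of the base code. -/
@[irreducible]
def baseWalk : ℕ := walkLength 2 384

theorem baseWalk_pos : 1 ≤ baseWalk := by
  rw [baseWalk]
  exact Nat.le_add_left _ _

/-- A bound for the ratio of the length of the base code to the length of the messages. -/
@[irreducible]
def baseRatio : ℕ := 1184 * 16 ^ baseWalk

theorem baseRatio_pos : 1 ≤ baseRatio := by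
  rw [baseRatio, Nat.one_le_iff_ne_zero]
  positivity

/-- The length of the base code for messages of length `n`. -/
def baseLength (n : ℕ) : ℕ := walkRows (codeLength n) baseWalk

/-- The table of the base code for messages of length `n`. -/
def baseTable (n : ℕ) : ℕ → ℕ → ℕ :=
  compTable n (trunc (codeLength n) (walkTable (side (codeLength n)))) (trunc n (codeTable n))

theorem baseTable_le (n r i : ℕ) : baseTable n r i ≤ n := by
  unfold baseTable
  rw [← trunc_compTable]
  exact trunc_le _ _ _ _

theorem codeLength_pos {n : ℕ} (hn : 1 ≤ n) : 1 ≤ codeLength n := by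
  have h1 := numCoeffs_pos hn
  have h2 := halfDegree_pos n
  unfold codeLength
  exact Nat.mul_pos (by omega) (by omega)

theorem baseLength_le {n : ℕ} (hn : 1 ≤ n) : baseLength n ≤ baseRatio * n := by
  rw [baseRatio]
  refine (walkRows_le (codeLength_pos hn) _).trans ?_
  calc 4 * codeLength n * 16 ^ baseWalk ≤ 4 * (296 * n) * 16 ^ baseWalk := by
        gcongr; exact codeLength_le hn
    _ = 1184 * 16 ^ baseWalk * n := by ring

theorem weight_baseTable {n : ℕ} {x : ℕ → ZMod 2} (hx : ∃ u < n, x u ≠ 0) :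
    baseLength n ≤ 3 * weight (baseLength n) (tableMap (baseWalk * n) (baseTable n) x) := by
  have hn : 1 ≤ n := by obtain ⟨u, hu, -⟩ := hx; omega
  have h1 := weight_codeTable hx
  have h2 : tableMap n (trunc n (codeTable n)) x = tableMap n (codeTable n) x := by
    funext r
    refine tableMap_congr fun i hi => ?_
    rw [trunc_of_le (show codeTable n r i ≤ n from (evalTable_le _ _ _ _).trans hi)]
  -- For `l = 2` the relative weight is at least `1 / 2 - 1 / 8 = 3 / 8`, which exceeds 1/3.
  have h3 := (weight_walk_bounds (codeLength_pos hn) 2 384 (ρ := 1 / 384) (by norm_num)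
    (by norm_num) (by norm_num) (tableMap n (codeTable n) x) (by
      rw [one_div_mul_eq_div, div_le_iff₀' (by norm_num)]
      exact_mod_cast h1)).1
  rw [← h2, ← tableMap_compTable, ← baseTable, ← baseWalk, ← baseLength] at h3
  have h4 : (0 : ℝ) ≤ baseLength n := Nat.cast_nonneg _
  have h5 : (baseLength n : ℝ) ≤
      3 * weight (baseLength n) (tableMap (baseWalk * n) (baseTable n) x) := by
    linarith
  exact_mod_cast h5

end SparseTC

namespace SparseTC
open Finset Ctx

/-! ### The algorithms -/

/-- The least number whose `d`-th power is at least `n`. -/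
def rootCeil (n d : ℕ) : ℕ := (fun N => if n ≤ N ^ d then N else N + 1)^[n] 1

theorem rootCeil_iterate (n d i : ℕ) :
    1 ≤ (fun N => if n ≤ N ^ d then N else N + 1)^[i] 1 ∧
    (fun N => if n ≤ N ^ d then N else N + 1)^[i] 1 ≤ i + 1 ∧
    ((fun N => if n ≤ N ^ d then N else N + 1)^[i] 1 = 1 ∨
      ((fun N => if n ≤ N ^ d then N else N + 1)^[i] 1 - 1) ^ d < n) ∧
    (n ≤ (fun N => if n ≤ N ^ d then N else N + 1)^[i] 1 ^ d ∨
      (fun N => if n ≤ N ^ d then N else N + 1)^[i] 1 = i + 1) := by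
  induction i with
  | zero => simp
  | succ i ih =>
    rw [Function.iterate_succ_apply']
    set N := (fun N => if n ≤ N ^ d then N else N + 1)^[i] 1
    by_cases h : n ≤ N ^ d
    · simp only [if_pos h]
      exact ⟨ih.1, by omega, ih.2.2.1, .inl h⟩
    · simp only [if_neg h]
      exact ⟨by omega, by omega, .inr (by simpa using h), .inr (by have := ih.2.2.2.resolve_left h; omega)⟩

theorem rootCeil_pos (n d : ℕ) : 1 ≤ rootCeil n d := (rootCeil_iterate n d n).1

theorem le_rootCeil_pow {n d : ℕ} (hd : 1 ≤ d) : n ≤ rootCeil n d ^ d := by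
  rcases (rootCeil_iterate n d n).2.2.2 with h | h
  · exact h
  · rw [rootCeil, h]
    exact (Nat.le_succ n).trans (Nat.le_self_pow (by omega) _)

/-- If the root exceeds 1, it is at most twice its predecessor, whose power is below `n`. -/
theorem rootCeil_pow_le {n : ℕ} (hn : 1 ≤ n) (d : ℕ) : rootCeil n d ^ d ≤ 2 ^ d * n := by
  rcases (rootCeil_iterate n d n).2.2.1 with h | h
  · rw [rootCeil, h, one_pow]
    exact Nat.mul_pos (by positivity) hn
  · rw [← rootCeil] at h
    rcases (rootCeil_pos n d).eq_or_lt with h1 | h1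
    · rw [← h1, one_pow]
      exact Nat.mul_pos (by positivity) hn
    · calc rootCeil n d ^ d ≤ (2 * (rootCeil n d - 1)) ^ d := Nat.pow_le_pow_left (by omega) d
        _ = 2 ^ d * (rootCeil n d - 1) ^ d := mul_pow _ _ _
        _ ≤ 2 ^ d * n := Nat.mul_le_mul_left _ h.le

namespace PolyTime

variable {Γ : Type} [Ctx Γ]

theorem rootCeil' : PolyTime (fun p : ℕ × ℕ => rootCeil p.1 p.2) := by
  have := iterate (Γ := ℕ × ℕ) (Δ := ℕ) (count := fun p => p.1) (init := fun _ => 1)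
    (step := fun q => if q.1.1 ≤ min q.1.1 (q.2 ^ q.1.2) then q.2 else q.2 + 1)
    (by fun_prop) (by fun_prop) (by fun_prop) (B := fun p => size p + 1)
    (PolyBound.size.add (.const 1)) fun p i hi => by
      have := (rootCeil_iterate p.1 p.2 i).2.1
      simp only [le_min_iff, le_refl, true_and, size_nat, size_prod]
      omega
  simp only [le_min_iff, le_refl, true_and] at this
  exact this

@[fun_prop]
theorem rootCeil {n d : Γ → ℕ} (hn : PolyTime n) (hd : PolyTime d) :
    PolyTime (fun γ => rootCeil (n γ) (d γ)) :=
  rootCeil'.comp (f := fun γ => (n γ, d γ)) (hn.prodMk hd)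

@[fun_prop]
theorem baseLength {n : Γ → ℕ} (hn : PolyTime n) : PolyTime (fun γ => baseLength (n γ)) := by
  unfold SparseTC.baseLength walkRows
  exact (const (16 ^ baseWalk)).mul (by fun_prop)

theorem baseTable' : PolyTime (fun p : (ℕ × ℕ) × ℕ => baseTable p.1.1 p.1.2 p.2) := by
  unfold baseTable compTable SparseTC.trunc
  fun_prop

@[fun_prop]
theorem baseTable {n r i : Γ → ℕ} (hn : PolyTime n) (hr : PolyTime r) (hi : PolyTime i) :
    PolyTime (fun γ => baseTable (n γ) (r γ) (i γ)) :=
  baseTable'.comp (f := fun γ => ((n γ, r γ), i γ)) ((hn.prodMk hr).prodMk hi)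

end PolyTime

/-- An algorithm that computes the least `l` with `v ≤ u * 2 ^ l`, searches for the bound on the
numbers that occur in the description, and writes the description. -/
theorem exists_prog_emits {Γ : Type} [Ctx Γ] {G : (Γ × ℕ) × ℕ → List ℕ} (hG : Emits G)
    {ok : (Γ × ℕ) × ℕ → ℕ} (hok : PolyTime ok) {bound : Γ → ℕ → ℕ}
    (h : ∀ γ l M, ok ((γ, l), M) ≠ 0 ↔ bound γ l ≤ M) :
    ∃ (P : Prog) (C : ℕ), ∀ (γ : Γ) (s : State) (l : ℕ), At s 0 γ →
      s.reg (arity Γ + 1) ≤ s.reg (arity Γ) * 2 ^ l →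
      (∀ i < l, s.reg (arity Γ) * 2 ^ i < s.reg (arity Γ + 1)) →
      ∃ t s', t ≤ 6 * (size γ + l + bound γ l + 2) ^ (C + 1) ∧ Exec P s t s' ∧
        s'.out = s.out ++ G ((γ, l), bound γ l) := by
  obtain ⟨P, C, hP⟩ := hG.exists_search hok 0
  refine ⟨.seq (logProg (arity Γ) (arity Γ + 1) (arity Γ + 2)) P, C, fun γ s l hs h1 h2 => ?_⟩
  obtain ⟨t₁, s₁, ht₁, he₁, hr₁, hk₁, ho₁⟩ :=
    exec_logProg (z := arity Γ + 2) (by omega) (by omega) s h1 h2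
  have hat : At s₁ 0 (γ, l) := by
    refine at_prod.2 ⟨fun i hi => ?_, at_nat.2 (by simpa using hr₁)⟩
    rw [hk₁ _ (by omega) (by omega), hs i hi]
  obtain ⟨t₂, s₂, ht₂, he₂, ho₂⟩ := hP (γ, l) s₁ (bound γ l) hat
    (fun i hi => by
      by_contra hc
      have := (h γ l i).1 hc
      omega)
    ((h γ l _).2 le_rfl)
  refine ⟨_, s₂, ?_, .seq he₁ he₂, by rw [ho₂, ho₁]⟩
  rw [size_prod, size_nat] at ht₂
  dsimp only at ht₂
  set Y := size γ + l + bound γ l + 2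
  have h3 : Y ^ 1 ≤ Y ^ (C + 1) := Nat.pow_le_pow_right (by omega) (by omega)
  have h4 : Y ^ C ≤ Y ^ (C + 1) := Nat.pow_le_pow_right (by omega) (by omega)
  rw [pow_one] at h3
  omega

end SparseTC

/-! ### Circuits with capped parameters, and the programs that write them. -/

namespace SparseTC
open Finset Ctx

/-- The circuit of a random walk, where the numbers are capped at `M`. -/
def walkCircuit (n l k M : ℕ) : Circuit :=
  parityCircuit (min M (16 ^ walkLength l k) * (side n * side n)) (walkLength l k)
    (trunc n (walkTable (side n)))

theorem PolyTime.walkLength {Γ : Type} [Ctx Γ] {l k : Γ → ℕ} (hl : PolyTime l) (hk : PolyTime k) :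
    PolyTime (fun γ => walkLength (l γ) (k γ)) := by
  unfold SparseTC.walkLength
  fun_prop

attribute [fun_prop] PolyTime.walkLength

theorem emits_walkCircuit : Emits (fun q : (((ℕ × ℕ) × ℕ) × ℕ) × ℕ =>
    (walkCircuit q.1.1.1.1 q.1.2 ((q.1.1.2 + q.1.1.1.2 - 1) / q.1.1.1.2) q.2).encode) := by
  unfold walkCircuit
  refine emits_encode_parityCircuit (by fun_prop) (by fun_prop) ?_
  unfold trunc
  fun_prop

theorem walkCircuit_eq {n l k M : ℕ} (h : 16 ^ walkLength l k ≤ M) : walkCircuit n l k M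
    = chainCircuit (fun j => if j = 0 then n else walkRows n (walkLength l k))
        (fun _ => walkLength l k) (fun _ => walkTable (side n)) 1 := by
  rw [walkCircuit, min_eq_right h]
  simp [chainCircuit, walkRows]

/-- The numbers of coordinates in the construction of the balanced code, capped at `M`. -/
def cappedDim (n d l M j : ℕ) : ℕ :=
  if j < d then if j = 0 then n else
    min M (baseLength (rootCeil n d) ^ j) * min M (rootCeil n d ^ (d - j))
  else min M (16 ^ walkLength l (min M (3 ^ d))) * (side (min M (baseLength (rootCeil n d) ^ d)) *
    side (min M (baseLength (rootCeil n d) ^ d)))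

/-- The tables in the construction of the balanced code, where the numbers are capped at `M`. -/
def cappedTable (n d M j r i : ℕ) : ℕ :=
  if j + 1 < d then liftTable (rootCeil n d) (baseLength (rootCeil n d))
    (min M (rootCeil n d ^ (d - (j + 1)))) (baseTable (rootCeil n d)) r i
  else compTable (baseWalk * rootCeil n d) (trunc (min M (baseLength (rootCeil n d) ^ d))
    (walkTable (side (min M (baseLength (rootCeil n d) ^ d)))))
    (liftTable (rootCeil n d) (baseLength (rootCeil n d))
      (min M (rootCeil n d ^ (d - (j + 1)))) (baseTable (rootCeil n d))) r i

/-- The circuit of the balanced code, where the numbers are capped at `M`. -/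
def cappedCircuit (n d l M : ℕ) : Circuit :=
  chainCircuit (cappedDim n d l M)
    (balancedWidth (baseWalk * rootCeil n d) d (walkLength l (min M (3 ^ d)))) (cappedTable n d M) d

namespace PolyTime

variable {Γ : Type} [Ctx Γ]

theorem cappedDim {n d l M j : Γ → ℕ} (hn : PolyTime n) (hd : PolyTime d) (hl : PolyTime l)
    (hM : PolyTime M) (hj : PolyTime j) :
    PolyTime fun γ => cappedDim (n γ) (d γ) (l γ) (M γ) (j γ) := by
  unfold SparseTC.cappedDim
  fun_prop

theorem cappedTable {n d M j r i : Γ → ℕ} (hn : PolyTime n) (hd : PolyTime d)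
    (hM : PolyTime M) (hj : PolyTime j) (hr : PolyTime r) (hi : PolyTime i) :
    PolyTime fun γ => cappedTable (n γ) (d γ) (M γ) (j γ) (r γ) (i γ) := by
  unfold SparseTC.cappedTable compTable liftTable trunc
  fun_prop

end PolyTime

theorem emits_cappedCircuit : Emits (fun q : ((ℕ × ℕ) × ℕ) × ℕ =>
    (cappedCircuit q.1.1.1 q.1.1.2 q.1.2 q.2).encode) := by
  simp only [cappedCircuit, chainCircuit, Circuit.encode_flatMap]
  refine Emits.flatMap (Γ := ((ℕ × ℕ) × ℕ) × ℕ) (count := fun q => q.1.1.2)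
    (G := fun p => (parityCircuit (cappedDim p.1.1.1.1 p.1.1.1.2 p.1.1.2 p.1.2 (p.2 + 1))
      (balancedWidth (baseWalk * rootCeil p.1.1.1.1 p.1.1.1.2) p.1.1.1.2
        (walkLength p.1.1.2 (min p.1.2 (3 ^ p.1.1.1.2))) p.2)
      (trunc (cappedDim p.1.1.1.1 p.1.1.1.2 p.1.1.2 p.1.2 p.2)
        (cappedTable p.1.1.1.1 p.1.1.1.2 p.1.2 p.2))).encode)
    (by fun_prop) (emits_encode_parityCircuit ?_ ?_ ?_)
  · exact .cappedDim (by fun_prop) (by fun_prop) (by fun_prop) (by fun_prop) (by fun_prop)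
  · unfold balancedWidth
    fun_prop
  · unfold trunc
    have h1 : PolyTime fun q : (((((ℕ × ℕ) × ℕ) × ℕ) × ℕ) × ℕ) × ℕ =>
        cappedDim q.1.1.1.1.1.1 q.1.1.1.1.1.2 q.1.1.1.1.2 q.1.1.1.2 q.1.1.2 :=
      .cappedDim (by fun_prop) (by fun_prop) (by fun_prop) (by fun_prop) (by fun_prop)
    have h2 : PolyTime fun q : (((((ℕ × ℕ) × ℕ) × ℕ) × ℕ) × ℕ) × ℕ =>
        cappedTable q.1.1.1.1.1.1 q.1.1.1.1.1.2 q.1.1.1.2 q.1.1.2 q.1.2 q.2 :=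
      .cappedTable (by fun_prop) (by fun_prop) (by fun_prop) (by fun_prop) (by fun_prop)
        (by fun_prop)
    exact .ite_le h2 h1 h2 (.const 0)

/-- A bound for the numbers that occur in the construction of the balanced code. -/
def balancedBound (n d l : ℕ) : ℕ :=
  max (max (3 ^ d) (16 ^ walkLength l (3 ^ d)))
    (max (baseLength (rootCeil n d) ^ d) (rootCeil n d ^ d))

theorem baseLength_pos (n : ℕ) : 1 ≤ baseLength n := walkRows_pos _ _

theorem chainCircuit_congr {D D' W W' : ℕ → ℕ} {T T' : ℕ → ℕ → ℕ → ℕ} {k : ℕ}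
    (hD : ∀ j ≤ k, D j = D' j) (hW : ∀ j, W j = W' j) (hT : ∀ j < k, T j = T' j) :
    chainCircuit D W T k = chainCircuit D' W' T' k := by
  unfold chainCircuit
  refine List.flatMap_congr fun j hj => ?_
  have hj := List.mem_range.1 hj
  rw [hD _ hj, hD _ hj.le, hW, hT j hj]

/-- All the powers that are capped in the construction are bounded by the four in `balancedBound`,
so beyond that number the caps have no effect. -/
theorem cappedCircuit_eq {n d l M : ℕ} (h : balancedBound n d l ≤ M) : cappedCircuit n d l M
    = chainCircuit (balancedDim n (rootCeil n d) (baseLength (rootCeil n d)) d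
        (walkLength l (3 ^ d))) (balancedWidth (baseWalk * rootCeil n d) d (walkLength l (3 ^ d)))
        (balancedTable (rootCeil n d) (baseLength (rootCeil n d)) (baseWalk * rootCeil n d) d
          (baseTable (rootCeil n d))) d := by
  simp only [balancedBound, max_le_iff] at h
  obtain ⟨⟨h1, h2⟩, h3, h4⟩ := h
  have h5 : ∀ j ≤ d, min M (rootCeil n d ^ (d - j)) = rootCeil n d ^ (d - j) := fun j hj =>
    min_eq_right ((Nat.pow_le_pow_right (rootCeil_pos n d) (Nat.sub_le d j)).trans h4)
  have h6 : ∀ j ≤ d, min M (baseLength (rootCeil n d) ^ j) = baseLength (rootCeil n d) ^ j :=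
    fun j hj => min_eq_right ((Nat.pow_le_pow_right (baseLength_pos _) hj).trans h3)
  refine chainCircuit_congr (fun j hj => ?_) (fun j => ?_) (fun j hj => ?_)
  · rw [cappedDim, balancedDim, tensorDim, walkRows, min_eq_right h1, min_eq_right h2, h5 j hj,
      h6 j hj, h6 d le_rfl]
  · rw [min_eq_right h1]
  · funext r i
    rw [cappedTable, balancedTable, h5 _ hj, h6 d le_rfl]
    split_ifs <;> rfl

/-- For `ρ = a / b` the program uses the rounded-up quotient of `b` by `a` as the inverse density.
The comparison of a power with `M` is decided by the power capped at `M + 1`. -/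
theorem exists_prog_walkCircuit : ∃ (P : Prog) (C : ℕ), ∀ (n a b : ℕ) (s : State) (l : ℕ),
    s.reg 0 = n → s.reg 1 = a → s.reg 2 = b →
      s.reg 4 ≤ s.reg 3 * 2 ^ l → (∀ i < l, s.reg 3 * 2 ^ i < s.reg 4) →
      ∃ t s', t ≤ 6 * (n + a + b + l + 16 ^ walkLength l ((b + a - 1) / a) + 2) ^ (C + 1) ∧
        Exec P s t s' ∧ s'.out = s.out ++
          (walkCircuit n l ((b + a - 1) / a) (16 ^ walkLength l ((b + a - 1) / a))).encode := by
  obtain ⟨P, C, hP⟩ := exists_prog_emits (Γ := (ℕ × ℕ) × ℕ) emits_walkCircuit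
    (ok := fun q => if min (q.2 + 1) (16 ^ walkLength q.1.2
      ((q.1.1.2 + q.1.1.1.2 - 1) / q.1.1.1.2)) ≤ q.2 then 1 else 0) (by fun_prop)
    (bound := fun γ l => 16 ^ walkLength l ((γ.2 + γ.1.2 - 1) / γ.1.2))
    (fun γ l M => by simp)
  refine ⟨P, C, fun n a b s l h0 h1 h2 h3 h4 => ?_⟩
  have := hP ((n, a), b) s l (at_prod.2 ⟨at_prod.2 ⟨at_nat.2 h0, at_nat.2 h1⟩, at_nat.2 h2⟩) h3 h4
  simpa using this

theorem exists_prog_balanced : ∃ (P : Prog) (C : ℕ), ∀ (n d : ℕ) (s : State) (l : ℕ),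
    s.reg 0 = n → s.reg 1 = d →
      s.reg 3 ≤ s.reg 2 * 2 ^ l → (∀ i < l, s.reg 2 * 2 ^ i < s.reg 3) →
      ∃ t s', t ≤ 6 * (n + d + l + balancedBound n d l + 2) ^ (C + 1) ∧
        Exec P s t s' ∧ s'.out = s.out ++ (cappedCircuit n d l (balancedBound n d l)).encode := by
  obtain ⟨P, C, hP⟩ := exists_prog_emits (Γ := ℕ × ℕ) emits_cappedCircuit
    -- Once the first test has succeeded, the capped `3 ^ d` in the second test is exact.
    (ok := fun q => if min (q.2 + 1) (3 ^ q.1.1.2) ≤ q.2 then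
      if min (q.2 + 1) (16 ^ walkLength q.1.2 (min q.2 (3 ^ q.1.1.2))) ≤ q.2 then
      if min (q.2 + 1) (baseLength (rootCeil q.1.1.1 q.1.1.2) ^ q.1.1.2) ≤ q.2 then
      if min (q.2 + 1) (rootCeil q.1.1.1 q.1.1.2 ^ q.1.1.2) ≤ q.2 then 1 else 0 else 0 else 0
      else 0) (by fun_prop)
    (bound := fun γ l => balancedBound γ.1 γ.2 l)
    (fun γ l M => by
      have h : ∀ a, min (M + 1) a ≤ M ↔ a ≤ M := fun a => by simp
      simp only [h, balancedBound, max_le_iff]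
      by_cases h1 : 3 ^ γ.2 ≤ M
      · rw [min_eq_right h1]
        split_ifs <;> simp_all
      · simp [h1])
  refine ⟨P, C, fun n d s l h0 h1 h2 h3 => ?_⟩
  have := hP (n, d) s l (at_prod.2 ⟨at_nat.2 h0, at_nat.2 h1⟩) h2 h3
  simpa using this

end SparseTC

namespace SparseTC
open Finset Ctx

/-! ### The parameters of the codes -/

/-- Take the least `l` with `ε * 2 ^ l ≥ 1`. By minimality `2 ^ l < 2 / ε`, and `2 < 1 / ε`. -/
theorem exists_log {ε : ℚ} (h0 : 0 < ε) (h1 : ε < 1 / 2) : ∃ l : ℕ, 1 ≤ l ∧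
    ε.den ≤ ε.num.toNat * 2 ^ l ∧ (∀ i < l, ε.num.toNat * 2 ^ i < ε.den) ∧
    (1 / 2 : ℝ) ^ l ≤ ε ∧ (2 : ℝ) ^ l ≤ (1 / (ε : ℝ)) ^ 2 := by
  have hnum : 0 < ε.num := Rat.num_pos.2 h0
  have hcast : (ε.num.toNat : ℝ) = (ε.num : ℝ) := by
    have := Int.toNat_of_nonneg hnum.le
    exact_mod_cast congrArg (Int.cast : ℤ → ℝ) this
  have hden : (0 : ℝ) < ε.den := by exact_mod_cast ε.den_pos
  have hε : (ε : ℝ) * ε.den = ε.num.toNat := by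
    rw [hcast, Rat.cast_def, div_mul_cancel₀ _ hden.ne']
  have hε0 : (0 : ℝ) < ε := by exact_mod_cast h0
  have hε1 : (ε : ℝ) < 1 / 2 := by
    have : ((ε : ℚ) : ℝ) < ((1 / 2 : ℚ) : ℝ) := by exact_mod_cast h1
    simpa using this
  have key : ∀ i : ℕ, ε.num.toNat * 2 ^ i < ε.den ↔ (ε : ℝ) * 2 ^ i < 1 := fun i => by
    rw [← Nat.cast_lt (α := ℝ)]
    push_cast
    rw [← hε, mul_right_comm, mul_lt_iff_lt_one_left hden]
  have hex : ∃ l, ε.den ≤ ε.num.toNat * 2 ^ l :=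
    ⟨ε.den, Nat.lt_two_pow_self.le.trans (Nat.le_mul_of_pos_left _ (by omega))⟩
  classical
  set l := Nat.find hex
  have hl : ε.den ≤ ε.num.toNat * 2 ^ l := Nat.find_spec hex
  have hlt : ∀ i < l, ε.num.toNat * 2 ^ i < ε.den := fun i hi => not_le.1 (Nat.find_min hex hi)
  have hl1 : (1 : ℝ) ≤ ε * 2 ^ l := not_lt.1 fun h => (not_lt.2 hl) ((key l).2 h)
  have hpos : 1 ≤ l := by
    by_contra! h
    rw [Nat.lt_one_iff.1 h] at hl1
    linarith
  have h2 := (key (l - 1)).1 (hlt _ (by omega))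
  have h3 : (2 : ℝ) ^ l = 2 ^ (l - 1) * 2 := by rw [← pow_succ]; congr 1; omega
  refine ⟨l, hpos, hl, hlt, ?_, ?_⟩
  · rw [one_div, inv_pow, inv_le_iff_one_le_mul₀ (by positivity)]
    exact hl1
  · rw [div_pow, one_pow, le_div_iff₀ (by positivity), h3]
    have : (0 : ℝ) < 2 ^ (l - 1) := by positivity
    nlinarith

theorem relWeight_finMap {D W : ℕ → ℕ} {T : ℕ → ℕ → ℕ → ℕ} {k n m : ℕ} (x : Fin n → ZMod 2) :
    relWeight (finMap D W T k n m x) = weight m (chainMap D W T k (extend n x)) / m := by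
  rw [relWeight, hammingNorm_eq_weight _ (chainMap D W T k (extend n x)) fun i => finMap_apply ..]

theorem extend_of_le {n i : ℕ} (x : Fin n → ZMod 2) (hi : n ≤ i) : extend n x i = 0 :=
  dif_neg (not_lt.2 hi)

/-- A bound for the number of the wires of the circuits. -/
theorem wires_factor_le {b K d l : ℕ} (hl : 1 ≤ l) :
    64 * d * (2 * K) ^ d * 16 ^ walkLength l (3 ^ d) * (walkLength l (3 ^ d) * b) ^ 2
      ≤ 2 ^ ((2 * K + 2 * b + 24589) * (l * 3 ^ d)) := by
  have h3 : d < 3 ^ d := Nat.lt_pow_self (by norm_num)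
  have h4 : 3 ^ d ≤ l * 3 ^ d := Nat.le_mul_of_pos_left _ hl
  have ht : walkLength l (3 ^ d) ≤ 4097 * (l * 3 ^ d) := by
    rw [walkLength, mul_assoc]; omega
  set s := l * 3 ^ d
  set t := walkLength l (3 ^ d)
  have e1 : 64 ≤ 2 ^ (6 * s) := by
    calc 64 = 2 ^ 6 := by norm_num
      _ ≤ _ := Nat.pow_le_pow_right two_pos (by omega)
  have e2 : d ≤ 2 ^ s := Nat.lt_two_pow_self.le.trans (Nat.pow_le_pow_right two_pos (by omega))
  have e3 : (2 * K) ^ d ≤ 2 ^ (2 * K * s) := by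
    calc (2 * K) ^ d ≤ (2 ^ (2 * K)) ^ d := Nat.pow_le_pow_left Nat.lt_two_pow_self.le d
      _ = 2 ^ (2 * K * d) := (pow_mul ..).symm
      _ ≤ _ := Nat.pow_le_pow_right two_pos (Nat.mul_le_mul_left _ (by omega))
  have e4 : 16 ^ t ≤ 2 ^ (16388 * s) := by
    calc 16 ^ t = 2 ^ (4 * t) := by rw [pow_mul]; norm_num
      _ ≤ _ := Nat.pow_le_pow_right two_pos (by omega)
  have e5 : t ≤ 2 ^ (4097 * s) :=
    Nat.lt_two_pow_self.le.trans (Nat.pow_le_pow_right two_pos (by omega))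
  have e6 : b ≤ 2 ^ (b * s) :=
    Nat.lt_two_pow_self.le.trans (Nat.pow_le_pow_right two_pos (Nat.le_mul_of_pos_right _ (by omega)))
  calc 64 * d * (2 * K) ^ d * 16 ^ t * (t * b) ^ 2
      ≤ 2 ^ (6 * s) * 2 ^ s * 2 ^ (2 * K * s) * 2 ^ (16388 * s)
        * (2 ^ (4097 * s) * 2 ^ (b * s)) ^ 2 := by gcongr
    _ = 2 ^ ((2 * K + 2 * b + 24589) * s) := by
      rw [← pow_add, ← pow_add, ← pow_add, ← pow_add, ← pow_mul, ← pow_add]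
      congr 1
      ring

section

variable {n N R K b d t : ℕ}

/-- One bound serves for all stages, although the factors `16 ^ t` and `t` arise only at the last
one. Each intermediate dimension is at most `K ^ d * N ^ d`. -/
theorem wires_balanced_le {B : ℕ → ℕ → ℕ} (hR1 : 1 ≤ R)
    (hR : R ≤ K * N) (hK : 1 ≤ K) (ht : 1 ≤ t) :
    (chainCircuit (balancedDim n N R d t) (balancedWidth (b * N) d t)
      (balancedTable N R (b * N) d B) d).wires
      ≤ d * (16 * (K ^ d * N ^ d) * 16 ^ t * (t * b * N) ^ 2) := by
  refine (wires_chainCircuit_le _ _ _ _).trans ?_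
  refine (sum_le_card_nsmul (range d) _ _ fun j hj => ?_).trans (by rw [card_range, smul_eq_mul])
  have hj := mem_range.1 hj
  have h1 : ∀ i ≤ d, R ^ i * N ^ (d - i) ≤ K ^ d * N ^ d := fun i hi => by
    calc R ^ i * N ^ (d - i) ≤ (K * N) ^ i * N ^ (d - i) := by gcongr
      _ = K ^ i * N ^ (i + (d - i)) := by rw [mul_pow, pow_add]; ring
      _ ≤ K ^ d * N ^ d := by
        rw [Nat.add_sub_cancel' hi]
        exact Nat.mul_le_mul_right _ (Nat.pow_le_pow_right hK hi)
  by_cases h : j + 1 < d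
  · rw [balancedDim, if_pos h, tensorDim, if_neg (Nat.succ_ne_zero j), balancedWidth, if_pos h]
    have h2 : 4 ≤ 16 * 16 ^ t := by
      have := Nat.one_le_pow t 16 (by norm_num)
      omega
    have h3 : b * N ≤ t * b * N := by
      rw [mul_assoc]
      exact Nat.le_mul_of_pos_left _ ht
    calc 4 * (R ^ (j + 1) * N ^ (d - (j + 1))) * (b * N) ^ 2
        ≤ 16 * 16 ^ t * (K ^ d * N ^ d) * (t * b * N) ^ 2 := by
          exact Nat.mul_le_mul (Nat.mul_le_mul h2 (h1 _ h.le)) (Nat.pow_le_pow_left h3 2)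
      _ = _ := by ring
  · rw [balancedDim, if_neg h, balancedWidth, if_neg h]
    have h2 := h1 d le_rfl
    rw [Nat.sub_self, pow_zero, mul_one] at h2
    calc 4 * walkRows (R ^ d) t * (t * (b * N)) ^ 2
        ≤ 4 * (4 * (K ^ d * N ^ d) * 16 ^ t) * (t * (b * N)) ^ 2 := by
          gcongr
          refine (walkRows_le (Nat.one_le_pow _ _ hR1) t).trans ?_
          gcongr
      _ = _ := by ring

theorem dim_balanced_le (hR1 : 1 ≤ R) (hR : R ≤ K * N) :
    walkRows (R ^ d) t ≤ 4 * (K ^ d * N ^ d) * 16 ^ t := by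
  refine (walkRows_le (Nat.one_le_pow _ _ hR1) t).trans ?_
  gcongr
  rw [← mul_pow]
  exact Nat.pow_le_pow_left hR d

end

/-- The constant in the exponents of the bounds for the balanced code. -/
def balancedExponent : ℕ := 2 * baseRatio + 2 * baseWalk + 24589

/-- All factors that do not depend on `n` are absorbed by one power of 2, by `wires_factor_le`. The
4 in front of the wires will cancel the square of the 2 in `rootCeil_le_rpow`. -/
theorem balanced_bounds {n d l : ℕ} (hn : 1 ≤ n) (hd : 1 ≤ d) (hl : 1 ≤ l) :
    walkRows (baseLength (rootCeil n d) ^ d) (walkLength l (3 ^ d))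
      ≤ n * 2 ^ (balancedExponent * (l * 3 ^ d)) ∧
    balancedBound n d l ≤ n * 2 ^ (balancedExponent * (l * 3 ^ d)) ∧
    4 * (cappedCircuit n d l (balancedBound n d l)).wires
      ≤ n * rootCeil n d ^ 2 * 2 ^ (balancedExponent * (l * 3 ^ d)) := by
  rw [cappedCircuit_eq le_rfl, balancedBound]
  have hZ : _ ≤ 2 ^ (balancedExponent * (l * 3 ^ d)) :=
    wires_factor_le (b := baseWalk) (K := baseRatio) hl
  have hb := baseWalk_pos
  have hK := baseRatio_pos
  have hN := rootCeil_pos n d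
  have hNd := rootCeil_pow_le hn d
  have hR1 := baseLength_pos (rootCeil n d)
  have hR := baseLength_le hN
  have hw := wires_balanced_le (n := n) (d := d) (b := baseWalk) (t := walkLength l (3 ^ d))
    (B := baseTable (rootCeil n d)) hR1 hR hK (by unfold walkLength; omega)
  have hm := dim_balanced_le (d := d) (t := walkLength l (3 ^ d)) hR1 hR
  have hRd : baseLength (rootCeil n d) ^ d
      ≤ baseRatio ^ d * rootCeil n d ^ d := by
    rw [← mul_pow]
    exact Nat.pow_le_pow_left hR d
  have ht : 1 ≤ walkLength l (3 ^ d) := by unfold walkLength; omega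
  have h3t : 3 ^ d ≤ 16 ^ walkLength l (3 ^ d) := by
    refine le_trans ?_ Nat.lt_two_pow_self.le |>.trans (Nat.pow_le_pow_left (by norm_num) _)
    rw [walkLength]
    have := Nat.le_mul_of_pos_left (3 ^ d) (show 0 < 4096 * l by omega)
    omega
  generalize baseRatio = K at *
  generalize baseWalk = b at *
  generalize hNn : rootCeil n d = N at *
  generalize walkLength l (3 ^ d) = t at *
  set Z := 2 ^ (balancedExponent * (l * 3 ^ d))
  have htb : 1 ≤ (t * b) ^ 2 := Nat.one_le_pow _ _ (Nat.mul_pos ht hb)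
  have h16 : 1 ≤ 16 ^ t := Nat.one_le_pow _ _ (by norm_num)
  have hKd : 1 ≤ K ^ d := Nat.one_le_pow _ _ hK
  have hKN : K ^ d * N ^ d ≤ (2 * K) ^ d * n := by
    calc K ^ d * N ^ d ≤ K ^ d * (2 ^ d * n) := Nat.mul_le_mul_left _ hNd
      _ = _ := by rw [mul_pow]; ring
  have hmain : 4 * (K ^ d * N ^ d) * 16 ^ t ≤ n * Z := by
    calc 4 * (K ^ d * N ^ d) * 16 ^ t ≤ 4 * ((2 * K) ^ d * n) * 16 ^ t * 1 := by
          rw [mul_one]; gcongr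
      _ ≤ (64 * d) * ((2 * K) ^ d * n) * 16 ^ t * (t * b) ^ 2 := by gcongr; omega
      _ = n * (64 * d * (2 * K) ^ d * 16 ^ t * (t * b) ^ 2) := by ring
      _ ≤ n * Z := Nat.mul_le_mul_left _ hZ
  have hNd1 : 1 ≤ N ^ d := Nat.one_le_pow _ _ hN
  have hKN1 : 1 ≤ K ^ d * N ^ d := Nat.mul_pos hKd hNd1
  have h16Z : 16 ^ t ≤ n * Z :=
    (Nat.le_mul_of_pos_left _ (by omega)).trans hmain
  have hKNZ : K ^ d * N ^ d ≤ n * Z := by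
    refine le_trans ?_ hmain
    nlinarith
  refine ⟨hm.trans hmain, max_le (max_le (h3t.trans h16Z) h16Z) (max_le (hRd.trans hKNZ)
    ((Nat.le_mul_of_pos_left _ hKd).trans hKNZ)), ?_⟩
  refine (Nat.mul_le_mul_left _ hw).trans ?_
  calc 4 * (d * (16 * (K ^ d * N ^ d) * 16 ^ t * (t * b * N) ^ 2))
      ≤ 4 * (d * (16 * ((2 * K) ^ d * n) * 16 ^ t * (t * b * N) ^ 2)) := by gcongr
    _ = n * N ^ 2 * (64 * d * (2 * K) ^ d * 16 ^ t * (t * b) ^ 2) := by ring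
    _ ≤ n * N ^ 2 * Z := Nat.mul_le_mul_left _ hZ

theorem rootCeil_le_rpow {n d : ℕ} (hn : 1 ≤ n) (hd : 1 ≤ d) :
    (rootCeil n d : ℝ) ≤ 2 * (n : ℝ) ^ ((d : ℝ)⁻¹) := by
  have hz : 0 ≤ (n : ℝ) ^ ((d : ℝ)⁻¹) := by positivity
  refine (pow_le_pow_iff_left₀ (by positivity) (by positivity) (show d ≠ 0 by omega)).1 ?_
  rw [mul_pow, Real.rpow_inv_natCast_pow (by positivity) (by omega)]
  exact_mod_cast rootCeil_pow_le hn d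

/-- The balanced code: the parameters, and the algorithm that writes the circuit. -/
theorem exists_balanced_code : ∃ c : ℕ, 0 < c ∧ ∃ P : Prog, ∀ d : ℕ, 1 ≤ d → ∃ A k : ℕ,
    ∀ n : ℕ, 1 ≤ n → ∀ ε : ℚ, 0 < ε → ε < 1 / 2 → ∀ s : State, s.reg 0 = n → s.reg 1 = d →
      s.reg 2 = ε.num.toNat → s.reg 3 = ε.den → s.out = [] →
      ∃ (t : ℕ) (C : Circuit) (m : ℕ) (f : (Fin n → ZMod 2) →ₗ[ZMod 2] (Fin m → ZMod 2)),
        (∃ s', Exec P s t s' ∧ s'.out = C.encode) ∧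
        (t : ℝ) ≤ A * ((n : ℝ) + 1 / (ε : ℝ)) ^ k ∧
        C.Computes f ∧
        (m : ℝ) ≤ n * (1 / (ε : ℝ)) ^ (c * 3 ^ d) ∧
        (∀ x : Fin n → ZMod 2, x ≠ 0 →
          1 / 2 - (ε : ℝ) ≤ relWeight (f x) ∧ relWeight (f x) ≤ 1 / 2) ∧
        C.depth = 2 * d ∧
        (C.wires : ℝ) ≤ (n : ℝ) ^ (1 + (c : ℝ) / d) + n * (1 / (ε : ℝ)) ^ (c * 3 ^ d) := by
  obtain ⟨P, C, hP⟩ := exists_prog_balanced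
  have he : 1 ≤ balancedExponent := by unfold balancedExponent; omega
  generalize hE : balancedExponent = E at *
  -- The exponent `2 * E` comes from `2 ^ l ≤ (1 / ε) ^ 2`; it is doubled once more when the wires
  -- are split into two terms.
  refine ⟨4 * E, by omega, P, fun d hd => ⟨6 * 5 ^ (C + 1), (2 * E * 3 ^ d + 1) * (C + 1),
    fun n hn ε h0 h1 s hs0 hs1 hs2 hs3 hs4 => ?_⟩⟩
  obtain ⟨l, hl, hl1, hl2, hl3, hl4⟩ := exists_log h0 h1
  obtain ⟨t, s', ht, hex, hout⟩ := hP n d s l hs0 hs1 (by rwa [hs2, hs3])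
    (by rwa [hs2, hs3])
  obtain ⟨hm, hM, hw⟩ := balanced_bounds hn hd hl
  have hcirc := cappedCircuit_eq (n := n) (d := d) (l := l) le_rfl
  have hdim : balancedDim n (rootCeil n d) (baseLength (rootCeil n d)) d (walkLength l (3 ^ d)) 0
      = n := by rw [balancedDim, if_pos (by omega), tensorDim, if_pos rfl]
  have hdim' : balancedDim n (rootCeil n d) (baseLength (rootCeil n d)) d (walkLength l (3 ^ d)) d
      = walkRows (baseLength (rootCeil n d) ^ d) (walkLength l (3 ^ d)) := by
    rw [balancedDim, if_neg (lt_irrefl d)]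
  have hcomp := computes_chainCircuit
    (balancedDim n (rootCeil n d) (baseLength (rootCeil n d)) d (walkLength l (3 ^ d)))
    (balancedWidth (baseWalk * rootCeil n d) d (walkLength l (3 ^ d)))
    (balancedTable (rootCeil n d) (baseLength (rootCeil n d)) (baseWalk * rootCeil n d) d
      (baseTable (rootCeil n d))) d
  rw [← hcirc, hdim, hdim'] at hcomp
  have hε0 : (0 : ℝ) < ε := by exact_mod_cast h0
  have hx1 : (1 : ℝ) ≤ 1 / ε := by
    rw [le_div_iff₀ hε0]
    have : (ε : ℝ) < (1 / 2 : ℚ) := by exact_mod_cast h1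
    push_cast at this
    linarith
  set x : ℝ := 1 / ε
  rw [hE] at hm hM hw
  have hZ : ((2 ^ (E * (l * 3 ^ d)) : ℕ) : ℝ) ≤ x ^ (2 * E * 3 ^ d) := by
    push_cast
    calc (2 : ℝ) ^ (E * (l * 3 ^ d)) = (2 ^ l) ^ (E * 3 ^ d) := by rw [← pow_mul]; congr 1; ring
      _ ≤ (x ^ 2) ^ (E * 3 ^ d) := pow_le_pow_left₀ (by positivity) hl4 _
      _ = x ^ (2 * E * 3 ^ d) := by rw [← pow_mul]; congr 1; ring
  have hn1 : (1 : ℝ) ≤ n := by exact_mod_cast hn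
  refine ⟨t, _, _, _, ⟨s', hex, by rw [hout, hs4, List.nil_append]⟩, ?_, hcomp, ?_, fun y hy => ?_,
    ?_, ?_⟩
  · have h3 : d < 3 ^ d := Nat.lt_pow_self (by norm_num)
    have h5 : l * 3 ^ d < 2 ^ (E * (l * 3 ^ d)) :=
      (Nat.le_mul_of_pos_left _ he).trans_lt Nat.lt_two_pow_self
    have h6 : 3 ^ d ≤ l * 3 ^ d := Nat.le_mul_of_pos_left _ hl
    have h7 : l ≤ l * 3 ^ d := Nat.le_mul_of_pos_right _ (by positivity)
    have h8 : 2 ^ (E * (l * 3 ^ d)) ≤ n * 2 ^ (E * (l * 3 ^ d)) := Nat.le_mul_of_pos_left _ hn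
    have h9 : n ≤ n * 2 ^ (E * (l * 3 ^ d)) := Nat.le_mul_of_pos_right _ (by positivity)
    -- Each of the five summands is at most `n * 2 ^ (E * (l * 3 ^ d))`.
    have hY : n + d + l + balancedBound n d l + 2 ≤ 5 * (n * 2 ^ (E * (l * 3 ^ d))) := by omega
    have hY' : ((n + d + l + balancedBound n d l + 2 : ℕ) : ℝ)
        ≤ 5 * (n + x) ^ (2 * E * 3 ^ d + 1) := by
      calc ((n + d + l + balancedBound n d l + 2 : ℕ) : ℝ)
          ≤ ((5 * (n * 2 ^ (E * (l * 3 ^ d))) : ℕ) : ℝ) := by exact_mod_cast hY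
        _ = 5 * (n * ((2 ^ (E * (l * 3 ^ d)) : ℕ) : ℝ)) := by push_cast; ring
        _ ≤ 5 * ((n + x) * (n + x) ^ (2 * E * 3 ^ d)) := by
          have e1 : x ^ (2 * E * 3 ^ d) ≤ (n + x) ^ (2 * E * 3 ^ d) :=
            pow_le_pow_left₀ (by linarith) (by linarith) _
          have e2 := hZ.trans e1
          have e3 : (n : ℝ) ≤ n + x := by linarith
          gcongr
        _ = _ := by rw [pow_succ]; ring
    calc (t : ℝ) ≤ ((6 * (n + d + l + balancedBound n d l + 2) ^ (C + 1) : ℕ) : ℝ) := by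
          exact_mod_cast ht
      _ = 6 * ((n + d + l + balancedBound n d l + 2 : ℕ) : ℝ) ^ (C + 1) := by
          rw [Nat.cast_mul, Nat.cast_pow, Nat.cast_ofNat]
      _ ≤ 6 * (5 * (n + x) ^ (2 * E * 3 ^ d + 1)) ^ (C + 1) := by gcongr
      _ = _ := by push_cast; rw [mul_pow, ← pow_mul]; ring
  · calc (walkRows (baseLength (rootCeil n d) ^ d) (walkLength l (3 ^ d)) : ℝ)
        ≤ n * ((2 ^ (E * (l * 3 ^ d)) : ℕ) : ℝ) := by exact_mod_cast hm
      _ ≤ n * x ^ (2 * E * 3 ^ d) := by gcongr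
      _ ≤ n * x ^ (4 * E * 3 ^ d) := by gcongr; first | exact hx1 | omega
  · obtain ⟨i, hi⟩ := Function.ne_iff.1 hy
    have h2 := weight_chainMap_balanced (n := n) (V := baseWalk * rootCeil n d) (d := d) (l := l)
      (N := rootCeil n d) (R := baseLength (rootCeil n d)) hd (baseLength_pos _)
      (baseTable_le (rootCeil n d)) (x := extend n y) (fun i hi => extend_of_le y hi)
      (fun z hz => weight_baseTable hz)
      ⟨i, i.2.trans_le (le_rootCeil_pow hd), by rw [extend_apply]; exact hi⟩
    have hpos : (0 : ℝ) < walkRows (baseLength (rootCeil n d) ^ d) (walkLength l (3 ^ d)) := by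
      exact_mod_cast walkRows_pos _ _
    rw [relWeight_finMap, le_div_iff₀ hpos, div_le_iff₀ hpos]
    refine ⟨le_trans ?_ h2.1, h2.2⟩
    have : (0 : ℝ) ≤ ε := hε0.le
    exact mul_le_mul_of_nonneg_right (by linarith) hpos.le
  · rw [hcirc, depth_chainCircuit]
  · set z : ℝ := (n : ℝ) ^ ((d : ℝ)⁻¹)
    have hz : 0 ≤ z := by positivity
    have hN : (rootCeil n d : ℝ) ≤ 2 * z := rootCeil_le_rpow hn hd
    have hw' : 4 * ((cappedCircuit n d l (balancedBound n d l)).wires : ℝ)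
        ≤ n * (rootCeil n d : ℝ) ^ 2 * ((2 ^ (E * (l * 3 ^ d)) : ℕ) : ℝ) := by exact_mod_cast hw
    have h2 : n * (rootCeil n d : ℝ) ^ 2 * ((2 ^ (E * (l * 3 ^ d)) : ℕ) : ℝ)
        ≤ n * (2 * z) ^ 2 * x ^ (2 * E * 3 ^ d) := by gcongr
    have h3 : n * z ^ 4 = (n : ℝ) ^ (1 + 4 / (d : ℝ)) := by
      rw [Real.rpow_add (by linarith), Real.rpow_one, ← Real.rpow_natCast z, ← Real.rpow_mul
        (by positivity)]
      congr 2
      push_cast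
      ring
    have h4 : (n : ℝ) ^ (1 + 4 / (d : ℝ)) ≤ (n : ℝ) ^ (1 + ((4 * E : ℕ) : ℝ) / d) := by
      refine Real.rpow_le_rpow_of_exponent_le hn1 ?_
      have : (4 : ℝ) ≤ ((4 * E : ℕ) : ℝ) := by exact_mod_cast (by omega : 4 ≤ 4 * E)
      gcongr
    have h5 : x ^ (4 * E * 3 ^ d) = (x ^ (2 * E * 3 ^ d)) ^ 2 := by
      rw [← pow_mul]; congr 1; ring
    rw [h5]
    refine le_trans ?_ (add_le_add h4 le_rfl)
    rw [← h3]
    refine le_of_mul_le_mul_left ((hw'.trans h2).trans ?_) (show (0 : ℝ) < 4 by norm_num)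
    generalize x ^ (2 * E * 3 ^ d) = Y
    -- This square gives `n * z ^ 2 * Y ≤ n * z ^ 4 + n * Y ^ 2`, which separates the power of `n`
    -- from the power of `1 / ε`.
    have h6 : 0 ≤ (n : ℝ) * (z ^ 2 - Y) ^ 2 := by positivity
    have h7 : 0 ≤ (n : ℝ) * (z ^ 4 + Y ^ 2) := by positivity
    linear_combination 2 * h6 + 2 * h7

end SparseTC

/-! ### The amplification algorithm, and the three items together. -/

namespace SparseTC
open Finset Ctx

/-- A single walk table with inverse density `κ`, the rounded-up `1 / ρ`, which is at most `2 / ρ`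
because `ρ ≤ 1`. The constant is `98344 = 2 * 2 * 24586`: one factor from `κ`, one from `2 ^ l ≤ (1
/ ε) ^ 2`, and `24586 = 4 + 6 * 4097` from the wires. -/
theorem exists_amplification : ∃ P : Prog, ∀ ρ : ℚ, 0 < ρ → ρ ≤ 1 → ∃ A k : ℕ, ∀ n : ℕ, 1 ≤ n →
    ∀ ε : ℚ, 0 < ε → ε < 1 / 2 →
    ∃ (t : ℕ) (C : Circuit) (m : ℕ) (f : (Fin n → ZMod 2) →ₗ[ZMod 2] (Fin m → ZMod 2)),
      P.OutputsCircuit [n, ρ.num.toNat, ρ.den, ε.num.toNat, ε.den] t C ∧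
      (t : ℝ) ≤ A * ((n : ℝ) + 1 / (ε : ℝ)) ^ k ∧
      C.Computes f ∧
      (m : ℝ) ≤ n * (1 / (ε : ℝ)) ^ ((98344 : ℝ) / (ρ : ℝ)) ∧
      (∀ x : Fin n → ZMod 2, (ρ : ℝ) ≤ relWeight x →
        1 / 2 - (ε : ℝ) ≤ relWeight (f x) ∧ relWeight (f x) ≤ 1 / 2) ∧
      C.depth = 2 ∧
      (C.wires : ℝ) ≤ n * (1 / (ε : ℝ)) ^ ((98344 : ℝ) / (ρ : ℝ)) := by
  obtain ⟨P, C, hP⟩ := exists_prog_walkCircuit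
  refine ⟨P, fun ρ hρ0 hρ1 => ?_⟩
  set a := ρ.num.toNat with ha
  set b := ρ.den with hb
  set κ := (b + a - 1) / a with hκ
  have hnum : 0 < ρ.num := Rat.num_pos.2 hρ0
  have ha0 : 0 < a := by omega
  have hb0 : 0 < b := ρ.den_pos
  have hbR : (0 : ℝ) < b := by exact_mod_cast hb0
  have haR : (0 : ℝ) < a := by exact_mod_cast ha0
  have hρR : (ρ : ℝ) = a / b := by
    have h1 : ((a : ℤ) : ℝ) = (ρ.num : ℝ) := by rw [ha, Int.toNat_of_nonneg hnum.le]
    rw [Rat.cast_def, ← h1, hb, Int.cast_natCast]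
  have hρ0' : (0 : ℝ) < ρ := by exact_mod_cast hρ0
  have hρ1' : (ρ : ℝ) ≤ 1 := by exact_mod_cast hρ1
  have hab : a ≤ b := by
    rw [hρR, div_le_one hbR] at hρ1'
    exact_mod_cast hρ1'
  have hκ1 : b ≤ κ * a := by
    have h1 := Nat.div_add_mod' (b + a - 1) a
    have h2 := Nat.mod_lt (b + a - 1) ha0
    rw [← hκ] at h1
    omega
  have hκ2 : κ * a ≤ 2 * b := (Nat.div_mul_le_self _ _).trans (by omega)
  have hκ0 : 1 ≤ κ := Nat.pos_of_ne_zero fun h => by rw [h] at hκ1; omega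
  have hκρ : (1 : ℝ) ≤ κ * ρ := by
    rw [hρR, ← mul_div_assoc, one_le_div hbR]
    exact_mod_cast hκ1
  have hκρ' : (κ : ℝ) ≤ 2 / ρ := by
    rw [hρR, div_div_eq_mul_div, le_div_iff₀ haR]
    exact_mod_cast hκ2
  refine ⟨6 * (a + b + 5) ^ (C + 1), 49172 * κ * (C + 1), fun n hn ε h0 h1 => ?_⟩
  obtain ⟨l, hl, hl1, hl2, hl3, hl4⟩ := exists_log h0 h1
  obtain ⟨t, s', ht, hex, hout⟩ :=
    hP n a b (initState [n, a, b, ε.num.toNat, ε.den]) l rfl rfl rfl hl1 hl2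
  rw [← hκ, walkCircuit_eq le_rfl] at hout
  rw [← hκ] at ht
  set w := walkLength l κ with hw
  have hcomp := computes_chainCircuit (fun j => if j = 0 then n else walkRows n w) (fun _ => w)
    (fun _ => walkTable (side n)) 1
  rw [if_pos rfl, if_neg one_ne_zero] at hcomp
  have hε0 : (0 : ℝ) < ε := by exact_mod_cast h0
  have hx1 : (1 : ℝ) ≤ 1 / ε := by
    rw [le_div_iff₀ hε0]
    have : (ε : ℝ) < (1 / 2 : ℚ) := by exact_mod_cast h1
    push_cast at this
    linarith
  set x : ℝ := 1 / ε
  have hn1 : (1 : ℝ) ≤ n := by exact_mod_cast hn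
  have hlκ : 1 ≤ l * κ := Nat.mul_pos hl hκ0
  have hw4 : w ≤ 4097 * (l * κ) := by rw [hw, walkLength, mul_assoc]; omega
  have hw1 : 1 ≤ w := by rw [hw, walkLength]; omega
  have hZ : 16 * 16 ^ w * w ^ 2 ≤ 2 ^ (24586 * (l * κ)) := by
    calc 16 * 16 ^ w * w ^ 2 ≤ 16 * 16 ^ w * (2 ^ w) ^ 2 := by
          gcongr; exact Nat.lt_two_pow_self.le
      _ = 2 ^ (4 + 6 * w) := by
          rw [show (16 : ℕ) = 2 ^ 4 by norm_num, ← pow_mul, ← pow_mul, ← pow_add, ← pow_add]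
          congr 1
          ring
      _ ≤ _ := Nat.pow_le_pow_right two_pos (by omega)
  have hZ' : ((2 ^ (24586 * (l * κ)) : ℕ) : ℝ) ≤ x ^ (49172 * κ) := by
    rw [Nat.cast_pow, Nat.cast_ofNat]
    calc (2 : ℝ) ^ (24586 * (l * κ)) = (2 ^ l) ^ (24586 * κ) := by rw [← pow_mul]; congr 1; ring
      _ ≤ (x ^ 2) ^ (24586 * κ) := pow_le_pow_left₀ (by positivity) hl4 _
      _ = x ^ (49172 * κ) := by rw [← pow_mul]; congr 1; ring
  have hx : x ^ (49172 * κ) ≤ x ^ ((98344 : ℝ) / (ρ : ℝ)) := by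
    rw [← Real.rpow_natCast]
    refine Real.rpow_le_rpow_of_exponent_le hx1 ?_
    push_cast
    calc (49172 : ℝ) * κ ≤ 49172 * (2 / ρ) := by gcongr
      _ = 98344 / ρ := by ring
  have hbound : ∀ M : ℕ, M ≤ n * (16 * 16 ^ w * w ^ 2) →
      (M : ℝ) ≤ n * x ^ ((98344 : ℝ) / (ρ : ℝ)) := fun M hM => by
    calc (M : ℝ) ≤ ((n * 2 ^ (24586 * (l * κ)) : ℕ) : ℝ) := by
          exact_mod_cast hM.trans (Nat.mul_le_mul_left _ hZ)
      _ = n * ((2 ^ (24586 * (l * κ)) : ℕ) : ℝ) := Nat.cast_mul _ _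
      _ ≤ n * x ^ ((98344 : ℝ) / (ρ : ℝ)) := by
          have := hZ'.trans hx
          gcongr
  refine ⟨t, _, _, _, ⟨s', hex, by rw [hout]; rfl⟩, ?_, hcomp, hbound _ ?_, fun y hy => ?_, ?_,
    hbound _ ?_⟩
  · have h2 : 16 ^ w ≤ 2 ^ (24586 * (l * κ)) := by
      refine le_trans ?_ hZ
      have : 1 ≤ w ^ 2 := Nat.one_le_pow _ _ hw1
      nlinarith [Nat.zero_le (16 ^ w)]
    have h3 : l ≤ 2 ^ (24586 * (l * κ)) := by
      have h4 : l ≤ l * κ := Nat.le_mul_of_pos_right _ hκ0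
      exact (by omega : l ≤ 24586 * (l * κ)).trans Nat.lt_two_pow_self.le
    set X : ℝ := n + x
    have hX1 : 1 ≤ X := by linarith
    have hXE : x ^ (49172 * κ) ≤ X ^ (49172 * κ) :=
      pow_le_pow_left₀ (by linarith) (by linarith) _
    have hXn : (n : ℝ) ≤ X ^ (49172 * κ) :=
      (by linarith : (n : ℝ) ≤ X).trans (le_self_pow₀ hX1 (by omega))
    have hX1' : 1 ≤ X ^ (49172 * κ) := one_le_pow₀ hX1
    have h2' : ((16 ^ w : ℕ) : ℝ) ≤ X ^ (49172 * κ) :=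
      (Nat.cast_le.2 h2).trans (hZ'.trans hXE)
    have h3' : (l : ℝ) ≤ X ^ (49172 * κ) := (Nat.cast_le.2 h3).trans (hZ'.trans hXE)
    have hY : ((n + a + b + l + 16 ^ w + 2 : ℕ) : ℝ) ≤ (a + b + 5) * X ^ (49172 * κ) := by
      rw [Nat.cast_add, Nat.cast_add, Nat.cast_add, Nat.cast_add, Nat.cast_add]
      push_cast at h2' ⊢
      nlinarith [mul_le_mul_of_nonneg_left hX1' haR.le, mul_le_mul_of_nonneg_left hX1' hbR.le]
    calc (t : ℝ) ≤ ((6 * (n + a + b + l + 16 ^ w + 2) ^ (C + 1) : ℕ) : ℝ) := by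
          exact_mod_cast ht
      _ = 6 * ((n + a + b + l + 16 ^ w + 2 : ℕ) : ℝ) ^ (C + 1) := by
          rw [Nat.cast_mul, Nat.cast_pow, Nat.cast_ofNat]
      _ ≤ 6 * ((a + b + 5) * X ^ (49172 * κ)) ^ (C + 1) := by gcongr
      _ = _ := by push_cast; rw [mul_pow, ← pow_mul]; ring
  · have : 1 ≤ w ^ 2 := Nat.one_le_pow _ _ hw1
    calc walkRows n w ≤ 4 * n * 16 ^ w * 1 := by rw [mul_one]; exact walkRows_le hn w
      _ ≤ 16 * n * 16 ^ w * w ^ 2 := by gcongr; norm_num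
      _ = _ := by ring
  · have hnpos : (0 : ℝ) < n := by linarith
    have hy' : (ρ : ℝ) * n ≤ weight n (extend n y) := by
      rw [relWeight, le_div_iff₀ hnpos,
        hammingNorm_eq_weight y (extend n y) fun i => (extend_apply y i).symm] at hy
      exact hy
    have h2 := weight_walk_bounds hn l κ hκρ hρ0' hρ1' (extend n y) hy'
    have hpos : (0 : ℝ) < walkRows n w := by exact_mod_cast walkRows_pos _ _
    rw [relWeight_finMap, le_div_iff₀ hpos, div_le_iff₀ hpos]
    refine ⟨le_trans ?_ h2.1, h2.2⟩
    exact mul_le_mul_of_nonneg_right (by linarith) hpos.le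
  · rw [depth_chainCircuit]
  · refine (wires_chainCircuit_le _ _ _ _).trans ?_
    rw [sum_range_one, zero_add, if_neg one_ne_zero]
    calc 4 * walkRows n w * w ^ 2 ≤ 4 * (4 * n * 16 ^ w) * w ^ 2 := by
          gcongr; exact walkRows_le hn w
      _ = _ := by ring

end SparseTC

open SparseTC in
theorem mainTheorem9 :
    -- a code with constant relative distance
    (∃ c : ℝ, 0 < c ∧ ∃ P : Prog, ∀ d : ℕ, 1 ≤ d → ∃ A k : ℕ, ∀ n : ℕ, 1 ≤ n →
      ∃ (t : ℕ) (C : Circuit) (m : ℕ) (f : (Fin n → ZMod 2) →ₗ[ZMod 2] (Fin m → ZMod 2)),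
        P.OutputsCircuit [n, d] t C ∧
        t ≤ A * n ^ k ∧
        C.Computes f ∧
        m ≤ A * n ∧
        (∀ x : Fin n → ZMod 2, x ≠ 0 → 1 / (3 : ℝ) ^ d ≤ relWeight (f x)) ∧
        C.depth = 2 * d ∧
        (C.wires : ℝ) ≤ A * (n : ℝ) ^ (1 + c / d)) ∧
    -- amplification of the distance
    (∃ c : ℝ, 0 < c ∧ ∃ P : Prog, ∀ ρ : ℚ, 0 < ρ → ρ ≤ 1 → ∃ A k : ℕ, ∀ n : ℕ, 1 ≤ n →
      ∀ ε : ℚ, 0 < ε → ε < 1 / 2 →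
      ∃ (t : ℕ) (C : Circuit) (m : ℕ) (f : (Fin n → ZMod 2) →ₗ[ZMod 2] (Fin m → ZMod 2)),
        P.OutputsCircuit [n, ρ.num.toNat, ρ.den, ε.num.toNat, ε.den] t C ∧
        (t : ℝ) ≤ A * ((n : ℝ) + 1 / (ε : ℝ)) ^ k ∧
        C.Computes f ∧
        (m : ℝ) ≤ n * (1 / (ε : ℝ)) ^ (c / (ρ : ℝ)) ∧
        (∀ x : Fin n → ZMod 2, (ρ : ℝ) ≤ relWeight x →
          1 / 2 - (ε : ℝ) ≤ relWeight (f x) ∧ relWeight (f x) ≤ 1 / 2) ∧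
        C.depth = 2 ∧
        (C.wires : ℝ) ≤ n * (1 / (ε : ℝ)) ^ (c / (ρ : ℝ))) ∧
    -- the balanced code
    (∃ c : ℝ, 0 < c ∧ ∃ P : Prog, ∀ d : ℕ, 1 ≤ d → ∃ A k : ℕ, ∀ n : ℕ, 1 ≤ n →
      ∀ ε : ℚ, 0 < ε → ε < 1 / 2 →
      ∃ (t : ℕ) (C : Circuit) (m : ℕ) (f : (Fin n → ZMod 2) →ₗ[ZMod 2] (Fin m → ZMod 2)),
        P.OutputsCircuit [n, d, ε.num.toNat, ε.den] t C ∧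
        (t : ℝ) ≤ A * ((n : ℝ) + 1 / (ε : ℝ)) ^ k ∧
        C.Computes f ∧
        (m : ℝ) ≤ n * (1 / (ε : ℝ)) ^ (c * (3 : ℝ) ^ d) ∧
        (∀ x : Fin n → ZMod 2, x ≠ 0 → |relWeight (f x) - 1 / 2| ≤ (ε : ℝ)) ∧
        C.depth = 2 * d ∧
        (C.wires : ℝ) ≤
          (n : ℝ) ^ (1 + c / d) + n * (1 / (ε : ℝ)) ^ (c * (3 : ℝ) ^ d)) := by
  obtain ⟨c, hc, P, hP⟩ := exists_balanced_code
  have hcR : (0 : ℝ) < c := by exact_mod_cast hc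
  -- Item 1 runs the program of item 3 for `ε = 1 / 6`, whose numerator and denominator are first
  -- put into the registers 2 and 3.
  refine ⟨⟨c, hcR, .seq (.seq (.const 2 1) (.const 3 6)) P, fun d hd => ?_⟩,
    ⟨98344, by norm_num, exists_amplification⟩, ⟨c, hcR, P, fun d hd => ?_⟩⟩
  · obtain ⟨A, k, hA⟩ := hP d hd
    refine ⟨A * 7 ^ k + 6 ^ (c * 3 ^ d) + 2, k, fun n hn => ?_⟩
    have h16 : ((1 / 6 : ℚ) : ℝ) = 1 / 6 := by push_cast; rfl
    obtain ⟨t, C, m, f, ⟨s', hex, hout⟩, ht, hcomp, hm, hdist, hdepth, hw⟩ :=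
      hA n hn (1 / 6) (by norm_num) (by norm_num)
        (((initState [n, d]).setReg 2 1).setReg 3 6) rfl rfl
        (by norm_num [State.setReg]) (by norm_num [State.setReg]) rfl
    have hn1 : (1 : ℝ) ≤ n := by exact_mod_cast hn
    rw [h16, one_div_one_div] at ht hm hw
    rw [h16] at hdist
    refine ⟨1 + 1 + t, C, m, f, ⟨s', .seq (.seq (.const _ _ _) (.const _ _ _)) hex, hout⟩, ?_,
      hcomp, ?_, fun x hx => ?_, hdepth, ?_⟩
    · have h1 : (n : ℝ) + 6 ≤ 7 * n := by linarith
      have h2 : (t : ℝ) ≤ A * (7 ^ k * n ^ k) := by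
        rw [← mul_pow]
        exact ht.trans (by gcongr)
      have h3 : t ≤ A * (7 ^ k * n ^ k) := by exact_mod_cast h2
      have h4 : 1 ≤ n ^ k := Nat.one_le_pow _ _ hn
      calc 1 + 1 + t ≤ 2 * n ^ k + A * (7 ^ k * n ^ k) := by omega
        _ = (A * 7 ^ k + 2) * n ^ k := by ring
        _ ≤ _ := Nat.mul_le_mul_right _ (by rw [add_right_comm]; exact Nat.le_add_right _ _)
    · have h1 : m ≤ n * 6 ^ (c * 3 ^ d) := by exact_mod_cast hm
      rw [mul_comm] at h1
      exact h1.trans (Nat.mul_le_mul_right _ (by omega))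
    · have h1 : (3 : ℝ) ^ 1 ≤ 3 ^ d := pow_le_pow_right₀ (by norm_num) hd
      -- The relative weight is at least `1 / 2 - 1 / 6 = 1 / 3`, which suffices since `d ≥ 1`.
      have h2 : 1 / (3 : ℝ) ^ d ≤ 1 / 3 := one_div_le_one_div_of_le (by norm_num) (by linarith)
      linarith [(hdist x hx).1]
    -- The second term in the number of wires is now linear in `n`, so it only increases the
    -- constant.
    · have h1 : (n : ℝ) ≤ (n : ℝ) ^ (1 + (c : ℝ) / d) := by
        refine Real.self_le_rpow_of_one_le hn1 ?_
        have : (0 : ℝ) ≤ c / d := by positivity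
        linarith
      have h2 : (n : ℝ) * 6 ^ (c * 3 ^ d) ≤ (n : ℝ) ^ (1 + (c : ℝ) / d) * 6 ^ (c * 3 ^ d) :=
        mul_le_mul_of_nonneg_right h1 (by positivity)
      have h3 : (0 : ℝ) ≤ (A * 7 ^ k + 1) * (n : ℝ) ^ (1 + (c : ℝ) / d) := by positivity
      rw [Nat.cast_add, Nat.cast_add, Nat.cast_mul, Nat.cast_pow, Nat.cast_pow, Nat.cast_ofNat,
        Nat.cast_ofNat, Nat.cast_ofNat]
      linarith
  · obtain ⟨A, k, hA⟩ := hP d hd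
    refine ⟨A, k, fun n hn ε h0 h1 => ?_⟩
    obtain ⟨t, C, m, f, ⟨s', hex, hout⟩, ht, hcomp, hm, hdist, hdepth, hw⟩ :=
      hA n hn ε h0 h1 (initState [n, d, ε.num.toNat, ε.den]) rfl rfl rfl rfl rfl
    have hpow : (1 / (ε : ℝ)) ^ ((c : ℝ) * (3 : ℝ) ^ d) = (1 / (ε : ℝ)) ^ (c * 3 ^ d) := by
      rw [← Real.rpow_natCast _ (c * 3 ^ d), Nat.cast_mul, Nat.cast_pow, Nat.cast_ofNat]
    rw [hpow]
    refine ⟨t, C, m, f, ⟨s', hex, hout⟩, ht, hcomp, hm, fun x hx => ?_, hdepth, hw⟩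
    have hε0 : (0 : ℝ) < ε := by exact_mod_cast h0
    rw [abs_le]
    constructor <;> linarith [(hdist x hx).1, (hdist x hx).2]
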